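/- **Theorem (Exponential soundness).** A *circuit game* with input set $\mathcal I$ and output set $\mathcal O$ is a relation $\mathcal R\subseteq\mathcal I\times\mathcal O$ together with a probability distribution $\pi$ on $\mathcal I$; a circuit wins it with probability $p$ if, for $x\sim\pi$, its output $y$ satisfies $(x,y)\in\mathcal R$ with probability $p$. Let $\Sigma=\{0,1\}^8$. *Planting GHZ games.* Let $r,L,\kappa$ be integers with $1\le r\le N'$, $L\ge 3$, and put $M=\lfloor N'/\sqrt r\rfloor\ge 6L$. Fix $r$ disjoint squares of side $M$ in the $N'\times N'$ grid, and in each of them $T\ge 4$ disjoint boxes of side $2L+1$ with $M^2\le\kappa\,T(2L+1)^2$. For each ordered choice of four distinct boxes $b_0,b_1,b_2,b_3$ of a square fix $\lfloor L/3\rfloor$ stars. A star consists of three paths in the square that join $b_0$ to $b_1,b_2,b_3$ and otherwise avoid the four boxes; distinct stars for the same choice of boxes are vertex-disjoint, and a star has total length at most $\kappa M$. The paths are extended inside the boxes, in a fixed way, to pairwise vertex-disjoint simple grid paths $\Gamma_j$ from a vertex $g_j\in b_0$ to a prescribed input location $u_j\in b_j$ ($j=1,2,3$). An instance consists, independently for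 each of the $r$ squares, of four uniformly random distinct boxes, uniformly random $u_j\in b_j$, a uniformly random star among those fixed for these boxes, and a uniformly random query $(x_1,x_2,x_3)\in\{000,011,101,110\}$ of the GHZ game. It is encoded as an element of $\Sigma^{[N']^2}$: each vertex of a path $\Gamma_j$ is told the directions of its neighbors on the path, $g_j$ and $u_j$ are marked as such with their label $j$, $u_j$ is given the question $x_j$, and all other vertices are blank. An output $y\in\Sigma^{[N']^2}$ wins if, in each of the $r$ copies, $$\sum_{j=1}^3\bigl(a_j-\mathrm{cor}_{s_j}(x_j)\bigr)=b_x \pmod 2,$$ where $b_x=0$ if $x=000$ and $b_x=1$ otherwise, $a_j$ is the first bit of $y$ at $u_j$, $s_j\in\mathbb Z_2^2$ is the sum over the vertices $v\neq u_j$ of $\Gamma_j$ of the first two bits of $y$ at $v$, and $\mathrm{cor}_s(0)=s_2$, $\mathrm{cor}_s(1)=s_1+s_2$ (the commutation exponent of $X^{s_1}Z^{s_2}$ with the Pauli $X$, respectively $Y$). The resulting circuit game, with $\mathcal I=\mathcal O=\Sigma^{[N']^2}$, is called a planting of $r$ copies of the GHZ game with parameters $(N',r,L,\kappa)$. *Claim.*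 There are an absolute constant $\kappa$ and, for every integer $N\ge1$, a circuit game $G_N$ which is a planting of $r=r(N)$ copies of the GHZ game with parameters $(N',r,L,\kappa)$, for some $N'=O(N)$ and $L=L(N)$, such that the following hold. * (Completeness) There are absolute constants $a,K_0,R$ such that for every $N\ge 1$ there is a quantum circuit of depth at most $3$ on the $N'\times N'$ grid, with $8+a$ qubits per vertex, whose gates are arbitrary unitaries on at most $K_0$ qubits located at vertices pairwise within distance $R$, which wins $G_N$ with probability $1$. (The 8 input bits of each vertex are loaded into 8 of its qubits, the others start in $|0\rangle$; after the last layer the same 8 qubits are measured in the computational basis to give the output.) * (Soundness) For every fan-in bound $K$ and every $\eta<1/7$ there is a constant $c>0$, depending only on $K$ and $\eta$, such that every classical (deterministic or randomized) circuit over $\Sigma$ with arbitrary gates of fan-in at most $K$, arbitrary fan-out, and depth at most $c\log N$ wins $G_N$ with probability at most $\exp(-\Omega(N^\eta))$, where the constant implicit in $\Omega$ depends only on $K$ and $\eta$. -/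

import Mathlib

/-- The type of vertices of the `N × N` grid. -/
abbrev Grid (N : ℕ) : Type := Fin N × Fin N

namespace Grid

/-- Two grid vertices are within `L∞`-distance `R` (no wrap-around). -/
def Within {N : ℕ} (R : ℕ) (v w : Grid N) : Prop :=
  v.1.val ≤ w.1.val + R ∧ w.1.val ≤ v.1.val + R ∧ v.2.val ≤ w.2.val + R ∧ w.2.val ≤ v.2.val + R

/-- The edges of the grid graph: one coordinate agrees and the other differs by one. -/
def Adj {N : ℕ} (v w : Grid N) : Prop :=
  (v.2 = w.2 ∧ (v.1.val + 1 = w.1.val ∨ w.1.val + 1 = v.1.val)) ∨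
  (v.1 = w.1 ∧ (v.2.val + 1 = w.2.val ∨ w.2.val + 1 = v.2.val))

/-- A simple path in the grid graph, given as the list of its vertices. -/
def IsPath {N : ℕ} (l : List (Grid N)) : Prop := l.Nodup ∧ l.IsChain Adj

/-- The axis-parallel square block of side `s` with lowest corner `c`. -/
def block (N : ℕ) (c : ℕ × ℕ) (s : ℕ) : Set (Grid N) :=
  {v | (c.1 ≤ v.1.val ∧ v.1.val < c.1 + s) ∧ (c.2 ≤ v.2.val ∧ v.2.val < c.2 + s)}

end Grid

/-! ### Circuit games -/

/-- The constant-size alphabet of inputs and outputs: 8-bit strings. -/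
abbrev Letter : Type := Fin 8 → Bool

/-- A circuit game with input set `I` and output set `O`: a relation together with a
probability distribution on the inputs. -/
structure CircuitGame (I O : Type) where
  dist : PMF I
  rel : Set (I × O)

open scoped Classical in
/-- The winning probability of a device which on input `x` returns `y` with probability
`beh x y`, for an input drawn from the distribution of the game. -/
noncomputable def CircuitGame.winProb {I O : Type} [Fintype I] [Fintype O]
    (G : CircuitGame I O) (beh : I → O → ℝ) : ℝ :=
  ∑ x, (G.dist x).toReal * ∑ y, if (x, y) ∈ G.rel then beh x y else 0

/-! ### Classical circuits -/

/-- A classical circuit over the alphabet `A` with input wires `ι`, output wires `ο` and gates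
of fan-in at most `K` (and arbitrary fan-out). The gates are listed in topological order; each of
them computes an arbitrary function of the values of its predecessors. -/
structure ClassicalCircuit (A ι ο : Type) (K : ℕ) where
  size : ℕ
  arity : Fin size → ℕ
  arity_le : ∀ g, arity g ≤ K
  pred : (g : Fin size) → Fin (arity g) → ι ⊕ {h : Fin size // h < g}
  op : (g : Fin size) → (Fin (arity g) → A) → A
  out : ο → ι ⊕ Fin size

namespace ClassicalCircuit

variable {A ι ο : Type} {K : ℕ}

/-- The value computed by a gate. -/
def gateVal (C : ClassicalCircuit A ι ο K) (x : ι → A) (g : Fin C.size) : A :=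
  C.op g fun k =>
    match C.pred g k with
    | Sum.inl i => x i
    | Sum.inr h => gateVal C x h.1
termination_by g
decreasing_by exact h.2

/-- The output of the circuit. -/
def eval (C : ClassicalCircuit A ι ο K) (x : ι → A) (o : ο) : A :=
  match C.out o with
  | Sum.inl i => x i
  | Sum.inr g => C.gateVal x g

/-- The number of gates on the longest path that ends in the given gate. -/
def gateDepth (C : ClassicalCircuit A ι ο K) (g : Fin C.size) : ℕ :=
  (Finset.univ.sup fun k =>
    match C.pred g k with
    | Sum.inl _ => 0
    | Sum.inr h => gateDepth C h.1) + 1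
termination_by g
decreasing_by exact h.2

/-- The depth of the circuit: the number of gates on a longest path. -/
def depth (C : ClassicalCircuit A ι ο K) : ℕ := Finset.univ.sup C.gateDepth

end ClassicalCircuit

open scoped Classical in
/-- The input-output behavior of a (randomized) classical circuit on the grid: besides
the input letter of every vertex it has `a` further input wires that hold a random string drawn from
`ρ`, independently of the input. Deterministic circuits are the case `a = 0`. -/
noncomputable def classicalBehavior {N K a : ℕ} (ρ : PMF (Fin a → Letter))
    (C : ClassicalCircuit Letter (Grid N ⊕ Fin a) (Grid N) K)
    (x y : Grid N → Letter) : ℝ :=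
  ∑ s, if C.eval (Sum.elim x s) = y then (ρ s).toReal else 0

/-! ### Quantum circuits -/

/-- A quantum gate on a set `W` of qubits: a unitary on the qubits of its support. -/
structure QGate (W : Type) [DecidableEq W] where
  support : Finset W
  mat : Matrix (support → Bool) (support → Bool) ℂ
  isUnitary : mat.conjTranspose * mat = 1

/-- The action of a gate on a state vector, written in the computational basis. -/
noncomputable def QGate.apply {W : Type} [DecidableEq W] (g : QGate W) (ψ : (W → Bool) → ℂ) : (W → Bool) → ℂ :=
  fun z => ∑ t : g.support → Bool,
    g.mat (fun k => z k) t * ψ (fun k => if h : k ∈ g.support then t ⟨k, h⟩ else z k)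

/-- A layer of a quantum circuit: gates that act on pairwise disjoint sets of qubits. -/
structure QLayer (W : Type) [DecidableEq W] where
  gates : List (QGate W)
  disjoint : gates.Pairwise fun g h => Disjoint g.support h.support

/-- The action of a layer. The gates commute, so their order in the list is immaterial. -/
noncomputable def QLayer.apply {W : Type} [DecidableEq W] (l : QLayer W) (ψ : (W → Bool) → ℂ) :
    (W → Bool) → ℂ :=
  l.gates.foldr QGate.apply ψ

/-- The qubits of a quantum circuit on the grid: each vertex holds 8 qubits for its
input and output letter and `a` ancilla qubits. -/
abbrev QWire (N a : ℕ) : Type := Grid N × (Fin 8 ⊕ Fin a)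

/-- A layered quantum circuit on the grid; the head of the list is the first layer. -/
abbrev QCircuit (N a : ℕ) : Type := List (QLayer (QWire N a))

namespace QCircuit

variable {N a : ℕ}

/-- The number of layers. -/
def depth (Q : QCircuit N a) : ℕ := List.length Q

/-- Every gate acts on at most `K` qubits. -/
def FanIn (Q : QCircuit N a) (K : ℕ) : Prop :=
  ∀ l ∈ Q, ∀ g ∈ l.gates, g.support.card ≤ K

/-- Every gate acts on qubits at vertices that are pairwise within distance `R` in the grid. -/
def GeometricallyLocal (Q : QCircuit N a) (R : ℕ) : Prop :=
  ∀ l ∈ Q, ∀ g ∈ l.gates, ∀ p ∈ g.support, ∀ q ∈ g.support, Grid.Within R p.1 q.1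

open scoped Classical in
/-- The initial state: the computational basis state holding the input letters, with all ancilla
qubits equal to zero. -/
noncomputable def init (a : ℕ) (x : Grid N → Letter) : (QWire N a → Bool) → ℂ :=
  fun z => if z = (fun p => Sum.elim (x p.1) (fun _ => false) p.2) then 1 else 0

/-- The final state on input `x`. -/
noncomputable def finalState (Q : QCircuit N a) (x : Grid N → Letter) : (QWire N a → Bool) → ℂ :=
  List.foldl (fun ψ l => QLayer.apply l ψ) (init a x) Q

open scoped Classical in
/-- The Born rule: all qubits of the final state are measured in the computational basis and the
letter qubits of each vertex form its output letter. -/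
noncomputable def behavior (Q : QCircuit N a) (x y : Grid N → Letter) : ℝ :=
  ∑ z : QWire N a → Bool,
    if (fun v k => z (v, Sum.inl k)) = y then ‖Q.finalState x z‖ ^ 2 else 0

end QCircuit

/-! ### The GHZ game -/

/-- The queries of the GHZ game; a query is drawn uniformly from this set. -/
def ghzQueries : Finset (Fin 3 → ZMod 2) :=
  {![0, 0, 0], ![0, 1, 1], ![1, 0, 1], ![1, 1, 0]}

/-- The right-hand side of the win condition of the GHZ game: the sum of the
three answers has to be `0` on the query `000` and `1` on the other queries. -/
def ghzTarget (x : Fin 3 → ZMod 2) : ZMod 2 := if x = 0 then 0 else 1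

/-- The label `(s₀, s₁)` of the one-qubit Pauli `X ^ s₀ Z ^ s₁` that a question asks to measure
(up to phase): `X` for the question `0` and `Y` for the question `1`. -/
def pauliLabel (q : ZMod 2) : ZMod 2 × ZMod 2 := (1, q)

/-- The correction value: the exponent of `-1` in the group commutator
of the one-qubit Paulis labelled `q` and `s`. -/
def cor (s q : ZMod 2 × ZMod 2) : ZMod 2 := q.1 * s.2 + q.2 * s.1

/-- The win condition of the rotated GHZ game on query `x`, for answers `a` and
rotation strings `s`. -/
def ghzRotatedWin (x a : Fin 3 → ZMod 2) (s : Fin 3 → ZMod 2 × ZMod 2) : Prop :=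
  ∑ j, (a j - cor (s j) (pauliLabel (x j))) = ghzTarget x

/-! ### Local encoding of the paths of a star -/

/-- The four neighbor directions of a grid vertex. -/
inductive Dir
  | left
  | right
  | down
  | up

/-- Two-bit code of a direction. -/
def Dir.bits : Dir → Bool × Bool
  | left => (false, false)
  | right => (false, true)
  | down => (true, false)
  | up => (true, true)

/-- The direction from a vertex to one of its neighbors. -/
def Grid.dir {N : ℕ} (v w : Grid N) : Dir :=
  if w.1 < v.1 then Dir.left else if v.1 < w.1 then Dir.right
  else if w.2 < v.2 then Dir.down else Dir.up

/-- What the input tells a grid vertex: it is on no star (`blank`); or it is an inner vertex of a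
path, to be teleported through from direction `p` to direction `n` (`relay`); or it is the first
vertex of the `j`-th path, which continues in direction `n` (`hub`); or it is the `j`-th input location,
reached from direction `p`, with question `q` (`term`). -/
inductive VertexSymbol
  | blank
  | relay (p n : Dir)
  | hub (j : Fin 3) (n : Dir)
  | term (j : Fin 3) (p : Dir) (q : ZMod 2)

/-- The encoding of the information at a vertex in one letter. -/
def VertexSymbol.code : VertexSymbol → Letter
  | blank => ![false, false, false, false, false, false, false, false]
  | relay p n => ![false, true, false, false, p.bits.1, p.bits.2, n.bits.1, n.bits.2]
  | hub j n => ![true, false, decide (j = 1), decide (j = 2), false, false, n.bits.1, n.bits.2]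
  | term j p q =>
      ![true, true, decide (j = 1), decide (j = 2), p.bits.1, p.bits.2, decide (q = 1), false]

/-- The information at `v` that describes the `j`-th path `l` (from the center of a
star to the `j`-th input location) and the question `q` at its last vertex. -/
def pathSymbol {N : ℕ} (l : List (Grid N)) (j : Fin 3) (q : ZMod 2) (v : Grid N) : VertexSymbol :=
  if v ∈ l then
    if l.idxOf v = 0 then VertexSymbol.hub j (v.dir (l.getD 1 v))
    else if l.idxOf v + 1 = l.length then VertexSymbol.term j (v.dir (l.getD (l.idxOf v - 1) v)) q
    else VertexSymbol.relay (v.dir (l.getD (l.idxOf v - 1) v)) (v.dir (l.getD (l.idxOf v + 1) v))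
  else VertexSymbol.blank

/-! ### Planting `r` copies of the GHZ game in the grid -/

/-- The side length `⌊N / √r⌋` of the squares that hold the `r` copies. -/
def squareSide (N r : ℕ) : ℕ := Nat.sqrt (N ^ 2 / r)

/-- The fixed choices behind the random input patterns with `r` stars on the `N × N` grid: squares, boxes
of side `2L + 1` in each square, and for any four distinct boxes `b 0` (the central one), `b 1`, `b 2`,
`b 3` of a square a family of `⌊L / 3⌋` stars. The `j`-th path of a star is `arm`; it is
extended by `hub` inside the central box and by `tail` inside the box of the `j`-th player, up to
the input location at position `o` of that box. The constant `κ` bounds the density of the boxes and the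
lengths of the paths. -/
structure Planting (κ N r L : ℕ) where
  /-- the number of boxes in each square -/
  T : ℕ
  one_le_r : 1 ≤ r
  r_le : r ≤ N
  three_le_L : 3 ≤ L
  six_L_le : 6 * L ≤ squareSide N r
  four_le_T : 4 ≤ T
  /-- the lowest corner of each square -/
  corner : Fin r → ℕ × ℕ
  corner_le : ∀ i, (corner i).1 + squareSide N r ≤ N ∧ (corner i).2 + squareSide N r ≤ N
  squares_disjoint : Pairwise fun i i' => Disjoint
    (Grid.block N (corner i) (squareSide N r)) (Grid.block N (corner i') (squareSide N r))
  /-- the lowest corner of each box -/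
  anchor : Fin r → Fin T → ℕ × ℕ
  box_in_square : ∀ i t,
    ((corner i).1 ≤ (anchor i t).1 ∧
      (anchor i t).1 + (2 * L + 1) ≤ (corner i).1 + squareSide N r) ∧
    ((corner i).2 ≤ (anchor i t).2 ∧
      (anchor i t).2 + (2 * L + 1) ≤ (corner i).2 + squareSide N r)
  boxes_disjoint : ∀ i, Pairwise fun t t' => Disjoint
    (Grid.block N (anchor i t) (2 * L + 1)) (Grid.block N (anchor i t') (2 * L + 1))
  /-- the boxes cover a constant fraction of each square -/
  dense : squareSide N r ^ 2 ≤ κ * (T * (2 * L + 1) ^ 2)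
  arm : (i : Fin r) → (b : Fin 4 ↪ Fin T) → (s : Fin (L / 3)) → (j : Fin 3) → List (Grid N)
  hub : (i : Fin r) → (b : Fin 4 ↪ Fin T) → (s : Fin (L / 3)) → (j : Fin 3) → List (Grid N)
  tail : (i : Fin r) → (b : Fin 4 ↪ Fin T) → (s : Fin (L / 3)) → (j : Fin 3) →
    (o : Fin (2 * L + 1) × Fin (2 * L + 1)) → List (Grid N)
  /-- each arm joins the central box to the `j`-th box and otherwise stays in the square and
  outside the four boxes -/
  arm_spec : ∀ i b s j, ∃ v mid w, arm i b s j = v :: (mid ++ [w]) ∧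
    v ∈ Grid.block N (anchor i (b 0)) (2 * L + 1) ∧
    w ∈ Grid.block N (anchor i (b j.succ)) (2 * L + 1) ∧
    ∀ p ∈ mid, p ∈ Grid.block N (corner i) (squareSide N r) ∧
      ∀ t, p ∉ Grid.block N (anchor i (b t)) (2 * L + 1)
  /-- the paths of distinct stars of a family are vertex-disjoint -/
  stars_disjoint : ∀ i b s s' j j', s ≠ s' → (arm i b s j).Disjoint (arm i b s' j')
  /-- the total length of the paths of a star -/
  length_le : ∀ i b s, ∑ j, (arm i b s j).length ≤ κ * squareSide N r
  hub_in_box : ∀ i b s j, ∀ p ∈ hub i b s j, p ∈ Grid.block N (anchor i (b 0)) (2 * L + 1)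
  tail_in_box : ∀ i b s j o, ∀ p ∈ tail i b s j o,
    p ∈ Grid.block N (anchor i (b j.succ)) (2 * L + 1)
  /-- the extended paths are simple paths of the grid graph -/
  isPath : ∀ i b s j o, Grid.IsPath (hub i b s j ++ arm i b s j ++ tail i b s j o)
  /-- the extended `j`-th path ends in the input location at position `o` of the `j`-th box -/
  path_last : ∀ i b s j o, ∃ v ∈ (hub i b s j ++ arm i b s j ++ tail i b s j o).getLast?,
    v.1.val = (anchor i (b j.succ)).1 + o.1.val ∧ v.2.val = (anchor i (b j.succ)).2 + o.2.val
  /-- the extended paths of one star are vertex-disjoint -/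
  paths_disjoint : ∀ i b s j j' o o', j ≠ j' →
    (hub i b s j ++ arm i b s j ++ tail i b s j o).Disjoint
      (hub i b s j' ++ arm i b s j' ++ tail i b s j' o')

namespace Planting

variable {κ N r L : ℕ}

/-- The random choices for one copy of the GHZ game, all uniform and independent: four distinct boxes,
the positions of the three input locations in their boxes, a star of the family of these boxes, and a
query of the GHZ game. -/
abbrev Choice (P : Planting κ N r L) : Type :=
  (Fin 4 ↪ Fin P.T) × (Fin 3 → Fin (2 * L + 1) × Fin (2 * L + 1)) × Fin (L / 3) × ghzQueries

/-- The random choices for all `r` copies. -/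
abbrev Instance (P : Planting κ N r L) : Type := Fin r → P.Choice

theorem instance_nonempty (P : Planting κ N r L) : Nonempty P.Instance := by
  have h1 : Nonempty (Fin 4 ↪ Fin P.T) := ⟨Fin.castLEEmb P.four_le_T⟩
  have h2 : Nonempty (Fin (L / 3)) := ⟨⟨0, by have := P.three_le_L; omega⟩⟩
  have h3 : Nonempty ghzQueries := ⟨⟨![0, 0, 0], by simp [ghzQueries]⟩⟩
  exact inferInstance

/-- The `j`-th (extended) path of the star of the `i`-th copy, from the center of the star to the
input location of the `j`-th player. -/
def path (P : Planting κ N r L) (c : P.Instance) (i : Fin r) (j : Fin 3) : List (Grid N) :=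
  P.hub i (c i).1 (c i).2.2.1 j ++ P.arm i (c i).1 (c i).2.2.1 j ++
    P.tail i (c i).1 (c i).2.2.1 j ((c i).2.1 j)

/-- The query of the `i`-th copy. -/
def query (P : Planting κ N r L) (c : P.Instance) (i : Fin r) : Fin 3 → ZMod 2 :=
  (c i).2.2.2.1

open scoped Classical in
/-- The input string that describes an instance, vertex by vertex. The paths are pairwise disjoint, so
that the path through `v` is unique if there is one. -/
noncomputable def encode (P : Planting κ N r L) (c : P.Instance) (v : Grid N) : Letter :=
  if h : ∃ p : Fin r × Fin 3, v ∈ P.path c p.1 p.2 then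
    (pathSymbol (P.path c h.choose.1 h.choose.2) h.choose.2
      (P.query c h.choose.1 h.choose.2) v).code
  else VertexSymbol.blank.code

/-- A bit as an element of `ℤ/2`. -/
def bit (b : Bool) : ZMod 2 := if b then 1 else 0

/-- The rotation reported along a path: the sum of the two-bit teleportation outcomes `(y₀, y₁)`,
standing for `X ^ y₀ Z ^ y₁`, at all vertices of the path but the last. -/
def rotation (y : Grid N → Letter) (l : List (Grid N)) : ZMod 2 × ZMod 2 :=
  (l.dropLast.map fun v => (bit (y v 0), bit (y v 1))).sum

/-- The answer reported at the last vertex of a path. -/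
def answer (y : Grid N → Letter) (l : List (Grid N)) : ZMod 2 :=
  (l.getLast?.map fun v => bit (y v 0)).getD 0

/-- The output `y` wins all `r` planted copies of the GHZ game. -/
def Wins (P : Planting κ N r L) (c : P.Instance) (y : Grid N → Letter) : Prop :=
  ∀ i, ghzRotatedWin (P.query c i) (fun j => answer y (P.path c i j))
    (fun j => rotation y (P.path c i j))

/-- The circuit game obtained by planting `r` copies of the GHZ game in the grid. -/
noncomputable def game (P : Planting κ N r L) :
    CircuitGame (Grid N → Letter) (Grid N → Letter) where
  dist := haveI := P.instance_nonempty
    (PMF.uniformOfFintype P.Instance).map P.encode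
  rel := {xy | (∃ c, P.encode c = xy.1) ∧ ∀ c, P.encode c = xy.1 → P.Wins c xy.2}

end Planting

/-! ### Light cones of classical circuits -/

/-! Soundness. For a fixed random string, every output letter of a circuit of depth d reads at most
(K+1)^d input letters (`exists_light_cones`), and queries enter the input only at the input
locations (`encode_congr`). Order the copies and call copy k isolated if each of its input locations
is invisible to all paths of copies i ≤ k except the path leading to it. For fixed other queries, an
isolated copy is then played by three players who cannot communicate, so it is lost on at least one
of the four queries (`not_ghz_classical`), whereas the result of every lower copy does not depend on
the query of copy k. Peeling off copies from the last one gives a factor 3/4 per isolated copy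
(`card_wins_le`). Isolation of k depends only on the positions of copies up to k. Given the other
positions it fails with probability at most 1/2, because each input location is uniform in a box of
(2L+1)^2 vertices and the cones of the 3r paths are much smaller (`card_not_isolated_le`). A second
peeling, over positions, gives 3/4 + 1/4 · 1/2 = 7/8 per copy (`sum_isolated_le`). Both peelings are
`sum_prod_le`.

Completeness. Two layers suffice. The first prepares a Bell pair on every edge and a GHZ state on
every vertical triple of vertices. In the second, each vertex makes a Bell measurement of the two
ancillas named by its letter, or measures X or Y at an input location. The proof is a stabilizer
computation in the form ψ(z + α) = sign(z) ψ(z). Take X (question 0) or XZ (question 1) on all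
ancillas measured along a star, according to the question of the path. Flips preserve the entangled
state, as both ends of a used edge and all three shares at the hub are flipped
(`Grid.IsStar.constantOn_flips`). Signs cancel along each path (`prod_signs`), and the three
remaining ones cancel because a query has an even number of ones (`prod_ghz_signs`). The measuring
layer carries this symmetry to a product of outcome signs, which must be 1 at every output of
nonzero amplitude (`prod_eq_one_of_vertexLayer_apply_ne_zero`). By `prod_outcomes` and
`prod_ghz_phases` this is the win condition; unitarity then gives probability 1.

Construction. Each square has four boxes on an antidiagonal, so that no two share a row or a column.
A path leaves its central box horizontally and enters its target vertically; ordering the exit rows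
by target prevents crossings (`Layout.disjoint_arm`). The three paths of a star start at vertically
consecutive vertices and leave downwards, sideways and upwards, so the first direction identifies
the share of the GHZ state (`Layout.isStar_planting`). With n of order N^(1/4), there are n^2
squares and boxes of side of order n^3, which leaves room for light cones of size n/42. -/

namespace ClassicalCircuit

variable {A ι ο : Type} {K : ℕ}

/-- One level of gates multiplies the number of inputs read by at most the fan-in. The base K + 1
keeps the bound positive and monotone in the depth even for K = 0. -/
theorem gateVal_light_cone [DecidableEq ι] (C : ClassicalCircuit A ι ο K) (g : Fin C.size) :
    ∃ S : Finset ι, S.card ≤ (K + 1) ^ C.gateDepth g ∧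
      ∀ x x' : ι → A, (∀ i ∈ S, x i = x' i) → C.gateVal x g = C.gateVal x' g := by
  induction g using WellFoundedLT.induction with
  | ind g ih =>
    have hk : ∀ k : Fin (C.arity g), ∃ S : Finset ι,
        S.card ≤ (K + 1) ^ (C.gateDepth g - 1) ∧
        ∀ x x' : ι → A, (∀ i ∈ S, x i = x' i) →
          (match C.pred g k with
            | Sum.inl i => x i
            | Sum.inr h => C.gateVal x h.1) =
          (match C.pred g k with
            | Sum.inl i => x' i
            | Sum.inr h => C.gateVal x' h.1) := by
      intro k
      have hle : (match C.pred g k with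
          | Sum.inl _ => 0
          | Sum.inr h => C.gateDepth h.1) ≤ C.gateDepth g - 1 := by
        rw [gateDepth, Nat.add_sub_cancel]
        exact Finset.le_sup (f := fun k => match C.pred g k with
          | Sum.inl _ => 0
          | Sum.inr h => C.gateDepth h.1) (Finset.mem_univ k)
      cases hp : C.pred g k with
      | inl i =>
        exact ⟨{i}, by simpa using Nat.one_le_pow _ _ (by omega), fun x x' h => by simpa using h⟩
      | inr h =>
        obtain ⟨S, hS, hx⟩ := ih h.1 h.2
        rw [hp] at hle
        exact ⟨S, hS.trans (Nat.pow_le_pow_right (by omega) hle), hx⟩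
    choose S hS hx using hk
    refine ⟨Finset.univ.biUnion S, ?_, fun x x' h => ?_⟩
    · have hpos : C.gateDepth g = (C.gateDepth g - 1) + 1 := by
        rw [gateDepth]; simp
      calc (Finset.univ.biUnion S).card
          ≤ ∑ k, (S k).card := Finset.card_biUnion_le
        _ ≤ ∑ _k : Fin (C.arity g), (K + 1) ^ (C.gateDepth g - 1) :=
            Finset.sum_le_sum fun k _ => hS k
        _ = C.arity g * (K + 1) ^ (C.gateDepth g - 1) := by simp
        _ ≤ (K + 1) * (K + 1) ^ (C.gateDepth g - 1) :=
            Nat.mul_le_mul_right _ ((C.arity_le g).trans (by omega))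
        _ = (K + 1) ^ C.gateDepth g := by rw [← pow_succ', ← hpos]
    · rw [gateVal, gateVal]
      congr 1
      funext k
      exact hx k x x' fun i hi => h i (Finset.mem_biUnion.2 ⟨k, Finset.mem_univ k, hi⟩)

theorem eval_light_cone [DecidableEq ι] (C : ClassicalCircuit A ι ο K) (o : ο) :
    ∃ S : Finset ι, S.card ≤ (K + 1) ^ C.depth ∧
      ∀ x x' : ι → A, (∀ i ∈ S, x i = x' i) → C.eval x o = C.eval x' o := by
  cases ho : C.out o with
  | inl i =>
    exact ⟨{i}, by simpa using Nat.one_le_pow _ _ (by omega),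
      fun x x' h => by simpa [eval, ho] using h⟩
  | inr g =>
    obtain ⟨S, hS, hx⟩ := C.gateVal_light_cone g
    exact ⟨S, hS.trans (Nat.pow_le_pow_right (by omega)
      (Finset.le_sup (f := C.gateDepth) (Finset.mem_univ g))),
      fun x x' h => by simpa [eval, ho] using hx x x' h⟩

/-- The light cones with respect to the part `ι` of the inputs, the others being fixed. -/
theorem exists_light_cones {κ : Type} [DecidableEq ι] [DecidableEq κ]
    (C : ClassicalCircuit A (ι ⊕ κ) ο K) (s : κ → A) :
    ∃ S : ο → Finset ι, (∀ o, (S o).card ≤ (K + 1) ^ C.depth) ∧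
      ∀ o (x x' : ι → A), (∀ i ∈ S o, x i = x' i) →
        C.eval (Sum.elim x s) o = C.eval (Sum.elim x' s) o := by
  choose S hS hx using C.eval_light_cone
  refine ⟨fun o => (S o).toLeft, fun o => (Finset.card_toLeft_le).trans (hS o),
    fun o x x' h => hx o _ _ ?_⟩
  rintro (i | k) hi
  · exact h i (Finset.mem_toLeft.2 hi)
  · rfl

end ClassicalCircuit

/-! ### Averaging products coordinate by coordinate -/

/-- Exchanging the m-th coordinate with the fresh value is an involution on pairs, so resampling one
coordinate does not change an average. -/
theorem sum_sum_update {ι α : Type} [Fintype ι] [DecidableEq ι] [Fintype α] (m : ι)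
    (f : (ι → α) → ℝ) :
    ∑ p : ι → α, ∑ y, f (Function.update p m y) = Fintype.card α * ∑ p, f p := by
  classical
  have h : ∑ z : (ι → α) × α, f (Function.update z.1 m z.2) = ∑ z : (ι → α) × α, f z.1 := by
    refine Fintype.sum_bijective
      (fun z : (ι → α) × α => (Function.update z.1 m z.2, z.1 m)) ?_ _ _ fun _ => rfl
    refine Function.Involutive.bijective fun z => ?_
    simp
  rw [Fintype.sum_prod_type, Fintype.sum_prod_type] at h
  rw [h, Finset.mul_sum]
  simp

/-- If every factor only depends on the coordinates up to its own one, and its average over its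
own coordinate is at most `τ`, then the average of the product is at most a power of `τ`. -/
theorem sum_prod_le {α : Type} [Fintype α] [Nonempty α] {r : ℕ} (w : Fin r → (Fin r → α) → ℝ)
    {τ : ℝ} (hτ : 0 ≤ τ) (h0 : ∀ k p, 0 ≤ w k p) (G : Finset (Fin r))
    (h1 : ∀ k ∈ G, ∀ m ∈ G, k < m → ∀ p y, w k (Function.update p m y) = w k p)
    (h2 : ∀ k ∈ G, ∀ p, ∑ y, w k (Function.update p k y) ≤ τ * Fintype.card α) :
    ∑ p : Fin r → α, ∏ k ∈ G, w k p ≤ τ ^ G.card * Fintype.card (Fin r → α) := by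
  classical
  induction G using Finset.induction_on_max with
  | empty => simp
  | insert m G hm ih =>
    have hmG : m ∉ G := fun h => lt_irrefl _ (hm m h)
    have hα : (0 : ℝ) < Fintype.card α := by exact_mod_cast Fintype.card_pos
    have ih' := ih
      (fun k hk l hl => h1 k (Finset.mem_insert_of_mem hk) l (Finset.mem_insert_of_mem hl))
      (fun k hk => h2 k (Finset.mem_insert_of_mem hk))
    rw [Finset.card_insert_of_notMem hmG, pow_succ]
    -- The extra factor `card α` pays for resampling the coordinate m, which only the factor of the
    -- largest index m sees.
    refine le_of_mul_le_mul_left ?_ hα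
    rw [← sum_sum_update m]
    calc ∑ p : Fin r → α, ∑ y, ∏ k ∈ insert m G, w k (Function.update p m y)
        = ∑ p : Fin r → α, (∏ k ∈ G, w k p) * ∑ y, w m (Function.update p m y) := by
          refine Finset.sum_congr rfl fun p _ => ?_
          rw [Finset.mul_sum]
          refine Finset.sum_congr rfl fun y _ => ?_
          rw [Finset.prod_insert hmG, mul_comm]
          congr 1
          exact Finset.prod_congr rfl fun k hk => h1 k (Finset.mem_insert_of_mem hk) m
            (Finset.mem_insert_self _ _) (hm k hk) p y
      _ ≤ ∑ p : Fin r → α, (∏ k ∈ G, w k p) * (τ * Fintype.card α) :=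
          Finset.sum_le_sum fun p _ => mul_le_mul_of_nonneg_left
            (h2 m (Finset.mem_insert_self _ _) p) (Finset.prod_nonneg fun k _ => h0 k p)
      _ = (∑ p : Fin r → α, ∏ k ∈ G, w k p) * (τ * Fintype.card α) := by rw [Finset.sum_mul]
      _ ≤ (τ ^ G.card * Fintype.card (Fin r → α)) * (τ * Fintype.card α) :=
          mul_le_mul_of_nonneg_right ih' (by positivity)
      _ = _ := by ring

/-! ### The classical value of the GHZ game -/

theorem card_ghzQueries : Fintype.card ghzQueries = 4 := by
  rw [Fintype.card_coe]; decide

/-- Adding the four win conditions, every answer occurs twice and cancels mod 2, while the targets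
add up to 1. The hypothesis makes the j-th answer a function of the j-th question, which leaves six
unknown bits. -/
theorem not_ghz_classical (g : (Fin 3 → ZMod 2) → Fin 3 → ZMod 2)
    (hg : ∀ x ∈ ghzQueries, ∀ x' ∈ ghzQueries, ∀ j, x j = x' j → g x j = g x' j) :
    ∃ x ∈ ghzQueries, ∑ j, g x j ≠ ghzTarget x := by
  by_contra! h
  have m0 : ![0, 0, 0] ∈ ghzQueries := by decide
  have m1 : ![0, 1, 1] ∈ ghzQueries := by decide
  have m2 : ![1, 0, 1] ∈ ghzQueries := by decide
  have m3 : ![1, 1, 0] ∈ ghzQueries := by decide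
  have h0 := h _ m0
  have h1 := h _ m1
  have h2 := h _ m2
  have h3 := h _ m3
  rw [Fin.sum_univ_three] at h0 h1 h2 h3
  rw [show ghzTarget ![0, 0, 0] = 0 by decide] at h0
  rw [show ghzTarget ![0, 1, 1] = 1 by decide, hg _ m1 _ m0 0 rfl] at h1
  rw [show ghzTarget ![1, 0, 1] = 1 by decide, hg _ m2 _ m0 1 rfl, hg _ m2 _ m1 2 rfl] at h2
  rw [show ghzTarget ![1, 1, 0] = 1 by decide, hg _ m3 _ m0 2 rfl, hg _ m3 _ m1 1 rfl,
    hg _ m3 _ m2 0 rfl] at h3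
  generalize g ![0, 0, 0] 0 = a at *
  generalize g ![0, 0, 0] 1 = b at *
  generalize g ![0, 0, 0] 2 = c at *
  generalize g ![0, 1, 1] 1 = d at *
  generalize g ![0, 1, 1] 2 = e at *
  generalize g ![1, 0, 1] 0 = f at *
  revert a b c d e f
  decide

/-! ### Positions and queries of a planted instance -/

namespace Planting

variable {κ N r L : ℕ}

/-- The random choices for one copy, except for the query. -/
abbrev Pos (P : Planting κ N r L) : Type :=
  (Fin 4 ↪ Fin P.T) × (Fin 3 → Fin (2 * L + 1) × Fin (2 * L + 1)) × Fin (L / 3)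

theorem pos_nonempty (P : Planting κ N r L) : Nonempty P.Pos :=
  P.instance_nonempty.map fun c =>
    ⟨(c ⟨0, P.one_le_r⟩).1, (c ⟨0, P.one_le_r⟩).2.1, (c ⟨0, P.one_le_r⟩).2.2.1⟩

/-- An instance consists of positions and queries. -/
def instEquiv (P : Planting κ N r L) :
    (Fin r → P.Pos) × (Fin r → ghzQueries) ≃ P.Instance where
  toFun z i := ((z.1 i).1, (z.1 i).2.1, (z.1 i).2.2, z.2 i)
  invFun c := (fun i => ((c i).1, (c i).2.1, (c i).2.2.1), fun i => (c i).2.2.2)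
  left_inv _ := rfl
  right_inv _ := rfl

/-- The `j`-th path of the `i`-th copy. -/
def pathAt (P : Planting κ N r L) (i : Fin r) (y : P.Pos) (j : Fin 3) : List (Grid N) :=
  P.hub i y.1 y.2.2 j ++ P.arm i y.1 y.2.2 j ++ P.tail i y.1 y.2.2 j (y.2.1 j)

/-- The input location of the `j`-th player. -/
noncomputable def endpoint (P : Planting κ N r L) (i : Fin r) (y : P.Pos) (j : Fin 3) : Grid N :=
  (P.path_last i y.1 y.2.2 j (y.2.1 j)).choose

theorem getLast?_pathAt (P : Planting κ N r L) (i : Fin r) (y : P.Pos) (j : Fin 3) :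
    (P.pathAt i y j).getLast? = some (P.endpoint i y j) :=
  (P.path_last i y.1 y.2.2 j (y.2.1 j)).choose_spec.1

theorem endpoint_val (P : Planting κ N r L) (i : Fin r) (y : P.Pos) (j : Fin 3) :
    (P.endpoint i y j).1.val = (P.anchor i (y.1 j.succ)).1 + (y.2.1 j).1.val ∧
      (P.endpoint i y j).2.val = (P.anchor i (y.1 j.succ)).2 + (y.2.1 j).2.val :=
  (P.path_last i y.1 y.2.2 j (y.2.1 j)).choose_spec.2

/-- The question is written only at the last vertex of the path. -/
theorem pathSymbol_congr {l : List (Grid N)} (j : Fin 3) {q q' : ZMod 2} {v : Grid N}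
    (h : l.getLast? = some v → q = q') : pathSymbol l j q v = pathSymbol l j q' v := by
  unfold pathSymbol
  split_ifs with h1 h2 h3
  · rfl
  · have hlt : l.idxOf v < l.length := List.idxOf_lt_length_iff.2 h1
    rw [h]
    rw [List.getLast?_eq_getElem?, ← h3, Nat.add_sub_cancel, List.getElem?_eq_getElem hlt,
      List.getElem_idxOf]
  · rfl
  · rfl

/-- The queries only enter the input at the input locations. -/
theorem encode_congr (P : Planting κ N r L) (p : Fin r → P.Pos) (x x' : Fin r → ghzQueries)
    (v : Grid N) (h : ∀ i j, P.endpoint i (p i) j = v → (x i).1 j = (x' i).1 j) :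
    P.encode (P.instEquiv (p, x)) v = P.encode (P.instEquiv (p, x')) v := by
  unfold encode
  by_cases hv : ∃ z : Fin r × Fin 3, v ∈ P.pathAt z.1 (p z.1) z.2
  · have e1 : ∃ z : Fin r × Fin 3, v ∈ P.path (P.instEquiv (p, x)) z.1 z.2 := hv
    have e2 : ∃ z : Fin r × Fin 3, v ∈ P.path (P.instEquiv (p, x')) z.1 z.2 := hv
    rw [dif_pos e1, dif_pos e2]
    congr 1
    refine pathSymbol_congr _ fun hl => h _ _ ?_
    have := P.getLast?_pathAt hv.choose.1 (p hv.choose.1) hv.choose.2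
    exact Option.some_injective _ (this.symm.trans hl)
  · have e1 : ¬ ∃ z : Fin r × Fin 3, v ∈ P.path (P.instEquiv (p, x)) z.1 z.2 := hv
    have e2 : ¬ ∃ z : Fin r × Fin 3, v ∈ P.path (P.instEquiv (p, x')) z.1 z.2 := hv
    rw [dif_neg e1, dif_neg e2]

/-- The corrected answer of the `j`-th player on question `q`. -/
def reply (y : Grid N → Letter) (l : List (Grid N)) (q : ZMod 2) : ZMod 2 :=
  answer y l - cor (rotation y l) (pauliLabel q)

theorem reply_congr {y y' : Grid N → Letter} {l : List (Grid N)} (q : ZMod 2)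
    (h : ∀ v ∈ l, y v = y' v) : reply y l q = reply y' l q := by
  have h1 : answer y l = answer y' l := by
    unfold answer
    cases hl : l.getLast? with
    | none => rfl
    | some v => simp [h v (List.mem_of_getLast? hl)]
  have h2 : rotation y l = rotation y' l := by
    unfold rotation
    congr 1
    exact List.map_congr_left fun v hv => by rw [h v (List.mem_of_mem_dropLast hv)]
  rw [reply, reply, h1, h2]

/-- The inputs that the outputs along the `j`-th path of the `i`-th copy depend on. -/
def cone (P : Planting κ N r L) (S : Grid N → Finset (Grid N)) (i : Fin r) (y : P.Pos)
    (j : Fin 3) : Finset (Grid N) :=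
  (P.pathAt i y j).toFinset.biUnion S

theorem card_cone_le (P : Planting κ N r L) {S : Grid N → Finset (Grid N)} {B Λ : ℕ}
    (hS : ∀ o, (S o).card ≤ B) (hΛ : ∀ i y j, (P.pathAt i y j).length ≤ Λ) (i : Fin r)
    (y : P.Pos) (j : Fin 3) : (P.cone S i y j).card ≤ Λ * B :=
  calc (P.cone S i y j).card ≤ ∑ v ∈ (P.pathAt i y j).toFinset, (S v).card :=
        Finset.card_biUnion_le
    _ ≤ (P.pathAt i y j).toFinset.card * B := by
        simpa using Finset.sum_le_sum fun v (_ : v ∈ (P.pathAt i y j).toFinset) => hS v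
    _ ≤ Λ * B := Nat.mul_le_mul_right _ ((List.toFinset_card_le _).trans (hΛ i y j))

/-- No outputs along a path of a copy up to the `k`-th one depend on an input of the `k`-th copy,
except for those on the path that leads to this input. -/
def Isolated (P : Planting κ N r L) (S : Grid N → Finset (Grid N)) (p : Fin r → P.Pos)
    (k : Fin r) : Prop :=
  ∀ j i j', i ≤ k → (i, j') ≠ (k, j) → P.endpoint k (p k) j ∉ P.cone S i (p i) j'

/-- This is what the restriction to i ≤ k is for: isolation of k is unaffected by resampling the
positions of later copies. -/
theorem isolated_congr (P : Planting κ N r L) (S : Grid N → Finset (Grid N))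
    {p p' : Fin r → P.Pos} {k : Fin r} (h : ∀ i ≤ k, p i = p' i) :
    P.Isolated S p k ↔ P.Isolated S p' k := by
  unfold Isolated
  refine forall_congr' fun j => forall_congr' fun i => forall_congr' fun j' =>
    forall_congr' fun hi => forall_congr' fun _ => ?_
  rw [h k le_rfl, h i hi]

/-- The output of a local map on given positions and queries. -/
noncomputable def out (P : Planting κ N r L) (F : (Grid N → Letter) → Grid N → Letter)
    (p : Fin r → P.Pos) (x : Fin r → ghzQueries) : Grid N → Letter :=
  F (P.encode (P.instEquiv (p, x)))

/-- The `k`-th copy is won. -/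
def WinsCopy (P : Planting κ N r L) (F : (Grid N → Letter) → Grid N → Letter)
    (p : Fin r → P.Pos) (x : Fin r → ghzQueries) (k : Fin r) : Prop :=
  ∑ j, reply (P.out F p x) (P.pathAt k (p k) j) ((x k).1 j) = ghzTarget (x k).1

theorem wins_iff (P : Planting κ N r L) (F : (Grid N → Letter) → Grid N → Letter)
    (p : Fin r → P.Pos) (x : Fin r → ghzQueries) :
    P.Wins (P.instEquiv (p, x)) (F (P.encode (P.instEquiv (p, x)))) ↔
      ∀ k, P.WinsCopy F p x k := Iff.rfl

/-! ### Random queries for fixed positions -/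

section Local

variable (P : Planting κ N r L) {F : (Grid N → Letter) → Grid N → Letter}
  {S : Grid N → Finset (Grid N)}

/-- A new query of copy m reaches the output at o only through those input locations of m that lie
in the light cone of o. -/
theorem out_update (hF : ∀ o x x', (∀ v ∈ S o, x v = x' v) → F x o = F x' o)
    (p : Fin r → P.Pos) (x : Fin r → ghzQueries) (m : Fin r) (y : ghzQueries)
    {o : Grid N} (h : ∀ j, P.endpoint m (p m) j ∈ S o → (x m).1 j = y.1 j) :
    P.out F p (Function.update x m y) o = P.out F p x o := by
  refine hF o _ _ fun v hv => P.encode_congr p _ _ v fun i j hij => ?_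
  by_cases hi : i = m
  · subst hi
    rw [Function.update_self, h j (hij ▸ hv)]
  · rw [Function.update_of_ne hi]

/-- The input locations of an isolated copy lie outside the cones of all paths of lower copies. -/
theorem winsCopy_update_of_lt (hF : ∀ o x x', (∀ v ∈ S o, x v = x' v) → F x o = F x' o)
    {p : Fin r → P.Pos} {m k : Fin r} (hm : P.Isolated S p m) (hk : k < m)
    (x : Fin r → ghzQueries) (y : ghzQueries) :
    P.WinsCopy F p (Function.update x m y) k ↔ P.WinsCopy F p x k := by
  unfold WinsCopy
  rw [Function.update_of_ne hk.ne]
  have : ∀ j, reply (P.out F p (Function.update x m y)) (P.pathAt k (p k) j) ((x k).1 j) =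
      reply (P.out F p x) (P.pathAt k (p k) j) ((x k).1 j) := fun j =>
    reply_congr _ fun v hv => P.out_update hF p x m y fun l hl => absurd
      (Finset.mem_biUnion.2 ⟨v, List.mem_toFinset.2 hv, hl⟩)
      (hm l k j hk.le (by simp [hk.ne]))
  simp only [this]

/-- Along the j-th path of an isolated copy the outputs see only the j-th question of that copy.
With the other queries fixed, the corrected answers form a deterministic strategy without
communication, which fails on some query. -/
theorem exists_not_winsCopy (hF : ∀ o x x', (∀ v ∈ S o, x v = x' v) → F x o = F x' o)
    {p : Fin r → P.Pos} {k : Fin r} (hk : P.Isolated S p k) (x : Fin r → ghzQueries) :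
    ∃ y, ¬ P.WinsCopy F p (Function.update x k y) k := by
  classical
  obtain ⟨y, hy, hne⟩ := not_ghz_classical
    (fun y j => if hy : y ∈ ghzQueries then
      reply (P.out F p (Function.update x k ⟨y, hy⟩)) (P.pathAt k (p k) j) (y j) else 0)
    (fun y hy y' hy' j hj => by
      rw [dif_pos hy, dif_pos hy', ← hj]
      refine reply_congr _ fun v hv => ?_
      have := P.out_update hF p (Function.update x k ⟨y', hy'⟩) k ⟨y, hy⟩ (o := v)
        (fun l hl => by
          by_cases hlj : l = j
          · subst hlj; simp [hj]
          · exact absurd (Finset.mem_biUnion.2 ⟨v, List.mem_toFinset.2 hv, hl⟩)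
              (hk l k j le_rfl (by simpa using fun h => hlj h.symm)))
      rwa [Function.update_idem] at this)
  refine ⟨⟨y, hy⟩, fun hw => hne ?_⟩
  simpa [WinsCopy, hy] using hw

open scoped Classical in
/-- For fixed positions, every isolated copy reduces the winning probability by a factor `3 / 4`. -/
theorem card_wins_le (hF : ∀ o x x', (∀ v ∈ S o, x v = x' v) → F x o = F x' o)
    (p : Fin r → P.Pos) :
    ∑ x, (if ∀ k, P.WinsCopy F p x k then (1 : ℝ) else 0) ≤
      (∏ k, if P.Isolated S p k then (3 / 4 : ℝ) else 1) *
        Fintype.card (Fin r → ghzQueries) := by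
  have hne : Nonempty ghzQueries := ⟨⟨![0, 0, 0], by decide⟩⟩
  have key := sum_prod_le
    (fun k (x : Fin r → ghzQueries) => if P.WinsCopy F p x k then (1 : ℝ) else 0)
    (τ := 3 / 4) (by norm_num) (fun k x => by positivity)
    -- Copies that are not isolated are dropped from the product; their indicators are at most 1.
    (Finset.univ.filter (P.Isolated S p))
    (fun k _ m hm hkm x y => by
      simp only [P.winsCopy_update_of_lt hF (Finset.mem_filter.1 hm).2 hkm x y])
    (fun k hk x => by
      obtain ⟨y, hy⟩ := P.exists_not_winsCopy hF (Finset.mem_filter.1 hk).2 x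
      calc ∑ y, (if P.WinsCopy F p (Function.update x k y) k then (1 : ℝ) else 0)
          ≤ ∑ z, (if z = y then (0 : ℝ) else 1) := by
            refine Finset.sum_le_sum fun z _ => ?_
            by_cases hz : z = y
            · subst hz; simp [hy]
            · simp only [hz, if_false]; split_ifs <;> norm_num
        _ = 3 / 4 * Fintype.card ghzQueries := by
            rw [Finset.sum_ite, Finset.sum_const_zero, zero_add, Finset.sum_const,
              Finset.filter_ne' (Finset.univ : Finset ghzQueries) y,
              Finset.card_erase_of_mem (Finset.mem_univ _), Finset.card_univ, card_ghzQueries]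
            norm_num)
  rw [Finset.prod_ite, Finset.prod_const_one, mul_one, Finset.prod_const]
  refine le_trans (Finset.sum_le_sum fun x _ => ?_) key
  split_ifs with h
  · simp [h]
  · exact Finset.prod_nonneg fun k _ => by positivity

end Local

/-! ### Random positions -/

section Positions

variable (P : Planting κ N r L) {S : Grid N → Finset (Grid N)} {B Λ : ℕ}

open scoped Classical in
/-- A random input location rarely lies in a given set that does not depend on it. -/
theorem card_endpoint_mem_le (k : Fin r) (b : Fin 4 ↪ Fin P.T) (s : Fin (L / 3)) (j : Fin 3)
    (X : (Fin 3 → Fin (2 * L + 1) × Fin (2 * L + 1)) → Finset (Grid N)) {D : ℕ}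
    (hX : ∀ o, (X o).card ≤ D) (hXj : ∀ o e, X (Function.update o j e) = X o) :
    (2 * L + 1 : ℝ) ^ 2 * ∑ o, (if P.endpoint k (b, o, s) j ∈ X o then (1 : ℝ) else 0) ≤
      D * Fintype.card (Fin 3 → Fin (2 * L + 1) × Fin (2 * L + 1)) := by
  have h := sum_sum_update (α := Fin (2 * L + 1) × Fin (2 * L + 1)) j
    (fun o => if P.endpoint k (b, o, s) j ∈ X o then (1 : ℝ) else 0)
  have hc : (Fintype.card (Fin (2 * L + 1) × Fin (2 * L + 1)) : ℝ) = (2 * L + 1 : ℝ) ^ 2 := by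
    simp [sq]
  rw [hc] at h
  rw [← h]
  calc _ ≤ ∑ _o : Fin 3 → Fin (2 * L + 1) × Fin (2 * L + 1), (D : ℝ) := by
        refine Finset.sum_le_sum fun o _ => ?_
        rw [Finset.sum_ite, Finset.sum_const_zero, add_zero, Finset.sum_const, nsmul_eq_mul,
          mul_one]
        refine Nat.cast_le.2 (le_trans ?_ (hX o))
        refine Finset.card_le_card_of_injOn
          (fun e => P.endpoint k (b, Function.update o j e, s) j) (fun e he => ?_) ?_
        · have := (Finset.mem_filter.1 he).2
          rw [hXj] at this
          exact this
        · intro e _ e' _ hee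
          have h1 := P.endpoint_val k (b, Function.update o j e, s) j
          have h2 := P.endpoint_val k (b, Function.update o j e', s) j
          simp only at hee
          rw [hee] at h1
          simp only [Function.update_self] at h1 h2
          exact Prod.ext (Fin.ext (by omega)) (Fin.ext (by omega))
    _ = _ := by simp [mul_comm]

open scoped Classical in
-- Union bound over the 3 input locations of the copy and the 3r paths. Each cone has at most Λ·B
-- vertices and does not depend on the offset of the location tested, so each event has probability
-- at most Λ·B/(2L+1)^2; the constant 18 = 2·3·3 brings the total down to 1/2.
theorem card_not_isolated_le (hS : ∀ o, (S o).card ≤ B)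
    (hΛ : ∀ i y j, (P.pathAt i y j).length ≤ Λ)
    (hB : 18 * (r * (Λ * B)) ≤ (2 * L + 1) ^ 2) (p : Fin r → P.Pos) (k : Fin r) :
    ∑ y, (if P.Isolated S (Function.update p k y) k then (0 : ℝ) else 1) ≤
      1 / 2 * Fintype.card P.Pos := by
  have hW : (0 : ℝ) < (2 * L + 1 : ℝ) ^ 2 := by positivity
  set O := Fin 3 → Fin (2 * L + 1) × Fin (2 * L + 1) with hO
  have hpair : ∀ (b : Fin 4 ↪ Fin P.T) (s : Fin (L / 3)) (j : Fin 3) (z : Fin r × Fin 3),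
      (2 * L + 1 : ℝ) ^ 2 * ∑ o : O, (if z ≠ (k, j) ∧ P.endpoint k (b, o, s) j ∈
        P.cone S z.1 (Function.update p k (b, o, s) z.1) z.2 then (1 : ℝ) else 0) ≤
      (Λ * B : ℕ) * Fintype.card O := by
    intro b s j z
    by_cases hz : z = (k, j)
    · simp only [hz, ne_eq, not_true_eq_false, false_and, if_false, Finset.sum_const_zero,
        mul_zero]
      positivity
    · simp only [ne_eq, hz, not_false_eq_true, true_and]
      refine P.card_endpoint_mem_le k b s j
        (fun o => P.cone S z.1 (Function.update p k (b, o, s) z.1) z.2)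
        (fun o => P.card_cone_le hS hΛ _ _ _) fun o e => ?_
      -- Paths of other copies do not depend on `o`; within copy k, the path of another player
      -- depends on `o` only through that player's own offset.
      by_cases h1 : z.1 = k
      · have h2 : z.2 ≠ j := fun h => hz (Prod.ext h1 h)
        simp only [h1, Function.update_self]
        unfold cone pathAt
        simp only [Function.update_of_ne h2]
      · simp only [Function.update_of_ne h1]
  have hbs : ∀ (b : Fin 4 ↪ Fin P.T) (s : Fin (L / 3)),
      ∑ o : O, (if P.Isolated S (Function.update p k (b, o, s)) k then (0 : ℝ) else 1) ≤
        1 / 2 * Fintype.card O := by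
    intro b s
    refine le_of_mul_le_mul_left ?_ hW
    calc (2 * L + 1 : ℝ) ^ 2 *
          ∑ o : O, (if P.Isolated S (Function.update p k (b, o, s)) k then (0 : ℝ) else 1)
        ≤ (2 * L + 1 : ℝ) ^ 2 * ∑ o : O, ∑ j : Fin 3, ∑ z : Fin r × Fin 3,
          (if z ≠ (k, j) ∧ P.endpoint k (b, o, s) j ∈
            P.cone S z.1 (Function.update p k (b, o, s) z.1) z.2 then (1 : ℝ) else 0) := by
          refine mul_le_mul_of_nonneg_left (Finset.sum_le_sum fun o _ => ?_) hW.le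
          split_ifs with hI
          · exact Finset.sum_nonneg fun _ _ => Finset.sum_nonneg fun _ _ => by positivity
          · unfold Isolated at hI
            push Not at hI
            obtain ⟨j, i, j', _, hne, hmem⟩ := hI
            rw [Function.update_self] at hmem
            refine le_trans ?_ (Finset.single_le_sum (f := fun j => ∑ z : Fin r × Fin 3,
              (if z ≠ (k, j) ∧ P.endpoint k (b, o, s) j ∈
              P.cone S z.1 (Function.update p k (b, o, s) z.1) z.2 then (1 : ℝ) else 0))
              (fun j _ => Finset.sum_nonneg fun _ _ => by positivity) (Finset.mem_univ j))
            refine le_trans ?_ (Finset.single_le_sum (f := fun z : Fin r × Fin 3 =>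
              (if z ≠ (k, j) ∧ P.endpoint k (b, o, s) j ∈
              P.cone S z.1 (Function.update p k (b, o, s) z.1) z.2 then (1 : ℝ) else 0))
              (fun _ _ => by positivity) (Finset.mem_univ (i, j')))
            rw [if_pos ⟨hne, hmem⟩]
      _ = ∑ j : Fin 3, ∑ z : Fin r × Fin 3, (2 * L + 1 : ℝ) ^ 2 * ∑ o : O,
          (if z ≠ (k, j) ∧ P.endpoint k (b, o, s) j ∈
            P.cone S z.1 (Function.update p k (b, o, s) z.1) z.2 then (1 : ℝ) else 0) := by
          rw [Finset.sum_comm, Finset.mul_sum]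
          refine Finset.sum_congr rfl fun j _ => ?_
          rw [Finset.sum_comm, Finset.mul_sum]
      _ ≤ ∑ _j : Fin 3, ∑ _z : Fin r × Fin 3, ((Λ * B : ℕ) : ℝ) * Fintype.card O :=
          Finset.sum_le_sum fun j _ => Finset.sum_le_sum fun z _ => hpair b s j z
      _ = ((9 * (r * (Λ * B)) : ℕ) : ℝ) * Fintype.card O := by
          simp only [Finset.sum_const, Finset.card_univ, Fintype.card_prod, Fintype.card_fin,
            nsmul_eq_mul]
          push_cast; ring
      _ ≤ ((2 * L + 1 : ℝ) ^ 2 / 2) * Fintype.card O := by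
          refine mul_le_mul_of_nonneg_right ?_ (by positivity)
          have : ((18 * (r * (Λ * B)) : ℕ) : ℝ) ≤ (((2 * L + 1) ^ 2 : ℕ) : ℝ) := by
            exact_mod_cast hB
          push_cast at this ⊢
          linarith
      _ = _ := by ring
  calc ∑ y, (if P.Isolated S (Function.update p k y) k then (0 : ℝ) else 1)
      = ∑ b, ∑ s, ∑ o : O,
          (if P.Isolated S (Function.update p k (b, o, s)) k then (0 : ℝ) else 1) := by
        rw [Fintype.sum_prod_type]
        refine Finset.sum_congr rfl fun b _ => ?_
        rw [Fintype.sum_prod_type, Finset.sum_comm]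
    _ ≤ ∑ _b : Fin 4 ↪ Fin P.T, ∑ _s : Fin (L / 3), 1 / 2 * (Fintype.card O : ℝ) :=
        Finset.sum_le_sum fun b _ => Finset.sum_le_sum fun s _ => hbs b s
    _ = _ := by
        simp only [Finset.sum_const, Finset.card_univ, Fintype.card_prod, nsmul_eq_mul, Pos,
          ← hO]
        push_cast; ring

open scoped Classical in
-- A copy is isolated with conditional probability at least 1/2, so its average factor is at most
-- 3/4 + 1/4 · 1/2 = 7/8.
theorem sum_isolated_le (hS : ∀ o, (S o).card ≤ B)
    (hΛ : ∀ i y j, (P.pathAt i y j).length ≤ Λ)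
    (hB : 18 * (r * (Λ * B)) ≤ (2 * L + 1) ^ 2) :
    ∑ p : Fin r → P.Pos, ∏ k, (if P.Isolated S p k then (3 / 4 : ℝ) else 1) ≤
      (7 / 8) ^ r * Fintype.card (Fin r → P.Pos) := by
  have := P.pos_nonempty
  have key := sum_prod_le
    (fun k (p : Fin r → P.Pos) => if P.Isolated S p k then (3 / 4 : ℝ) else 1)
    (τ := 7 / 8) (by norm_num) (fun k p => by positivity) Finset.univ
    (fun k _ m _ hkm p y => by
      simp only [P.isolated_congr S (p := Function.update p m y) (p' := p) (k := k)
        fun i hi => Function.update_of_ne (hi.trans_lt hkm).ne _ _])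
    (fun k _ p => by
      have h := P.card_not_isolated_le hS hΛ hB p k
      calc ∑ y, (if P.Isolated S (Function.update p k y) k then (3 / 4 : ℝ) else 1)
          = ∑ y, (3 / 4 + 1 / 4 *
              (if P.Isolated S (Function.update p k y) k then (0 : ℝ) else 1)) :=
            Finset.sum_congr rfl fun y _ => by split_ifs <;> norm_num
        _ = 3 / 4 * Fintype.card P.Pos + 1 / 4 *
              ∑ y, (if P.Isolated S (Function.update p k y) k then (0 : ℝ) else 1) := by
            rw [Finset.sum_add_distrib, ← Finset.mul_sum, Finset.sum_const, Finset.card_univ,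
              nsmul_eq_mul, mul_comm]
        _ ≤ 7 / 8 * Fintype.card P.Pos := by linarith)
  simpa using key

open scoped Classical in
/-- A local map wins a planted game with exponentially small probability. -/
theorem sum_wins_le {F : (Grid N → Letter) → Grid N → Letter}
    (hF : ∀ o x x', (∀ v ∈ S o, x v = x' v) → F x o = F x' o)
    (hS : ∀ o, (S o).card ≤ B) (hΛ : ∀ i y j, (P.pathAt i y j).length ≤ Λ)
    (hB : 18 * (r * (Λ * B)) ≤ (2 * L + 1) ^ 2) :
    ∑ c, (if P.Wins c (F (P.encode c)) then (1 : ℝ) else 0) ≤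
      (7 / 8) ^ r * Fintype.card P.Instance := by
  rw [← P.instEquiv.sum_comp, ← Fintype.card_congr P.instEquiv, Fintype.sum_prod_type,
    Fintype.card_prod]
  simp only [P.wins_iff F]
  calc _ ≤ ∑ p, (∏ k, if P.Isolated S p k then (3 / 4 : ℝ) else 1) *
        Fintype.card (Fin r → ghzQueries) :=
        Finset.sum_le_sum fun p _ => P.card_wins_le hF p
    _ = (∑ p, ∏ k, if P.Isolated S p k then (3 / 4 : ℝ) else 1) *
        Fintype.card (Fin r → ghzQueries) := by rw [Finset.sum_mul]
    _ ≤ ((7 / 8) ^ r * Fintype.card (Fin r → P.Pos)) * Fintype.card (Fin r → ghzQueries) :=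
        mul_le_mul_of_nonneg_right (P.sum_isolated_le hS hΛ hB) (by positivity)
    _ = _ := by push_cast; ring

end Positions

/-! ### From counting instances to winning probabilities -/

open scoped Classical in
-- Averages over inputs become averages over instances, so that injectivity of `encode` is never
-- needed.
theorem sum_dist (P : Planting κ N r L) (g : (Grid N → Letter) → ℝ) :
    ∑ x, (P.game.dist x).toReal * g x =
      (Fintype.card P.Instance : ℝ)⁻¹ * ∑ c, g (P.encode c) := by
  have hx : ∀ x, (P.game.dist x).toReal =
      ∑ c, if x = P.encode c then (Fintype.card P.Instance : ℝ)⁻¹ else 0 := by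
    intro x
    simp only [game, PMF.map_apply, PMF.uniformOfFintype_apply, tsum_fintype]
    rw [ENNReal.toReal_sum (fun c _ => by
      split_ifs
      · exact ENNReal.inv_ne_top.2 (by
          have := P.instance_nonempty
          exact Nat.cast_ne_zero.2 Fintype.card_ne_zero)
      · exact ENNReal.zero_ne_top)]
    refine Finset.sum_congr rfl fun c _ => ?_
    split_ifs
    · rw [ENNReal.toReal_inv, ENNReal.toReal_natCast]
    · rfl
  simp only [hx, Finset.sum_mul, Finset.mul_sum]
  rw [Finset.sum_comm]
  refine Finset.sum_congr rfl fun c _ => ?_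
  rw [Finset.sum_eq_single (P.encode c) (fun x _ hx => by simp [hx]) (by simp)]
  simp

open scoped Classical in
/-- Shallow classical circuits win a planted game with exponentially small probability. -/
theorem winProb_classicalBehavior_le (P : Planting κ N r L) {Λ K m : ℕ}
    (ρ : PMF (Fin m → Letter)) (D : ClassicalCircuit Letter (Grid N ⊕ Fin m) (Grid N) K)
    (hΛ : ∀ i y j, (P.pathAt i y j).length ≤ Λ)
    (hB : 18 * (r * (Λ * (K + 1) ^ D.depth)) ≤ (2 * L + 1) ^ 2) :
    P.game.winProb (classicalBehavior ρ D) ≤ (7 / 8) ^ r := by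
  have hcard : (0 : ℝ) < Fintype.card P.Instance := by
    have := P.instance_nonempty
    exact_mod_cast Fintype.card_pos
  have hseed : ∀ s : Fin m → Letter,
      ∑ c, (if P.Wins c (D.eval (Sum.elim (P.encode c) s)) then (1 : ℝ) else 0) ≤
        (7 / 8) ^ r * Fintype.card P.Instance := by
    intro s
    obtain ⟨S, hS, hF⟩ := D.exists_light_cones s
    exact P.sum_wins_le (F := fun x => D.eval (Sum.elim x s)) hF hS hΛ hB
  have hρ : ∑ s, (ρ s).toReal = 1 := by
    rw [← ENNReal.toReal_sum (fun s _ => ρ.apply_ne_top s), ← tsum_fintype (L := .unconditional _),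
      ρ.tsum_coe]
    simp
  have hx : ∀ c, (∑ y, if (P.encode c, y) ∈ P.game.rel then
      classicalBehavior ρ D (P.encode c) y else 0) ≤
      ∑ s, (ρ s).toReal *
        (if P.Wins c (D.eval (Sum.elim (P.encode c) s)) then (1 : ℝ) else 0) := by
    intro c
    simp only [classicalBehavior]
    calc (∑ y, if (P.encode c, y) ∈ P.game.rel then
          ∑ s, (if D.eval (Sum.elim (P.encode c) s) = y then (ρ s).toReal else 0) else 0)
        ≤ ∑ y, ∑ s, (if D.eval (Sum.elim (P.encode c) s) = y then
            (ρ s).toReal * (if P.Wins c (D.eval (Sum.elim (P.encode c) s)) then (1 : ℝ) else 0)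
            else 0) := by
          refine Finset.sum_le_sum fun y _ => ?_
          split_ifs with h
          · refine Finset.sum_le_sum fun s _ => ?_
            split_ifs with h1 h2
            · simp
            -- The relation demands a win for every instance with this encoding, in particular for
            -- `c`.
            · exact absurd (h.2 c rfl) (h1 ▸ h2)
            · rfl
          · exact Finset.sum_nonneg fun s _ => by
              have := ENNReal.toReal_nonneg (a := ρ s)
              positivity
      _ = _ := by
          rw [Finset.sum_comm]
          simp
  rw [CircuitGame.winProb, P.sum_dist]
  calc _ ≤ (Fintype.card P.Instance : ℝ)⁻¹ * ∑ c, ∑ s, (ρ s).toReal *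
        (if P.Wins c (D.eval (Sum.elim (P.encode c) s)) then (1 : ℝ) else 0) :=
        mul_le_mul_of_nonneg_left (Finset.sum_le_sum fun c _ => hx c) (by positivity)
    _ = (Fintype.card P.Instance : ℝ)⁻¹ * ∑ s, (ρ s).toReal * ∑ c,
        (if P.Wins c (D.eval (Sum.elim (P.encode c) s)) then (1 : ℝ) else 0) := by
        rw [Finset.sum_comm]
        simp only [Finset.mul_sum]
    _ ≤ (Fintype.card P.Instance : ℝ)⁻¹ * ∑ s, (ρ s).toReal *
        ((7 / 8) ^ r * Fintype.card P.Instance) :=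
        mul_le_mul_of_nonneg_left (Finset.sum_le_sum fun s _ =>
          mul_le_mul_of_nonneg_left (hseed s) ENNReal.toReal_nonneg) (by positivity)
    _ = (7 / 8) ^ r := by
        rw [← Finset.sum_mul, hρ]
        field_simp

end Planting

/-! ### Unitarity of quantum circuits -/

namespace QGate

variable {W : Type} [DecidableEq W] [Fintype W]

/-- For each assignment of the qubits outside the support, the gate acts by its unitary matrix on
one slice of ψ, and the norm of every slice is preserved. -/
theorem sum_norm_sq_apply (g : QGate W) (ψ : (W → Bool) → ℂ) :
    ∑ z, ‖g.apply ψ z‖ ^ 2 = ∑ z, ‖ψ z‖ ^ 2 := by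
  set e := Equiv.piEquivPiSubtypeProd (fun k => k ∈ g.support) (fun _ : W => Bool) with he
  rw [← e.symm.sum_comp, ← e.symm.sum_comp, Fintype.sum_prod_type_right,
    Fintype.sum_prod_type_right]
  refine Finset.sum_congr rfl fun w _ => ?_
  have h1 : ∀ s, g.apply ψ (e.symm (s, w)) =
      g.mat.mulVec (fun t => ψ (e.symm (t, w))) s := by
    intro s
    refine Finset.sum_congr rfl fun t _ => ?_
    congr 2
    · funext k
      simp [he, Equiv.piEquivPiSubtypeProd]
    · funext k
      simp only [he, Equiv.piEquivPiSubtypeProd, Equiv.coe_fn_symm_mk]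
      split_ifs <;> rfl
  simp only [h1]
  suffices h : ∀ φ, ∑ s, ‖g.mat.mulVec φ s‖ ^ 2 = ∑ s, ‖φ s‖ ^ 2 from h _
  intro φ
  have h2 : star (g.mat.mulVec φ) ⬝ᵥ g.mat.mulVec φ = star φ ⬝ᵥ φ := by
    rw [Matrix.star_mulVec, ← Matrix.dotProduct_mulVec, Matrix.mulVec_mulVec, g.isUnitary,
      Matrix.one_mulVec]
  have h3 : ∀ χ : (g.support → Bool) → ℂ, star χ ⬝ᵥ χ = ((∑ s, ‖χ s‖ ^ 2 : ℝ) : ℂ) := by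
    intro χ
    simp only [dotProduct, Pi.star_apply, RCLike.star_def, Complex.conj_mul']
    push_cast
    rfl
  rw [h3, h3] at h2
  exact_mod_cast h2

end QGate

theorem QLayer.sum_norm_sq_apply {W : Type} [DecidableEq W] [Fintype W] (l : QLayer W)
    (ψ : (W → Bool) → ℂ) : ∑ z, ‖l.apply ψ z‖ ^ 2 = ∑ z, ‖ψ z‖ ^ 2 := by
  unfold QLayer.apply
  induction l.gates with
  | nil => rfl
  | cons g gs ih => rw [List.foldr_cons, QGate.sum_norm_sq_apply, ih]

namespace QCircuit

variable {N a : ℕ}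

theorem sum_norm_sq_finalState (Q : QCircuit N a) (x : Grid N → Letter) :
    ∑ z, ‖Q.finalState x z‖ ^ 2 = 1 := by
  have h : ∀ (Q : QCircuit N a) (ψ : (QWire N a → Bool) → ℂ),
      ∑ z, ‖List.foldl (fun ψ l => QLayer.apply l ψ) ψ Q z‖ ^ 2 = ∑ z, ‖ψ z‖ ^ 2 := by
    intro Q
    induction Q with
    | nil => exact fun _ => rfl
    | cons l Q ih => exact fun ψ => (ih _).trans (l.sum_norm_sq_apply ψ)
  rw [finalState, h]
  simp [init, apply_ite]

open scoped Classical in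
/-- If every output of nonzero amplitude lies in a set, then the output lies in it with
certainty. -/
theorem sum_behavior_eq_one (Q : QCircuit N a) (x : Grid N → Letter)
    (Y : Set (Grid N → Letter))
    (h : ∀ z, Q.finalState x z ≠ 0 → (fun v k => z (v, Sum.inl k)) ∈ Y) :
    (∑ y, if y ∈ Y then Q.behavior x y else 0) = 1 := by
  rw [← Q.sum_norm_sq_finalState x]
  calc (∑ y, if y ∈ Y then Q.behavior x y else 0)
      = ∑ y, ∑ z : QWire N a → Bool, (if (fun v k => z (v, Sum.inl k)) = y then
          (if y ∈ Y then ‖Q.finalState x z‖ ^ 2 else 0) else 0) := by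
        refine Finset.sum_congr rfl fun y _ => ?_
        unfold behavior
        split_ifs <;> simp
    _ = ∑ z : QWire N a → Bool, (if (fun v k => z (v, Sum.inl k)) ∈ Y then
          ‖Q.finalState x z‖ ^ 2 else 0) := by
        rw [Finset.sum_comm]
        exact Finset.sum_congr rfl fun z _ => by rw [Finset.sum_ite_eq]; simp
    _ = _ := by
        refine Finset.sum_congr rfl fun z _ => ?_
        split_ifs with hz
        · rfl
        · have : Q.finalState x z = 0 := by
            by_contra h0
            exact hz (h z h0)
          simp [this]

end QCircuit

open scoped Classical in
theorem Planting.winProb_eq_one {κ N r L a : ℕ} (P : Planting κ N r L) (Q : QCircuit N a)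
    (h : ∀ c z, Q.finalState (P.encode c) z ≠ 0 → P.Wins c fun v k => z (v, Sum.inl k)) :
    P.game.winProb Q.behavior = 1 := by
  have hcard : (Fintype.card P.Instance : ℝ) ≠ 0 := by
    have := P.instance_nonempty
    exact_mod_cast Fintype.card_ne_zero
  have h1 : ∀ c, (∑ y, if (P.encode c, y) ∈ P.game.rel then Q.behavior (P.encode c) y else 0)
      = 1 := fun c => Q.sum_behavior_eq_one (P.encode c) {y | (P.encode c, y) ∈ P.game.rel}
    -- Instances with the same encoding lead to the same final state, so the hypothesis applies to
    -- each of them.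
    fun z hz => ⟨⟨c, rfl⟩, fun c' hc' => h c' z (by rw [hc']; exact hz)⟩
  rw [CircuitGame.winProb, P.sum_dist]
  simp only [h1]
  rw [Finset.sum_const, Finset.card_univ, nsmul_eq_mul, mul_one, inv_mul_cancel₀ hcard]

/-! ### Gates along embeddings, and a normal form for one-Hadamard gates -/

namespace QGate

variable {W ι : Type} [DecidableEq W] [Fintype ι] [DecidableEq ι]

/-- The wires of an embedded register. -/
noncomputable def registerEquiv (f : ι ↪ W) : ι ≃ {w // w ∈ Finset.univ.map f} :=
  Equiv.ofBijective (fun i => ⟨f i, by simp⟩)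
    ⟨fun i j h => f.injective (Subtype.ext_iff.1 h), fun w => by
      obtain ⟨i, -, hi⟩ := Finset.mem_map.1 w.2
      exact ⟨i, Subtype.ext hi⟩⟩

/-- The gate that acts by a given unitary on an embedded register. -/
noncomputable def ofEmbedding (f : ι ↪ W) (m : Matrix (ι → Bool) (ι → Bool) ℂ)
    (hm : m.conjTranspose * m = 1) : QGate W where
  support := Finset.univ.map f
  mat := m.submatrix ((registerEquiv f).arrowCongr (Equiv.refl Bool)).symm
    ((registerEquiv f).arrowCongr (Equiv.refl Bool)).symm
  isUnitary := by
    rw [Matrix.conjTranspose_submatrix, Matrix.submatrix_mul_equiv, hm,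
      Matrix.submatrix_one_equiv]

theorem apply_ofEmbedding (f : ι ↪ W) (m : Matrix (ι → Bool) (ι → Bool) ℂ)
    (hm : m.conjTranspose * m = 1) (ψ : (W → Bool) → ℂ) (z : W → Bool) :
    (ofEmbedding f m hm).apply ψ z =
      ∑ t : ι → Bool, m (z ∘ f) t * ψ (Function.extend f t z) := by
  refine Fintype.sum_equiv ((registerEquiv f).arrowCongr (Equiv.refl Bool)).symm _ _ fun t => ?_
  congr 2
  funext k
  split_ifs with h
  · obtain ⟨i, -, rfl⟩ := Finset.mem_map.1 h
    rw [f.injective.extend_apply]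
    rfl
  · rw [Function.extend_apply']
    rintro ⟨i, rfl⟩
    exact h (by simp [ofEmbedding])

end QGate

/-- The sign of a bit. -/
def bsgn (b : Bool) : ℂ := if b then -1 else 1

@[simp] theorem bsgn_false : bsgn false = 1 := rfl

@[simp] theorem bsgn_true : bsgn true = -1 := rfl

theorem bsgn_mul_self (b : Bool) : bsgn b * bsgn b = 1 := by cases b <;> simp

section Hadamard

variable {ι : Type} [Fintype ι] [DecidableEq ι]

/-- The Hadamard gate on the wire `w`. -/
noncomputable def hadamard (w : ι) (z t : ι → Bool) : ℂ :=
  if ∀ k ≠ w, z k = t k then (Real.sqrt 2 : ℂ)⁻¹ * bsgn (z w && t w) else 0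

/-- Columns that differ off w have disjoint supports; otherwise only the two values at w contribute,
and the signs decide. -/
theorem sum_hadamard (w : ι) (t t' : ι → Bool) :
    ∑ z, star (hadamard w z t) * hadamard w z t' = if t = t' then 1 else 0 := by
  have hs : (Real.sqrt 2 : ℂ)⁻¹ * (Real.sqrt 2 : ℂ)⁻¹ = 1 / 2 := by
    rw [← mul_inv, ← Complex.ofReal_mul, Real.mul_self_sqrt (by norm_num)]
    norm_num
  have hstar : ∀ z t, star (hadamard w z t) = hadamard w z t := by
    intro z t
    unfold hadamard
    split_ifs
    · cases z w <;> cases t w <;> simp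
    · simp
  simp only [hstar]
  by_cases h : ∀ k ≠ w, t k = t' k
  · have hsub : ∑ z, hadamard w z t * hadamard w z t' =
        ∑ b : Bool, hadamard w (Function.update t w b) t *
          hadamard w (Function.update t w b) t' := by
      refine (Fintype.sum_of_injective (fun b : Bool => Function.update t w b)
        (Function.update_injective t w) _ _ (fun z hz => ?_) fun b => rfl).symm
      have : ¬ ∀ k ≠ w, z k = t k := fun hk => hz ⟨z w, by
        funext k
        by_cases hkw : k = w
        · subst hkw; simp
        · simp [hkw, hk k hkw]⟩
      simp [hadamard, this]
    have h1 : ∀ b, ∀ k ≠ w, Function.update t w b k = t k := fun b k hk => by simp [hk]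
    have h2 : ∀ b, ∀ k ≠ w, Function.update t w b k = t' k := fun b k hk => by simp [hk, h k hk]
    have hH1 : ∀ b, hadamard w (Function.update t w b) t =
        (Real.sqrt 2 : ℂ)⁻¹ * bsgn (b && t w) := fun b => by
      rw [hadamard, if_pos (h1 b), Function.update_self]
    have hH2 : ∀ b, hadamard w (Function.update t w b) t' =
        (Real.sqrt 2 : ℂ)⁻¹ * bsgn (b && t' w) := fun b => by
      rw [hadamard, if_pos (h2 b), Function.update_self]
    have htt : t = t' ↔ t w = t' w := ⟨fun e => by rw [e], fun e => by
      funext k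
      by_cases hk : k = w
      · rw [hk, e]
      · exact h k hk⟩
    rw [hsub]
    simp only [hH1, hH2, htt, Fintype.sum_bool]
    cases t w <;> cases t' w <;> simp <;> linear_combination 2 * hs
  · have : t ≠ t' := fun e => h fun k _ => by rw [e]
    rw [if_neg this]
    refine Finset.sum_eq_zero fun z _ => ?_
    unfold hadamard
    split_ifs with h1 h2
    · exact absurd (fun k hk => (h1 k hk).symm.trans (h2 k hk)) h
    all_goals simp

/-- A Hadamard gate between two monomial gates. -/
noncomputable def oneHadamard (w : ι) (ph : (ι → Bool) → ℂ) (f e : (ι → Bool) ≃ (ι → Bool)) :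
    Matrix (ι → Bool) (ι → Bool) ℂ :=
  fun z t => ph t * hadamard w (f z) (e t)

/-- Summation over z absorbs the permutation f, which leaves the orthonormality of the Hadamard
columns. -/
theorem oneHadamard_isUnitary (w : ι) {ph : (ι → Bool) → ℂ} (hph : ∀ t, star (ph t) * ph t = 1)
    (f e : (ι → Bool) ≃ (ι → Bool)) :
    (oneHadamard w ph f e).conjTranspose * oneHadamard w ph f e = 1 := by
  ext t t'
  have h : ∀ z, star (oneHadamard w ph f e z t) * oneHadamard w ph f e z t' =
      star (ph t) * ph t' * (star (hadamard w (f z) (e t)) * hadamard w (f z) (e t')) :=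
    fun z => by simp only [oneHadamard, star_mul]; ring
  rw [Matrix.mul_apply]
  simp only [Matrix.conjTranspose_apply, h]
  rw [← Finset.mul_sum, f.sum_comp (fun z => star (hadamard w z (e t)) * hadamard w z (e t')),
    sum_hadamard, Matrix.one_apply]
  by_cases htt : t = t'
  · rw [htt, if_pos rfl, if_pos rfl, mul_one, hph]
  · simp [htt]

end Hadamard

/-! ### Preparation of GHZ states -/

section Fanout

variable {ι : Type} [DecidableEq ι]

/-- Controlled NOT gates from the wire `w` to all others. -/
def fanout (w : ι) : (ι → Bool) ≃ (ι → Bool) :=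
  Function.Involutive.toPerm (fun z k => if k = w then z w else xor (z k) (z w)) fun z => by
    funext k
    by_cases hk : k = w <;> simp [hk]

theorem fanout_apply (w : ι) (z : ι → Bool) (k : ι) :
    fanout w z k = if k = w then z w else xor (z k) (z w) := rfl

variable [Fintype ι]

/-- The unitary that prepares a GHZ state. -/
noncomputable def ghzPrep (w : ι) : Matrix (ι → Bool) (ι → Bool) ℂ :=
  oneHadamard w (fun _ => 1) (fanout w) (Equiv.refl _)

theorem ghzPrep_isUnitary (w : ι) : (ghzPrep w).conjTranspose * ghzPrep w = 1 :=
  oneHadamard_isUnitary w (fun _ => by simp) _ _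

open scoped Classical in
-- `fanout` is its own inverse, so applying it to z undoes the controlled NOTs; the result vanishes
-- off w exactly if z is constant.
theorem ghzPrep_apply_zero (w : ι) (z : ι → Bool) :
    ghzPrep w z (fun _ => false) =
      if ∀ i j, z i = z j then (Real.sqrt 2 : ℂ)⁻¹ else 0 := by
  have h : (∀ k ≠ w, fanout w z k = false) ↔ ∀ i j, z i = z j := by
    constructor
    · intro h
      have h' : ∀ k, z k = z w := fun k => by
        by_cases hk : k = w
        · rw [hk]
        · have := h k hk
          simpa [fanout_apply, hk] using this
      exact fun i j => (h' i).trans (h' j).symm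
    · intro h k hk
      simp [fanout_apply, hk, h k w]
  unfold ghzPrep oneHadamard hadamard
  simp only [Equiv.refl_apply, Bool.and_false, bsgn_false, mul_one, one_mul, ne_eq] at h ⊢
  simp only [h]

end Fanout

/-! ### Preparing GHZ states on disjoint supports in parallel -/

section Entangle

variable {W : Type} [DecidableEq W]

open scoped Classical in
/-- The gate prepares a GHZ state on its support from the all-zero state. -/
def QGate.PreparesGHZ (g : QGate W) : Prop :=
  ∀ z, g.mat z (fun _ => false) = if ∀ a b, z a = z b then (Real.sqrt 2 : ℂ)⁻¹ else 0

theorem QGate.preparesGHZ_ofEmbedding {ι : Type} [Fintype ι] [DecidableEq ι] (f : ι ↪ W)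
    (w : ι) : (QGate.ofEmbedding f (ghzPrep w) (ghzPrep_isUnitary w)).PreparesGHZ := by
  classical
  intro z
  refine (ghzPrep_apply_zero w _).trans ?_
  congr 1
  refine propext ⟨fun h a b => ?_, fun h i j => h _ _⟩
  obtain ⟨i, rfl⟩ := (registerEquiv f).surjective a
  obtain ⟨j, rfl⟩ := (registerEquiv f).surjective b
  exact h i j

/-- A basis state is constant on the supports of the gates and agrees with `z₀` elsewhere. -/
def ConstantOn (gs : List (QGate W)) (z₀ t : W → Bool) : Prop :=
  (∀ g ∈ gs, ∀ a ∈ g.support, ∀ b ∈ g.support, t a = t b) ∧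
    ∀ w, (∀ g ∈ gs, w ∉ g.support) → t w = z₀ w

open scoped Classical in
-- When a gate acts, its support still carries the zeros of z₀ because the supports are disjoint.
-- Hence only the zero column of its matrix contributes, and each gate adds one constancy condition
-- and one factor 1/√2.
theorem foldr_preparesGHZ (gs : List (QGate W)) (hg : ∀ g ∈ gs, g.PreparesGHZ)
    (hd : gs.Pairwise fun g h => Disjoint g.support h.support) (z₀ : W → Bool)
    (hz₀ : ∀ g ∈ gs, ∀ a ∈ g.support, z₀ a = false) (t : W → Bool) :
    gs.foldr QGate.apply (fun z => if z = z₀ then 1 else 0) t =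
      if ConstantOn gs z₀ t then (Real.sqrt 2 : ℂ)⁻¹ ^ gs.length else 0 := by
  induction gs generalizing t with
  | nil =>
    have : ConstantOn [] z₀ t ↔ t = z₀ := by
      simp [ConstantOn, funext_iff]
    simp [this]
  | cons g gs ih =>
    rw [List.pairwise_cons] at hd
    have ih' := ih (fun g' h => hg g' (List.mem_cons_of_mem _ h)) hd.2
      (fun g' h => hz₀ g' (List.mem_cons_of_mem _ h))
    have hout : ∀ a ∈ g.support, ∀ g' ∈ gs, a ∉ g'.support := fun a ha g' hg' =>
      Finset.disjoint_left.1 (hd.1 g' hg') ha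
    rw [List.foldr_cons, QGate.apply]
    simp only [ih']
    rw [Finset.sum_eq_single (fun _ => false)]
    · rw [hg g List.mem_cons_self]
      set t' : W → Bool := fun k => if h : k ∈ g.support then false else t k with ht'
      have e1 : (∀ a b : g.support, t a = t b) ∧ ConstantOn gs z₀ t' ↔
          ConstantOn (g :: gs) z₀ t := by
        have hin : ∀ g' ∈ gs, ∀ a ∈ g'.support, t' a = t a := fun g' hg' a ha => by
          have : a ∉ g.support := fun h => hout a h g' hg' ha
          simp [ht', this]
        constructor
        · rintro ⟨h1, h2, h3⟩
          refine ⟨fun g' hg' a ha b hb => ?_, fun w hw => ?_⟩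
          · rcases List.mem_cons.1 hg' with rfl | hg'
            · exact h1 ⟨a, ha⟩ ⟨b, hb⟩
            · rw [← hin g' hg' a ha, ← hin g' hg' b hb, h2 g' hg' a ha b hb]
          · have hwg := hw g List.mem_cons_self
            have := h3 w fun g' hg' => hw g' (List.mem_cons_of_mem _ hg')
            simpa [ht', hwg] using this
        · rintro ⟨h1, h2⟩
          refine ⟨fun a b => h1 g List.mem_cons_self a a.2 b b.2,
            fun g' hg' a ha b hb => ?_, fun w hw => ?_⟩
          · rw [hin g' hg' a ha, hin g' hg' b hb, h1 g' (List.mem_cons_of_mem _ hg') a ha b hb]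
          · by_cases hwg : w ∈ g.support
            · simp [ht', hwg, hz₀ g List.mem_cons_self w hwg]
            · rw [← h2 w (List.forall_mem_cons.2 ⟨hwg, hw⟩)]
              simp [ht', hwg]
      by_cases h1 : ∀ a b : g.support, t a = t b
      · by_cases h2 : ConstantOn gs z₀ t'
        · rw [if_pos h1, if_pos h2, if_pos (e1.1 ⟨h1, h2⟩), List.length_cons, pow_succ']
        · rw [if_neg h2, if_neg fun h => h2 (e1.2 h).2, mul_zero]
      · rw [if_neg h1, if_neg fun h => h1 (e1.2 h).1, zero_mul]
    · intro s _ hs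
      rw [if_neg, mul_zero]
      intro hc
      refine hs (funext fun a => ?_)
      have := hc.2 a (hout a a.2)
      simpa [hz₀ g List.mem_cons_self a a.2] using this
    · simp

end Entangle

/-! ### A layer with the same gate at all vertices -/

section VertexLayer

variable {N a : ℕ}

/-- The qubits at a vertex. -/
def vertexWires (v : Grid N) : (Fin 8 ⊕ Fin a) ↪ QWire N a :=
  ⟨fun k => (v, k), fun _ _ h => (Prod.ext_iff.1 h).2⟩

variable {m : Matrix (Fin 8 ⊕ Fin a → Bool) (Fin 8 ⊕ Fin a → Bool) ℂ}
  (hm : m.conjTranspose * m = 1)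

/-- The gate `m` at the vertex `v`. -/
noncomputable def vertexGate (v : Grid N) : QGate (QWire N a) :=
  QGate.ofEmbedding (vertexWires v) m hm

theorem extend_vertexWires (v : Grid N) (t : Fin 8 ⊕ Fin a → Bool) (z : QWire N a → Bool)
    (w : QWire N a) :
    Function.extend (vertexWires v) t z w = if w.1 = v then t w.2 else z w := by
  obtain ⟨u, k⟩ := w
  by_cases h : u = v
  · subst h
    rw [if_pos rfl]
    exact (vertexWires u).injective.extend_apply t z k
  · rw [if_neg h, Function.extend_apply']
    rintro ⟨i, hi⟩
    exact h (Prod.ext_iff.1 hi).1.symm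

open scoped Classical in
/-- How a Pauli type symmetry of a state changes under a layer with gates at single vertices. -/
theorem foldr_vertexGate (x : Grid N → Letter) (α : Grid N → Fin 8 ⊕ Fin a → Bool)
    (c c' : Grid N → (Fin 8 ⊕ Fin a → Bool) → ℂ)
    (hloc : ∀ v z t, (∀ k, t (Sum.inl k) = x v k) →
      m z (fun k => xor (t k) (α v k)) * c v t = c' v z * m z t)
    (ψ : (QWire N a → Bool) → ℂ)
    (hx : ∀ z, ψ z ≠ 0 → ∀ v k, z (v, Sum.inl k) = x v k)
    (hψ : ∀ z, ψ (fun w => xor (z w) (α w.1 w.2)) = (∏ v, c v fun k => z (v, k)) * ψ z)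
    (D : List (Grid N)) (hD : D.Nodup) (z : QWire N a → Bool) :
    ((D.map (vertexGate hm)).foldr QGate.apply ψ z ≠ 0 →
        ∀ v ∉ D, ∀ k, z (v, Sum.inl k) = x v k) ∧
      (D.map (vertexGate hm)).foldr QGate.apply ψ
          (fun w => xor (z w) (if w.1 ∈ D then false else α w.1 w.2)) =
        (∏ v, (if v ∈ D then c' v else c v) fun k => z (v, k)) *
          (D.map (vertexGate hm)).foldr QGate.apply ψ z := by
  -- `D` lists the vertices already measured. There the flips are gone and the sign `c` has turned
  -- into the outcome sign `c'`; off `D` the letters are still those of the input, as `hloc`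
  -- requires.
  induction D generalizing z with
  | nil => exact ⟨fun h v _ => hx z h v, by simpa using hψ z⟩
  | cons v D ih =>
    rw [List.nodup_cons] at hD
    have ih' := ih hD.2
    have happ : ∀ φ z, (vertexGate hm v).apply φ z =
        ∑ t, m (z ∘ vertexWires v) t * φ (Function.extend (vertexWires v) t z) :=
      QGate.apply_ofEmbedding (vertexWires v) m hm
    simp only [List.map_cons, List.foldr_cons, happ]
    set φ := (D.map (vertexGate hm)).foldr QGate.apply ψ with hφ
    constructor
    · intro hne u hu k
      rw [List.mem_cons, not_or] at hu
      obtain ⟨t, -, ht⟩ := Finset.exists_ne_zero_of_sum_ne_zero hne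
      have := (ih' _).1 (right_ne_zero_of_mul ht) u hu.2 k
      rwa [extend_vertexWires, if_neg hu.1] at this
    · have hz : (fun w : QWire N a => xor (z w) (if w.1 ∈ v :: D then false else α w.1 w.2)) ∘
          vertexWires v = z ∘ vertexWires v := by
        funext k
        change xor (z (v, k)) (if v ∈ v :: D then false else _) = z (v, k)
        rw [if_pos List.mem_cons_self, Bool.xor_false]
      rw [hz]
      have hinv : Function.Involutive fun (t : Fin 8 ⊕ Fin a → Bool) k => xor (t k) (α v k) :=
        fun t => by funext k; simp
      -- Shifting the summation variable by `α v` moves the flip from the state to the column index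
      -- of `m`, where `hloc` applies.
      rw [← Equiv.sum_comp (hinv.toPerm _), Finset.mul_sum]
      refine Finset.sum_congr rfl fun t _ => ?_
      change m _ (fun k => xor (t k) (α v k)) * φ (Function.extend _
        (fun k => xor (t k) (α v k)) _) = _
      have hpatch : Function.extend (vertexWires v) (fun k => xor (t k) (α v k))
          (fun w : QWire N a => xor (z w) (if w.1 ∈ v :: D then false else α w.1 w.2)) =
          fun w => xor (Function.extend (vertexWires v) t z w)
            (if w.1 ∈ D then false else α w.1 w.2) := by
        funext w
        simp only [extend_vertexWires]
        by_cases h : w.1 = v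
        · simp [h, hD.1]
        · simp [h]
      obtain ⟨h1, h2⟩ := ih' (Function.extend (vertexWires v) t z)
      rw [hpatch, h2]
      by_cases h0 : φ (Function.extend (vertexWires v) t z) = 0
      · rw [h0]; ring
      · have ht : ∀ k, t (Sum.inl k) = x v k := fun k => by
          have := h1 h0 v hD.1 k
          rwa [extend_vertexWires, if_pos rfl] at this
        have hl := hloc v (z ∘ vertexWires v) t ht
        have hp1 : (∏ u, (if u ∈ D then c' u else c u)
            fun k => Function.extend (vertexWires v) t z (u, k)) =
            c v t * ∏ u ∈ Finset.univ.erase v, (if u ∈ D then c' u else c u)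
              fun k => z (u, k) := by
          rw [← Finset.mul_prod_erase _ _ (Finset.mem_univ v)]
          congr 1
          · rw [if_neg hD.1]
            congr 1
            funext k
            rw [extend_vertexWires, if_pos rfl]
          · refine Finset.prod_congr rfl fun u hu => ?_
            refine congrArg _ (funext fun k => ?_)
            rw [extend_vertexWires, if_neg (Finset.ne_of_mem_erase hu)]
        have hp2 : (∏ u, (if u ∈ v :: D then c' u else c u) fun k => z (u, k)) =
            c' v (z ∘ vertexWires v) * ∏ u ∈ Finset.univ.erase v,
              (if u ∈ D then c' u else c u) fun k => z (u, k) := by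
          rw [← Finset.mul_prod_erase _ _ (Finset.mem_univ v)]
          congr 1
          · rw [if_pos List.mem_cons_self]
            rfl
          · refine Finset.prod_congr rfl fun u hu => ?_
            simp [Finset.ne_of_mem_erase hu]
        rw [hp1, hp2]
        linear_combination (∏ u ∈ Finset.univ.erase v, (if u ∈ D then c' u else c u)
          fun k => z (u, k)) * φ (Function.extend (vertexWires v) t z) * hl

/-- The layer with the gate `m` at every vertex. -/
noncomputable def vertexLayer (N : ℕ) : QLayer (QWire N a) where
  gates := (Finset.univ : Finset (Grid N)).toList.map (vertexGate hm)
  disjoint := by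
    rw [List.pairwise_map]
    refine (Finset.nodup_toList _).imp fun {u v} huv => ?_
    rw [Finset.disjoint_left]
    intro w hw hw'
    obtain ⟨i, -, hi⟩ := Finset.mem_map.1 hw
    obtain ⟨j, -, hj⟩ := Finset.mem_map.1 hw'
    exact huv (Prod.ext_iff.1 (hi.trans hj.symm)).1

/-- Once all vertices are measured no flip is left, so the symmetry compares an amplitude with
itself; if it is nonzero, the sign must be 1. -/
theorem prod_eq_one_of_vertexLayer_apply_ne_zero (x : Grid N → Letter)
    (α : Grid N → Fin 8 ⊕ Fin a → Bool)
    (c c' : Grid N → (Fin 8 ⊕ Fin a → Bool) → ℂ)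
    (hloc : ∀ v z t, (∀ k, t (Sum.inl k) = x v k) →
      m z (fun k => xor (t k) (α v k)) * c v t = c' v z * m z t)
    (ψ : (QWire N a → Bool) → ℂ)
    (hx : ∀ z, ψ z ≠ 0 → ∀ v k, z (v, Sum.inl k) = x v k)
    (hψ : ∀ z, ψ (fun w => xor (z w) (α w.1 w.2)) = (∏ v, c v fun k => z (v, k)) * ψ z)
    (z : QWire N a → Bool) (hz : (vertexLayer hm N).apply ψ z ≠ 0) :
    ∏ v, c' v (fun k => z (v, k)) = 1 := by
  have h := (foldr_vertexGate hm x α c c' hloc ψ hx hψ _ (Finset.nodup_toList Finset.univ) z).2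
  simp only [Finset.mem_toList, Finset.mem_univ, if_true, Bool.xor_false] at h
  have h' : 1 * (vertexLayer hm N).apply ψ z =
      (∏ v, c' v fun k => z (v, k)) * (vertexLayer hm N).apply ψ z := by
    rw [one_mul]; exact h
  exact (mul_right_cancel₀ hz h').symm

end VertexLayer

/-! ### The gate that measures at a vertex -/

/-- The direction with a given two-bit code. -/
def Dir.ofBits : Bool → Bool → Dir
  | false, false => left
  | false, true => right
  | true, false => down
  | true, true => up

theorem Dir.ofBits_bits (d : Dir) : Dir.ofBits d.bits.1 d.bits.2 = d := by cases d <;> rfl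

/-- The ancilla that is entangled with the neighbor in a given direction. -/
def Dir.port : Dir → Fin 7
  | left => 0
  | right => 1
  | down => 2
  | up => 3

theorem Dir.port_injective : Function.Injective Dir.port := by
  intro d d' h
  cases d <;> cases d' <;> first | rfl | exact absurd h (by decide)

/-- The ancilla holding the share of a GHZ state, for the path leaving in a given direction. -/
def Dir.ghzPort : Dir → Fin 7
  | left => 5
  | right => 5
  | down => 4
  | up => 6

theorem Dir.port_val_lt (d : Dir) : d.port.val < 4 := by cases d <;> decide

theorem Dir.le_ghzPort_val (d : Dir) : 4 ≤ d.ghzPort.val := by cases d <;> decide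

theorem Dir.ghzPort_ne_port (d d' : Dir) : d.ghzPort ≠ d'.port := fun h => by
  have h1 := d.le_ghzPort_val
  have h2 := d'.port_val_lt
  rw [h] at h1
  omega

namespace VertexGate

/-- The first ancilla that is measured at a vertex with a given input letter. -/
def portA (l : Letter) : Fin 7 :=
  if l 0 && !l 1 then (Dir.ofBits (l 6) (l 7)).ghzPort else (Dir.ofBits (l 4) (l 5)).port

/-- The second ancilla that is measured at a vertex with a given input letter. -/
def portB (l : Letter) : Fin 7 := (Dir.ofBits (l 6) (l 7)).port

/-- The input letter marks an input location. -/
def isTerm (l : Letter) : Bool := l 0 && l 1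

/-- A permutation that moves the measured ancillas to the front. -/
def toFront (l : Letter) : Equiv.Perm (Fin 7) :=
  if isTerm l then Equiv.swap 0 (portA l)
  else Equiv.swap 0 (portA l) * Equiv.swap 1 (Equiv.swap 0 (portA l) (portB l))

theorem toFront_zero_of_isTerm {l : Letter} (h : isTerm l = true) :
    toFront l 0 = portA l := by
  simp [toFront, h]

/-- The inner transposition aims at the preimage of `portB` under the outer one, so that both ports
arrive correctly even if one of them is 0 or 1. -/
theorem toFront_of_not_isTerm {l : Letter} (h : isTerm l = false) (hAB : portA l ≠ portB l) :
    toFront l 0 = portA l ∧ toFront l 1 = portB l := by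
  simp only [toFront, h, Bool.false_eq_true, if_false, Equiv.Perm.coe_mul, Function.comp_apply]
  generalize portA l = a at *
  generalize portB l = b at *
  revert a b
  decide

/-- A controlled NOT gate. -/
def cnot : (Fin 7 → Bool) ≃ (Fin 7 → Bool) :=
  Function.Involutive.toPerm (fun u => Function.update u 1 (xor (u 0) (u 1))) fun u => by
    simp

theorem cnot_apply (u : Fin 7 → Bool) (k : Fin 7) :
    cnot u k = if k = 1 then xor (u 0) (u 1) else u k := by
  change Function.update u 1 (xor (u 0) (u 1)) k = _
  rw [Function.update_apply]

/-- The action on the ancillas before the Hadamard gate. -/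
def before (l : Letter) : (Fin 7 → Bool) ≃ (Fin 7 → Bool) :=
  ((toFront l).symm.arrowCongr (Equiv.refl Bool)).trans
    (if isTerm l then Equiv.refl _ else cnot)

theorem before_of_isTerm {l : Letter} (h : isTerm l = true) (t : Fin 7 → Bool) (k : Fin 7) :
    before l t k = t (toFront l k) := by
  simp [before, h]

theorem before_of_not_isTerm {l : Letter} (h : isTerm l = false) (t : Fin 7 → Bool)
    (k : Fin 7) :
    before l t k = if k = 1 then xor (t (toFront l 0)) (t (toFront l 1))
      else t (toFront l k) := by
  simp [before, h, cnot_apply]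

/-- The inverse of the action on the ancillas after the Hadamard gate. -/
def after (l : Letter) : (Fin 7 → Bool) ≃ (Fin 7 → Bool) :=
  if isTerm l then Equiv.refl _ else (Equiv.swap 0 1).arrowCongr (Equiv.refl Bool)

/-- A reversible operation on the ancillas that is controlled by the letter. -/
def controlled (g : Letter → (Fin 7 → Bool) ≃ (Fin 7 → Bool)) :
    (Fin 8 ⊕ Fin 7 → Bool) ≃ (Fin 8 ⊕ Fin 7 → Bool) where
  toFun t := Sum.elim (t ∘ Sum.inl) (g (t ∘ Sum.inl) (t ∘ Sum.inr))
  invFun t := Sum.elim (t ∘ Sum.inl) ((g (t ∘ Sum.inl)).symm (t ∘ Sum.inr))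
  left_inv t := by
    funext k
    rcases k with k | k <;> simp
  right_inv t := by
    funext k
    rcases k with k | k <;> simp

/-- The exchange of the two measurement outcomes with the first two bits of the letter. -/
def exchange : (Fin 8 ⊕ Fin 7 → Bool) ≃ (Fin 8 ⊕ Fin 7 → Bool) :=
  Equiv.arrowCongr (Equiv.swap (Sum.inl 0) (Sum.inr 0) * Equiv.swap (Sum.inl 1) (Sum.inr 1) :
    Equiv.Perm (Fin 8 ⊕ Fin 7)) (Equiv.refl Bool)

/-- The phase gate at input locations with question `1`. -/
noncomputable def phase (t : Fin 8 ⊕ Fin 7 → Bool) : ℂ :=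
  if isTerm (t ∘ Sum.inl) && t (Sum.inl 6) && t (Sum.inr (portA (t ∘ Sum.inl))) then
    Complex.I else 1

/-- The unitary of the gate: Bell measurements at the vertices of a path except its
last one, and measurements of Pauli observables at input locations. -/
noncomputable def mat : Matrix (Fin 8 ⊕ Fin 7 → Bool) (Fin 8 ⊕ Fin 7 → Bool) ℂ :=
  oneHadamard (Sum.inr 0) phase (exchange.trans (controlled after)) (controlled before)

theorem mat_isUnitary : mat.conjTranspose * mat = 1 :=
  oneHadamard_isUnitary _ (fun t => by unfold phase; split_ifs <;> simp) _ _

end VertexGate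

/-- This is the relation H X = Z H on the wire w. -/
theorem hadamard_flip {ι : Type} [Fintype ι] [DecidableEq ι] (w : ι) (z t : ι → Bool) :
    hadamard w z (fun k => xor (t k) (decide (k = w))) = bsgn (z w) * hadamard w z t := by
  have h : (∀ k ≠ w, z k = xor (t k) (decide (k = w))) ↔ ∀ k ≠ w, z k = t k :=
    forall₂_congr fun k hk => by simp [hk]
  unfold hadamard
  simp only [h]
  split_ifs
  · cases z w <;> cases t w <;> simp
  · simp

namespace VertexGate

theorem exchange_apply (z : Fin 8 ⊕ Fin 7 → Bool) :
    exchange z (Sum.inr 0) = z (Sum.inl 0) ∧ exchange z (Sum.inr 1) = z (Sum.inl 1) :=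
  ⟨rfl, rfl⟩

/-- The operator is X (q = 0) or XZ (q = 1) on both ports. After the controlled NOT, flipping both
ports flips only the Hadamard wire, whose outcome becomes the second bit of the letter. The parity
of the two ports becomes the first bit, which gives the sign that depends on q. -/
theorem mat_bell {l : Letter} (hl : isTerm l = false) (hAB : portA l ≠ portB l) (q : Bool)
    (z t : Fin 8 ⊕ Fin 7 → Bool) (ht : t ∘ Sum.inl = l) :
    mat z (fun k => xor (t k) (Sum.elim (fun _ => false)
        (fun i => decide (i = portA l ∨ i = portB l)) k)) *
        (bsgn (q && t (Sum.inr (portA l))) * bsgn (q && t (Sum.inr (portB l)))) =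
      bsgn (z (Sum.inl 1)) * bsgn (q && z (Sum.inl 0)) * mat z t := by
  obtain ⟨h0, h1⟩ := toFront_of_not_isTerm hl hAB
  set α : Fin 8 ⊕ Fin 7 → Bool := Sum.elim (fun _ => false)
    (fun i => decide (i = portA l ∨ i = portB l)) with hα
  have hlet : (fun k => xor (t k) (α k)) ∘ Sum.inl = l := by
    rw [← ht]; funext k; simp [hα]
  have hB : ∀ s : Fin 8 ⊕ Fin 7 → Bool, s ∘ Sum.inl = l →
      controlled before s = Sum.elim l (before l (s ∘ Sum.inr)) := by
    intro s hs
    change Sum.elim (s ∘ Sum.inl) (before (s ∘ Sum.inl) (s ∘ Sum.inr)) = _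
    rw [hs]
  have hphase : ∀ s : Fin 8 ⊕ Fin 7 → Bool, s ∘ Sum.inl = l → phase s = 1 := by
    intro s hs
    unfold phase
    simp only [hs, hl, Bool.false_and, Bool.false_eq_true, if_false]
  have hflip : controlled before (fun k => xor (t k) (α k)) =
      fun k => xor (controlled before t k) (decide (k = Sum.inr 0)) := by
    rw [hB _ hlet, hB _ ht]
    funext k
    rcases k with k | k
    · simp
    · simp only [Sum.elim_inr, before_of_not_isTerm hl, Function.comp_apply, hα, h0, h1]
      by_cases hk1 : k = 1
      · subst hk1
        cases t (Sum.inr (portA l)) <;> cases t (Sum.inr (portB l)) <;> simp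
      · by_cases hk0 : k = 0
        · subst hk0
          simp [h0]
        · have e0 : toFront l k ≠ portA l := fun h =>
            hk0 ((toFront l).injective (h.trans h0.symm))
          have e1 : toFront l k ≠ portB l := fun h =>
            hk1 ((toFront l).injective (h.trans h1.symm))
          simp [hk1, hk0, e0, e1]
  unfold mat oneHadamard
  rw [hphase _ hlet, hphase _ ht, hflip, hadamard_flip, one_mul, one_mul]
  set F := (exchange.trans (controlled after)) z with hF
  -- Where the Hadamard matrix vanishes both sides are 0; elsewhere z determines the letter and the
  -- parity of the ports.
  by_cases hH : ∀ k ≠ Sum.inr 0, F k = controlled before t k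
  · have hz : exchange z ∘ Sum.inl = l := by
      funext k
      have := hH (Sum.inl k) (by simp)
      rw [hB t ht] at this
      exact this
    have hFr : ∀ k, F (Sum.inr k) = exchange z (Sum.inr (Equiv.swap 0 1 k)) := by
      intro k
      change after (exchange z ∘ Sum.inl) (exchange z ∘ Sum.inr) k = _
      rw [hz, after, hl]
      simp
    have e0 : F (Sum.inr 0) = z (Sum.inl 1) := by
      rw [hFr, Equiv.swap_apply_left, (exchange_apply z).2]
    have e1 : z (Sum.inl 0) = xor (t (Sum.inr (portA l))) (t (Sum.inr (portB l))) := by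
      have := hH (Sum.inr 1) (by simp)
      rw [hFr, Equiv.swap_apply_right, (exchange_apply z).1, hB t ht] at this
      simpa [before_of_not_isTerm hl, h0, h1] using this
    rw [e0, e1]
    cases q <;> cases t (Sum.inr (portA l)) <;> cases t (Sum.inr (portB l)) <;> simp
  · have : hadamard (Sum.inr 0) F (controlled before t) = 0 := if_neg hH
    rw [this]
    ring

/-- For question 1 the phase gate makes this a measurement of Y: flipping the port multiplies the
phase by I or by its inverse, and the sign of the port bit turns both into I. -/
theorem mat_pauli {l : Letter} (hl : isTerm l = true)
    (z t : Fin 8 ⊕ Fin 7 → Bool) (ht : t ∘ Sum.inl = l) :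
    mat z (fun k => xor (t k) (Sum.elim (fun _ => false)
        (fun i => decide (i = portA l)) k)) * bsgn (l 6 && t (Sum.inr (portA l))) =
      bsgn (z (Sum.inl 0)) * (if l 6 then Complex.I else 1) * mat z t := by
  have h0 := toFront_zero_of_isTerm hl
  set α : Fin 8 ⊕ Fin 7 → Bool := Sum.elim (fun _ => false)
    (fun i => decide (i = portA l)) with hα
  have hlet : (fun k => xor (t k) (α k)) ∘ Sum.inl = l := by
    rw [← ht]; funext k; simp [hα]
  have hB : ∀ s : Fin 8 ⊕ Fin 7 → Bool, s ∘ Sum.inl = l →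
      controlled before s = Sum.elim l (before l (s ∘ Sum.inr)) := by
    intro s hs
    change Sum.elim (s ∘ Sum.inl) (before (s ∘ Sum.inl) (s ∘ Sum.inr)) = _
    rw [hs]
  have hphase : ∀ s : Fin 8 ⊕ Fin 7 → Bool, s ∘ Sum.inl = l →
      phase s = if l 6 && s (Sum.inr (portA l)) then Complex.I else 1 := by
    intro s hs
    have h6 : s (Sum.inl 6) = l 6 := congrFun hs 6
    unfold phase
    rw [hs, hl, h6, Bool.true_and]
  have hflip : controlled before (fun k => xor (t k) (α k)) =
      fun k => xor (controlled before t k) (decide (k = Sum.inr 0)) := by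
    rw [hB _ hlet, hB _ ht]
    funext k
    rcases k with k | k
    · simp
    · simp only [Sum.elim_inr, before_of_isTerm hl, Function.comp_apply, hα]
      by_cases hk0 : k = 0
      · subst hk0
        simp [h0]
      · have e0 : toFront l k ≠ portA l := fun h =>
          hk0 ((toFront l).injective (h.trans h0.symm))
        simp [hk0, e0]
  unfold mat oneHadamard
  rw [hphase _ hlet, hphase _ ht, hflip, hadamard_flip]
  set F := (exchange.trans (controlled after)) z with hF
  by_cases hH : ∀ k ≠ Sum.inr 0, F k = controlled before t k
  · have hz : exchange z ∘ Sum.inl = l := by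
      funext k
      have := hH (Sum.inl k) (by simp)
      rw [hB t ht] at this
      exact this
    have e0 : F (Sum.inr 0) = z (Sum.inl 0) := by
      change after (exchange z ∘ Sum.inl) (exchange z ∘ Sum.inr) 0 = _
      rw [hz, after, hl]
      exact (exchange_apply z).1
    have eα : α (Sum.inr (portA l)) = true := by simp [hα]
    rw [e0, eα]
    cases l 6 <;> cases t (Sum.inr (portA l)) <;> simp
    · ring
    · ring_nf
      simp
  · have : hadamard (Sum.inr 0) F (controlled before t) = 0 := if_neg hH
    rw [this]
    ring

end VertexGate

/-! ### Symmetries of the measurement at a vertex -/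

namespace VertexSymbol

/-- The ancillas that are measured. -/
def ports : VertexSymbol → Finset (Fin 7)
  | blank => ∅
  | relay p n => {p.port, n.port}
  | hub _ n => {n.ghzPort, n.port}
  | term _ p _ => {p.port}

/-- Flips of the measured ancillas. -/
def flips (s : VertexSymbol) : Fin 8 ⊕ Fin 7 → Bool :=
  Sum.elim (fun _ => false) fun k => decide (k ∈ s.ports)

/-- The signs of the measured ancillas on question `q`. -/
def signs (s : VertexSymbol) (q : ZMod 2) (t : Fin 8 ⊕ Fin 7 → Bool) : ℂ :=
  ∏ k ∈ s.ports, bsgn (decide (q = 1) && t (Sum.inr k))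

/-- The sign of the outcome on question `q`. -/
noncomputable def outcome (s : VertexSymbol) (q : ZMod 2) (z : Fin 8 ⊕ Fin 7 → Bool) : ℂ :=
  match s with
  | blank => 1
  | relay _ _ => bsgn (z (Sum.inl 1)) * bsgn (decide (q = 1) && z (Sum.inl 0))
  | hub _ _ => bsgn (z (Sum.inl 1)) * bsgn (decide (q = 1) && z (Sum.inl 0))
  | term _ _ _ => bsgn (z (Sum.inl 0)) * (if q = 1 then Complex.I else 1)

/-- The symbol can occur on a simple path to an input location with question `q`. -/
def Admissible (q : ZMod 2) : VertexSymbol → Prop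
  | relay p n => p ≠ n
  | term _ _ q' => q' = q
  | _ => True

/-- Relays and hubs fall under `mat_bell`, input locations under `mat_pauli`. The two ports of a
relay are distinct by admissibility; at a hub the GHZ share is never an edge port. -/
theorem mat_flips {s : VertexSymbol} {q : ZMod 2} (hs : s.Admissible q) (hb : s ≠ blank)
    (z t : Fin 8 ⊕ Fin 7 → Bool) (ht : t ∘ Sum.inl = s.code) :
    VertexGate.mat z (fun k => xor (t k) (s.flips k)) * s.signs q t =
      s.outcome q z * VertexGate.mat z t := by
  cases s with
  | blank => exact absurd rfl hb
  | relay p n =>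
    have hA : VertexGate.portA (relay p n).code = p.port := by
      simp [VertexGate.portA, code, Dir.ofBits_bits]
    have hB : VertexGate.portB (relay p n).code = n.port := by
      simp [VertexGate.portB, code, Dir.ofBits_bits]
    have hne : p.port ≠ n.port := fun h => hs (Dir.port_injective h)
    have := VertexGate.mat_bell (l := (relay p n).code) rfl (by rwa [hA, hB])
      (decide (q = 1)) z t ht
    rw [hA, hB] at this
    simpa [flips, signs, outcome, ports, Finset.prod_pair hne] using this
  | hub j n =>
    have hA : VertexGate.portA (hub j n).code = n.ghzPort := by
      simp [VertexGate.portA, code, Dir.ofBits_bits]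
    have hB : VertexGate.portB (hub j n).code = n.port := by
      simp [VertexGate.portB, code, Dir.ofBits_bits]
    have hne : n.ghzPort ≠ n.port := Dir.ghzPort_ne_port n n
    have := VertexGate.mat_bell (l := (hub j n).code) rfl (by rwa [hA, hB])
      (decide (q = 1)) z t ht
    rw [hA, hB] at this
    simpa [flips, signs, outcome, ports, Finset.prod_pair hne] using this
  | term j p q' =>
    have hq : q' = q := hs
    subst hq
    have hA : VertexGate.portA (term j p q').code = p.port := by
      simp [VertexGate.portA, code, Dir.ofBits_bits]
    have h6 : (term j p q').code 6 = decide (q' = 1) := rfl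
    have := VertexGate.mat_pauli (l := (term j p q').code) rfl z t ht
    rw [hA, h6] at this
    simpa [flips, signs, outcome, ports] using this

end VertexSymbol

/-! ### Neighbors in the grid -/

/-- The opposite direction. -/
def Dir.opp : Dir → Dir
  | left => right
  | right => left
  | down => up
  | up => down

theorem Dir.opp_opp (d : Dir) : d.opp.opp = d := by cases d <;> rfl

namespace Grid

variable {N : ℕ}

/-- The vertex `w` is the neighbor of `v` in direction `d`. -/
def Next (d : Dir) (v w : Grid N) : Prop :=
  match d with
  | Dir.left => v.2 = w.2 ∧ w.1.val + 1 = v.1.val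
  | Dir.right => v.2 = w.2 ∧ v.1.val + 1 = w.1.val
  | Dir.down => v.1 = w.1 ∧ w.2.val + 1 = v.2.val
  | Dir.up => v.1 = w.1 ∧ v.2.val + 1 = w.2.val

theorem Next.dir_eq {d : Dir} {v w : Grid N} (h : Next d v w) : v.dir w = d := by
  unfold Grid.dir
  simp only [Fin.lt_def]
  cases d <;> obtain ⟨h1, h2⟩ := h <;> rw [Fin.ext_iff] at h1
  · rw [if_pos (by omega)]
  · rw [if_neg (by omega), if_pos (by omega)]
  · rw [if_neg (by omega), if_neg (by omega), if_pos (by omega)]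
  · rw [if_neg (by omega), if_neg (by omega), if_neg (by omega)]

theorem Next.symm {d : Dir} {v w : Grid N} (h : Next d v w) : Next d.opp w v := by
  cases d <;> exact ⟨h.1.symm, h.2⟩

theorem Adj.next {v w : Grid N} (h : Adj v w) : Next (v.dir w) v w := by
  obtain ⟨d, hd⟩ : ∃ d, Next d v w := by
    rcases h with ⟨h1, h2 | h2⟩ | ⟨h1, h2 | h2⟩
    · exact ⟨Dir.right, h1, h2⟩
    · exact ⟨Dir.left, h1, h2⟩
    · exact ⟨Dir.up, h1, h2⟩
    · exact ⟨Dir.down, h1, h2⟩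
  rwa [hd.dir_eq]

theorem Next.unique {d : Dir} {v w w' : Grid N} (h : Next d v w) (h' : Next d v w') :
    w = w' := by
  cases d <;> obtain ⟨h1, h2⟩ := h <;> obtain ⟨h3, h4⟩ := h' <;> rw [Fin.ext_iff] at h1 h3 <;>
    exact Prod.ext (Fin.ext (by omega)) (Fin.ext (by omega))

theorem Next.ne {d : Dir} {v w : Grid N} (h : Next d v w) : v ≠ w := by
  rintro rfl
  cases d <;> obtain ⟨h1, h2⟩ := h <;> omega

end Grid

/-! ### The symbols along a path -/

section PathSymbol

variable {N : ℕ} {l : List (Grid N)}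

theorem Grid.IsPath.next (hl : Grid.IsPath l) {n : ℕ} (hn : n + 1 < l.length) :
    Grid.Next (l[n].dir l[n + 1]) l[n] l[n + 1] :=
  (List.isChain_iff_getElem.1 hl.2 n hn).next

theorem pathSymbol_zero (hl : Grid.IsPath l) (h1 : 1 < l.length) (j : Fin 3) (q : ZMod 2) :
    pathSymbol l j q l[0] = VertexSymbol.hub j (l[0].dir l[1]) := by
  unfold pathSymbol
  rw [if_pos (List.getElem_mem _), hl.1.idxOf_getElem, if_pos rfl, List.getD_eq_getElem _ _ h1]

theorem pathSymbol_last (hl : Grid.IsPath l) {n : ℕ} (hn : n + 2 = l.length) (j : Fin 3)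
    (q : ZMod 2) :
    pathSymbol l j q l[n + 1] = VertexSymbol.term j (l[n + 1].dir l[n]) q := by
  unfold pathSymbol
  rw [if_pos (List.getElem_mem _), hl.1.idxOf_getElem, if_neg (by omega), if_pos (by omega),
    Nat.add_sub_cancel, List.getD_eq_getElem _ _ (by omega)]

theorem pathSymbol_mid (hl : Grid.IsPath l) {n : ℕ} (hn : n + 2 < l.length) (j : Fin 3)
    (q : ZMod 2) :
    pathSymbol l j q l[n + 1] =
      VertexSymbol.relay (l[n + 1].dir l[n]) (l[n + 1].dir l[n + 2]) := by
  unfold pathSymbol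
  rw [if_pos (List.getElem_mem _), hl.1.idxOf_getElem, if_neg (by omega), if_neg (by omega),
    Nat.add_sub_cancel, List.getD_eq_getElem _ _ (by omega), List.getD_eq_getElem _ _ hn]

/-- A simple path cannot turn back: equal directions would identify the vertices two steps apart. -/
theorem Grid.IsPath.dir_ne (hl : Grid.IsPath l) {n : ℕ} (hn : n + 2 < l.length) :
    l[n + 1].dir l[n] ≠ l[n + 1].dir l[n + 2] := by
  intro h
  have h1 := (hl.next (n := n) (by omega)).symm
  have h2 := hl.next (n := n + 1) (by omega)
  rw [← h1.dir_eq, h] at h1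
  have := (List.Nodup.getElem_inj_iff hl.1).1 (h1.unique h2)
  omega

theorem Grid.IsPath.dir_opp (hl : Grid.IsPath l) {n : ℕ} (hn : n + 1 < l.length) :
    l[n + 1].dir l[n] = (l[n].dir l[n + 1]).opp := (hl.next hn).symm.dir_eq

theorem pathSymbol_ne_blank {j : Fin 3} {q : ZMod 2} {v : Grid N} (hv : v ∈ l) :
    pathSymbol l j q v ≠ VertexSymbol.blank := by
  unfold pathSymbol
  rw [if_pos hv]
  split_ifs <;> simp

/-- Every vertex of a path is the first one, an inner one, or the last one. -/
theorem Grid.exists_index (h1 : 1 < l.length) {v : Grid N} (hv : v ∈ l) :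
    v = l[0] ∨ (∃ n, ∃ hn : n + 2 < l.length, v = l[n + 1]) ∨
      ∃ n, ∃ hn : n + 2 = l.length, v = l[n + 1] := by
  obtain ⟨n, hn, rfl⟩ := List.getElem_of_mem hv
  rcases n with _ | n
  · exact Or.inl rfl
  · rcases Nat.lt_or_ge (n + 2) l.length with h | h
    · exact Or.inr (Or.inl ⟨n, h, rfl⟩)
    · exact Or.inr (Or.inr ⟨n, by omega, rfl⟩)

theorem pathSymbol_admissible (hl : Grid.IsPath l) (h1 : 1 < l.length) (j : Fin 3) (q : ZMod 2)
    {v : Grid N} (hv : v ∈ l) : (pathSymbol l j q v).Admissible q := by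
  rcases Grid.exists_index h1 hv with rfl | ⟨n, hn, rfl⟩ | ⟨n, hn, rfl⟩
  · rw [pathSymbol_zero hl h1]; trivial
  · rw [pathSymbol_mid hl hn]; exact hl.dir_ne hn
  · rw [pathSymbol_last hl hn]; exact rfl

/-- A direction is measured at a vertex of a path if and only if the path contains the
corresponding edge. -/
theorem port_mem_ports_iff (hl : Grid.IsPath l) (h1 : 1 < l.length) (j : Fin 3) (q : ZMod 2)
    {v : Grid N} (hv : v ∈ l) (d : Dir) :
    d.port ∈ (pathSymbol l j q v).ports ↔
      ∃ n, ∃ hn : n + 1 < l.length,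
        (v = l[n] ∧ d = l[n].dir l[n + 1]) ∨ (v = l[n + 1] ∧ d = l[n + 1].dir l[n]) := by
  have hinj : ∀ {i k : ℕ} {hi : i < l.length} {hk : k < l.length}, l[i] = l[k] → i = k :=
    hl.1.getElem_inj_iff.1
  rcases Grid.exists_index h1 hv with rfl | ⟨n, hn, rfl⟩ | ⟨n, hn, rfl⟩
  · rw [pathSymbol_zero hl h1]
    simp only [VertexSymbol.ports, Finset.mem_insert, Finset.mem_singleton,
      (Dir.ghzPort_ne_port _ _).symm, false_or, Dir.port_injective.eq_iff]
    constructor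
    · exact fun h => ⟨0, h1, Or.inl ⟨rfl, h⟩⟩
    · rintro ⟨n, hn, ⟨h, h'⟩ | ⟨h, h'⟩⟩
      · obtain rfl : 0 = n := hinj h
        exact h'
      · exact absurd (hinj h) (by omega)
  · rw [pathSymbol_mid hl hn]
    simp only [VertexSymbol.ports, Finset.mem_insert, Finset.mem_singleton,
      Dir.port_injective.eq_iff]
    constructor
    · rintro (h | h)
      · exact ⟨n, by omega, Or.inr ⟨rfl, h⟩⟩
      · exact ⟨n + 1, hn, Or.inl ⟨rfl, h⟩⟩
    · rintro ⟨m, hm, ⟨h, h'⟩ | ⟨h, h'⟩⟩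
      · obtain rfl : n + 1 = m := hinj h
        exact Or.inr h'
      · obtain rfl : n = m := by have := hinj h; omega
        exact Or.inl h'
  · rw [pathSymbol_last hl hn]
    simp only [VertexSymbol.ports, Finset.mem_singleton, Dir.port_injective.eq_iff]
    constructor
    · exact fun h => ⟨n, by omega, Or.inr ⟨rfl, h⟩⟩
    · rintro ⟨m, hm, ⟨h, h'⟩ | ⟨h, h'⟩⟩
      · have := hinj h
        omega
      · obtain rfl : n = m := by have := hinj h; omega
        exact h'

/-- The ancillas from index 4 on are GHZ shares, and only the first vertex of a path measures one of
them. -/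
theorem mem_ports_iff_of_four_le (hl : Grid.IsPath l) (h1 : 1 < l.length) (j : Fin 3)
    (q : ZMod 2) {v : Grid N} (hv : v ∈ l) {k : Fin 7} (hk : 4 ≤ k.val) :
    k ∈ (pathSymbol l j q v).ports ↔ v = l[0] ∧ k = (l[0].dir l[1]).ghzPort := by
  have hne : ∀ d : Dir, k ≠ d.port := fun d h => by
    have := d.port_val_lt
    rw [← h] at this
    omega
  have hinj : ∀ {i k : ℕ} {hi : i < l.length} {hk : k < l.length}, l[i] = l[k] → i = k :=
    hl.1.getElem_inj_iff.1
  rcases Grid.exists_index h1 hv with rfl | ⟨n, hn, rfl⟩ | ⟨n, hn, rfl⟩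
  · rw [pathSymbol_zero hl h1]
    simp [VertexSymbol.ports, hne]
  · rw [pathSymbol_mid hl hn]
    have : l[n + 1] ≠ l[0] := fun h => by have := hinj h; omega
    simp [VertexSymbol.ports, hne, this]
  · rw [pathSymbol_last hl hn]
    have : l[n + 1] ≠ l[0] := fun h => by have := hinj h; omega
    simp [VertexSymbol.ports, hne, this]

/-- Each edge sign E n occurs at both ends of its edge and squares to 1; only the factor G of the
hub survives. -/
theorem prod_telescope {A E : ℕ → ℂ} {G : ℂ} (hE : ∀ n, E n * E n = 1) (h0 : A 0 = G * E 0)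
    (m : ℕ) (hA : ∀ n < m, A (n + 1) = E n * E (n + 1)) (hm : A (m + 1) = E m) :
    ∏ n ∈ Finset.range (m + 2), A n = G := by
  have h : ∀ k ≤ m, ∏ n ∈ Finset.range (k + 1), A n = G * E k := by
    intro k
    induction k with
    | zero => intro _; simpa using h0
    | succ k ih =>
      intro hk
      rw [Finset.prod_range_succ, ih (by omega), hA k (by omega)]
      linear_combination G * E (k + 1) * hE k
  rw [Finset.prod_range_succ, h m le_rfl, hm]
  linear_combination G * hE m

theorem prod_map_eq_prod_range {α : Type} (l : List α) (d : α) (F : α → ℂ) :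
    (l.map F).prod = ∏ n ∈ Finset.range l.length, F (l.getD n d) := by
  induction l with
  | nil => simp
  | cons a l ih =>
    rw [List.map_cons, List.prod_cons, List.length_cons, Finset.prod_range_succ', ih, mul_comm]
    simp

/-- The signs of entangled ancillas along a path cancel, except for the share of the GHZ state. -/
theorem prod_signs (hl : Grid.IsPath l) (h1 : 1 < l.length) (j : Fin 3) (q : ZMod 2)
    (t : QWire N 7 → Bool)
    (ht : ∀ d v w, Grid.Next d v w → t (v, Sum.inr d.port) = t (w, Sum.inr d.opp.port)) :
    (l.map fun v => (pathSymbol l j q v).signs q fun k => t (v, k)).prod =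
      bsgn (decide (q = 1) && t (l[0], Sum.inr (l[0].dir l[1]).ghzPort)) := by
  obtain ⟨m, hm⟩ : ∃ m, m + 2 = l.length := ⟨l.length - 2, by omega⟩
  have hD : ∀ n (hn : n < l.length), l.getD n l[0] = l[n] :=
    fun n hn => List.getD_eq_getElem _ _ hn
  -- The sign of the n-th edge, read at its earlier end; `hback` reads it at the later end, where
  -- the Bell pair holds the same bit. The default of `getD` is never used below.
  set E : ℕ → ℂ := fun n => bsgn (decide (q = 1) &&
    t (l.getD n l[0], Sum.inr ((l.getD n l[0]).dir (l.getD (n + 1) l[0])).port)) with hEdef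
  have hback : ∀ n (hn : n + 1 < l.length),
      bsgn (decide (q = 1) && t (l[n + 1], Sum.inr (l[n + 1].dir l[n]).port)) = E n := by
    intro n hn
    rw [hl.dir_opp hn, ← ht _ _ _ (hl.next hn)]
    simp only [hEdef]
    rw [hD n (by omega), hD (n + 1) hn]
  rw [prod_map_eq_prod_range l l[0],
    show Finset.range l.length = Finset.range (m + 2) by rw [hm]]
  refine prod_telescope (E := E) (fun n => bsgn_mul_self _) ?_ m (fun n hn => ?_) ?_
  · simp only [hEdef]
    rw [hD 0 (by omega), hD (0 + 1) (by omega), pathSymbol_zero hl h1, VertexSymbol.signs,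
      VertexSymbol.ports, Finset.prod_pair (Dir.ghzPort_ne_port _ _)]
  · rw [← hback n (by omega)]
    simp only [hEdef]
    rw [hD (n + 1) (by omega), hD (n + 1 + 1) (by omega), pathSymbol_mid hl (by omega),
      VertexSymbol.signs, VertexSymbol.ports,
      Finset.prod_pair fun h => hl.dir_ne (by omega) (Dir.port_injective h)]
  · rw [← hback m (by omega), hD (m + 1) (by omega), pathSymbol_last hl hm, VertexSymbol.signs,
      VertexSymbol.ports, Finset.prod_singleton]

end PathSymbol

/-! ### The outcomes along a path -/

/-- The sign of a parity. -/
def zsgn (a : ZMod 2) : ℂ := if a = 1 then -1 else 1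

theorem zmod_two_cases (a : ZMod 2) : a = 0 ∨ a = 1 := by
  revert a
  decide

@[simp] theorem zsgn_zero : zsgn 0 = 1 := rfl

@[simp] theorem zsgn_one : zsgn 1 = -1 := rfl

theorem zsgn_add (a b : ZMod 2) : zsgn (a + b) = zsgn a * zsgn b := by
  rcases zmod_two_cases a with rfl | rfl <;> rcases zmod_two_cases b with rfl | rfl <;>
    simp [show (1 + 1 : ZMod 2) = 0 from rfl]

theorem zsgn_eq_one_iff (a : ZMod 2) : zsgn a = 1 ↔ a = 0 := by
  rcases zmod_two_cases a with rfl | rfl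
  · simp
  · norm_num

theorem bsgn_eq_zsgn (b : Bool) : bsgn b = zsgn (Planting.bit b) := by
  cases b <;> simp [Planting.bit]

theorem bsgn_and_eq_zsgn (q : ZMod 2) (b : Bool) :
    bsgn (decide (q = 1) && b) = zsgn (q * Planting.bit b) := by
  rcases zmod_two_cases q with rfl | rfl <;> cases b <;> simp [Planting.bit]

/-- A Bell outcome (y₀, y₁) contributes (-1)^(y₁ + q y₀), the commutation sign of X^y₀ Z^y₁ with the
Pauli of the question. As `cor` is additive in the rotation, the product along the path collects the
total rotation; the last vertex adds the answer and the factor I. -/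
theorem prod_outcomes {N : ℕ} {l : List (Grid N)} (hl : Grid.IsPath l) (h1 : 1 < l.length)
    (j : Fin 3) (q : ZMod 2) (z : QWire N 7 → Bool) :
    (l.map fun v => (pathSymbol l j q v).outcome q fun k => z (v, k)).prod =
      zsgn (Planting.answer (fun v k => z (v, Sum.inl k)) l -
        cor (Planting.rotation (fun v k => z (v, Sum.inl k)) l) (pauliLabel q)) *
        (if q = 1 then Complex.I else 1) := by
  obtain ⟨m, hm⟩ : ∃ m, m + 2 = l.length := ⟨l.length - 2, by omega⟩
  have hne : l ≠ [] := by rintro rfl; simp at h1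
  have hlast : l.getLast hne = l[m + 1] := by
    rw [List.getLast_eq_getElem]
    congr 1
    omega
  have hdrop : ∀ v ∈ l.dropLast, (pathSymbol l j q v).outcome q (fun k => z (v, k)) =
      zsgn (Planting.bit (z (v, Sum.inl 1)) + q * Planting.bit (z (v, Sum.inl 0))) := by
    intro v hv
    rw [zsgn_add, ← bsgn_eq_zsgn, ← bsgn_and_eq_zsgn]
    rcases Grid.exists_index h1 (List.mem_of_mem_dropLast hv) with rfl | ⟨n, hn, rfl⟩ |
      ⟨n, hn, rfl⟩
    · rw [pathSymbol_zero hl h1]; rfl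
    · rw [pathSymbol_mid hl hn]; rfl
    · exfalso
      obtain ⟨k, hk, hkv⟩ := List.getElem_of_mem hv
      rw [List.length_dropLast] at hk
      rw [List.getElem_dropLast] at hkv
      have := hl.1.getElem_inj_iff.1 hkv
      omega
  have hans : Planting.answer (fun v k => z (v, Sum.inl k)) l =
      Planting.bit (z (l[m + 1], Sum.inl 0)) := by
    rw [Planting.answer, List.getLast?_eq_some_getLast hne, hlast]
    rfl
  have hrot : ∀ L : List (Grid N),
      (L.map fun v => zsgn (Planting.bit (z (v, Sum.inl 1)) +
        q * Planting.bit (z (v, Sum.inl 0)))).prod =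
      zsgn (cor ((L.map fun v => (Planting.bit (z (v, Sum.inl 0)),
        Planting.bit (z (v, Sum.inl 1)))).sum) (pauliLabel q)) := by
    intro L
    induction L with
    | nil => simp [zsgn, cor]
    | cons v L ih =>
      rw [List.map_cons, List.prod_cons, ih, ← zsgn_add]
      congr 1
      simp only [cor, pauliLabel, List.map_cons, List.sum_cons, Prod.fst_add, Prod.snd_add]
      ring
  have hsplit : (l.map fun v => (pathSymbol l j q v).outcome q fun k => z (v, k)).prod =
      (l.dropLast.map fun v => (pathSymbol l j q v).outcome q fun k => z (v, k)).prod *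
        (pathSymbol l j q l[m + 1]).outcome q fun k => z (l[m + 1], k) := by
    conv_lhs => rw [← List.dropLast_append_getLast hne, List.map_append, List.prod_append,
      List.dropLast_append_getLast hne]
    simp [hlast]
  rw [hsplit, List.map_congr_left hdrop, hrot, pathSymbol_last hl hm, hans, sub_eq_add_neg,
    ZMod.neg_eq_self_mod_two, zsgn_add, ← bsgn_eq_zsgn]
  simp only [VertexSymbol.outcome, Planting.rotation]
  ring

/-! ### The entangling layer -/

instance {N : ℕ} (d : Dir) (v w : Grid N) : Decidable (Grid.Next d v w) := by
  cases d <;> unfold Grid.Next <;> infer_instance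

section EntanglingLayer

variable {N : ℕ}

/-- The edges of the grid in a given direction. -/
abbrev EdgeIndex (N : ℕ) (d : Dir) : Type :=
  {p : Grid N × Grid N // Grid.Next d p.1 p.2}

/-- Three vertically consecutive vertices of the grid. -/
abbrev TripleIndex (N : ℕ) : Type :=
  {p : Fin 3 → Grid N // Grid.Next Dir.up (p 0) (p 1) ∧ Grid.Next Dir.up (p 1) (p 2)}

/-- The two ancillas of an edge. -/
def edgeWires {d : Dir} (p : EdgeIndex N d) : Bool ↪ QWire N 7 :=
  ⟨fun b => if b then (p.1.1, Sum.inr d.port) else (p.1.2, Sum.inr d.opp.port), fun b b' h => by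
    have hne := p.2.ne
    cases b <;> cases b' <;> simp_all⟩

/-- The ancilla with the share of a GHZ state at each vertex of a triple. -/
def ghzIndex : Fin 3 → Fin 7 := ![4, 5, 6]

theorem ghzIndex_injective : Function.Injective ghzIndex := by decide

/-- The three ancillas of a triple. -/
def tripleWires (p : TripleIndex N) : Fin 3 ↪ QWire N 7 :=
  ⟨fun i => (p.1 i, Sum.inr (ghzIndex i)), fun _ _ h =>
    ghzIndex_injective (Sum.inr_injective (Prod.ext_iff.1 h).2)⟩

/-- The entangled states that are prepared: one for each edge and for each triple. -/
abbrev EntangledIndex (N : ℕ) : Type :=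
  (EdgeIndex N Dir.right ⊕ EdgeIndex N Dir.up) ⊕ TripleIndex N

/-- The gate that prepares one entangled state. -/
noncomputable def entangledGate : EntangledIndex N → QGate (QWire N 7)
  | Sum.inl (Sum.inl p) => QGate.ofEmbedding (edgeWires p) (ghzPrep true) (ghzPrep_isUnitary _)
  | Sum.inl (Sum.inr p) => QGate.ofEmbedding (edgeWires p) (ghzPrep true) (ghzPrep_isUnitary _)
  | Sum.inr p => QGate.ofEmbedding (tripleWires p) (ghzPrep 0) (ghzPrep_isUnitary _)

theorem preparesGHZ_entangledGate (i : EntangledIndex N) : (entangledGate i).PreparesGHZ := by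
  rcases i with (p | p) | p <;> exact QGate.preparesGHZ_ofEmbedding _ _

theorem mem_map_edgeWires {d : Dir} (p : EdgeIndex N d) (w : QWire N 7) :
    w ∈ Finset.univ.map (edgeWires p) ↔
      w = (p.1.1, Sum.inr d.port) ∨ w = (p.1.2, Sum.inr d.opp.port) := by
  simp only [Finset.mem_map, Finset.mem_univ, true_and, Bool.exists_bool,
    eq_comm (b := w)]
  exact or_comm

theorem mem_map_tripleWires (p : TripleIndex N) (w : QWire N 7) :
    w ∈ Finset.univ.map (tripleWires p) ↔ ∃ i, w = (p.1 i, Sum.inr (ghzIndex i)) := by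
  simp only [Finset.mem_map, Finset.mem_univ, true_and, eq_comm (b := w)]
  exact Iff.rfl

theorem edgeIndex_unique {d : Dir} {p p' : EdgeIndex N d} {w : QWire N 7}
    (h : w ∈ Finset.univ.map (edgeWires p)) (h' : w ∈ Finset.univ.map (edgeWires p')) :
    p = p' := by
  obtain ⟨⟨v, u⟩, hp⟩ := p
  obtain ⟨⟨v', u'⟩, hp'⟩ := p'
  have hport : d.port ≠ d.opp.port := by cases d <;> decide
  rw [mem_map_edgeWires] at h h'
  simp only at hp hp' h h'
  rcases h with rfl | rfl <;> rcases h' with h' | h' <;>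
    obtain ⟨h1, h2⟩ := Prod.ext_iff.1 h' <;> simp only [Sum.inr.injEq] at h1 h2
  · subst h1
    obtain rfl := hp.unique hp'
    rfl
  · exact absurd h2 hport
  · exact absurd h2.symm hport
  · subst h1
    obtain rfl := hp.symm.unique hp'.symm
    rfl

theorem triple_eq {p p' : Fin 3 → Grid N}
    (hp : Grid.Next Dir.up (p 0) (p 1) ∧ Grid.Next Dir.up (p 1) (p 2))
    (hp' : Grid.Next Dir.up (p' 0) (p' 1) ∧ Grid.Next Dir.up (p' 1) (p' 2)) {i : Fin 3}
    (h : p i = p' i) : p = p' := by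
  have h1 : p 1 = p' 1 := by
    fin_cases i
    · exact hp.1.unique (by rw [show p 0 = p' 0 from h]; exact hp'.1)
    · exact h
    · exact hp.2.symm.unique (by rw [show p 2 = p' 2 from h]; exact hp'.2.symm)
  have h0 : p 0 = p' 0 := hp.1.symm.unique (by rw [h1]; exact hp'.1.symm)
  have h2 : p 2 = p' 2 := hp.2.unique (by rw [h1]; exact hp'.2)
  funext k
  fin_cases k <;> assumption

/-- The ancilla determines the type of the state and the role of the vertex in it, and then the
vertex determines the edge or triple. A vertex can play all three roles in different triples, hence
the three separate GHZ ancillas. -/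
theorem entangledIndex_unique {i i' : EntangledIndex N} {w : QWire N 7}
    (h : w ∈ (entangledGate i).support) (h' : w ∈ (entangledGate i').support) : i = i' := by
  have hE : ∀ {d : Dir} {p : EdgeIndex N d}, w ∈ Finset.univ.map (edgeWires p) →
      w.2 = Sum.inr d.port ∨ w.2 = Sum.inr d.opp.port := fun {d p} hw => by
    rcases (mem_map_edgeWires p w).1 hw with rfl | rfl
    · exact Or.inl rfl
    · exact Or.inr rfl
  have hT : ∀ {p : TripleIndex N}, w ∈ Finset.univ.map (tripleWires p) →
      ∃ k, w.2 = Sum.inr (ghzIndex k) := fun {p} hw => by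
    obtain ⟨k, rfl⟩ := (mem_map_tripleWires p w).1 hw
    exact ⟨k, rfl⟩
  have hET : ∀ (d : Dir) (k : Fin 3), d.port ≠ ghzIndex k := by
    intro d k; cases d <;> revert k <;> decide
  have hEE : ∀ {p : EdgeIndex N Dir.right} {p' : EdgeIndex N Dir.up},
      w ∈ Finset.univ.map (edgeWires p) → w ∈ Finset.univ.map (edgeWires p') → False := by
    intro p p' h h'
    rcases hE h with h | h <;> rcases hE h' with h' | h' <;> rw [h] at h' <;>
      exact absurd (Sum.inr_injective h') (by decide)
  have hET' : ∀ {d : Dir} {p : EdgeIndex N d} {p' : TripleIndex N},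
      w ∈ Finset.univ.map (edgeWires p) → w ∈ Finset.univ.map (tripleWires p') → False := by
    intro d p p' h h'
    obtain ⟨k, hk⟩ := hT h'
    rcases hE h with h | h <;> rw [h] at hk <;> exact hET _ _ (Sum.inr_injective hk)
  rcases i with (p | p) | p <;> rcases i' with (p' | p') | p'
  · rw [edgeIndex_unique h h']
  · exact (hEE h h').elim
  · exact (hET' h h').elim
  · exact (hEE h' h).elim
  · rw [edgeIndex_unique h h']
  · exact (hET' h h').elim
  · exact (hET' h' h).elim
  · exact (hET' h' h).elim
  · obtain ⟨k, hk⟩ := (mem_map_tripleWires p w).1 h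
    obtain ⟨k', hk'⟩ := (mem_map_tripleWires p' w).1 h'
    rw [hk] at hk'
    obtain ⟨h1, h2⟩ := Prod.ext_iff.1 hk'
    obtain rfl := ghzIndex_injective (Sum.inr_injective h2)
    rw [Subtype.ext (triple_eq p.2 p'.2 h1)]

/-- The layer that prepares all entangled states. -/
noncomputable def entanglingLayer (N : ℕ) : QLayer (QWire N 7) where
  gates := (Finset.univ : Finset (EntangledIndex N)).toList.map entangledGate
  disjoint := by
    rw [List.pairwise_map]
    refine (Finset.nodup_toList _).imp fun {i i'} hi => ?_
    exact Finset.disjoint_left.2 fun w hw hw' => hi (entangledIndex_unique hw hw')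

theorem constantOn_entanglingLayer_iff (z₀ t : QWire N 7 → Bool) :
    ConstantOn (entanglingLayer N).gates z₀ t ↔
      ((∀ d v w, Grid.Next d v w → t (v, Sum.inr d.port) = t (w, Sum.inr d.opp.port)) ∧
        ∀ p : TripleIndex N, ∀ i i', t (p.1 i, Sum.inr (ghzIndex i)) =
          t (p.1 i', Sum.inr (ghzIndex i'))) ∧
      ∀ w, (∀ i, w ∉ (entangledGate i).support) → t w = z₀ w := by
  unfold ConstantOn entanglingLayer
  simp only [List.mem_map, Finset.mem_toList, Finset.mem_univ, true_and, forall_exists_index,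
    forall_apply_eq_imp_iff]
  refine and_congr ⟨fun h => ⟨fun d v w hvw => ?_, fun p i i' => ?_⟩, fun h i => ?_⟩ Iff.rfl
  · have hR : ∀ v w, Grid.Next Dir.right v w → t (v, Sum.inr 1) = t (w, Sum.inr 0) :=
      fun v w hvw => h (Sum.inl (Sum.inl ⟨(v, w), hvw⟩)) _
        ((mem_map_edgeWires ⟨(v, w), hvw⟩ _).2 (Or.inl rfl)) _
        ((mem_map_edgeWires ⟨(v, w), hvw⟩ _).2 (Or.inr rfl))
    have hU : ∀ v w, Grid.Next Dir.up v w → t (v, Sum.inr 3) = t (w, Sum.inr 2) :=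
      fun v w hvw => h (Sum.inl (Sum.inr ⟨(v, w), hvw⟩)) _
        ((mem_map_edgeWires ⟨(v, w), hvw⟩ _).2 (Or.inl rfl)) _
        ((mem_map_edgeWires ⟨(v, w), hvw⟩ _).2 (Or.inr rfl))
    cases d
    · exact (hR w v hvw.symm).symm
    · exact hR v w hvw
    · exact (hU w v hvw.symm).symm
    · exact hU v w hvw
  · exact h (Sum.inr p) _ ((mem_map_tripleWires p _).2 ⟨i, rfl⟩) _
      ((mem_map_tripleWires p _).2 ⟨i', rfl⟩)
  · have hedge : ∀ {d : Dir} (p : EdgeIndex N d), ∀ a ∈ Finset.univ.map (edgeWires p),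
        ∀ b ∈ Finset.univ.map (edgeWires p), t a = t b := by
      intro d p a ha b hb
      have := h.1 d _ _ p.2
      rcases (mem_map_edgeWires p a).1 ha with rfl | rfl <;>
        rcases (mem_map_edgeWires p b).1 hb with rfl | rfl
      · rfl
      · exact this
      · exact this.symm
      · rfl
    rcases i with (p | p) | p
    · exact hedge p
    · exact hedge p
    · intro a ha b hb
      obtain ⟨k, rfl⟩ := (mem_map_tripleWires p a).1 ha
      obtain ⟨k', rfl⟩ := (mem_map_tripleWires p b).1 hb
      exact h.2 p k k'

theorem inl_notMem_support (v : Grid N) (k : Fin 8) (i : EntangledIndex N) :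
    ((v, Sum.inl k) : QWire N 7) ∉ (entangledGate i).support := by
  intro h
  rcases i with (p | p) | p
  · rcases (mem_map_edgeWires p _).1 h with h | h <;> simp at h
  · rcases (mem_map_edgeWires p _).1 h with h | h <;> simp at h
  · obtain ⟨k, h⟩ := (mem_map_tripleWires p _).1 h
    simp at h

/-- The entangled state is uniform on the basis states that are constant on the supports, so a flip
pattern that is itself constant there, and zero elsewhere, is a stabilizer of X type. -/
theorem constantOn_xor {W : Type} [DecidableEq W] {gs : List (QGate W)} {z₀ α : W → Bool}
    (hα : ConstantOn gs (fun _ => false) α) (z : W → Bool) :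
    ConstantOn gs z₀ (fun w => xor (z w) (α w)) ↔ ConstantOn gs z₀ z := by
  unfold ConstantOn
  refine and_congr (forall₂_congr fun g hg => forall₂_congr fun a ha => forall₂_congr
    fun b hb => ?_) (forall_congr' fun w => forall_congr' fun hw => ?_)
  · dsimp only
    rw [hα.1 g hg a ha b hb, Bool.xor_left_inj]
  · dsimp only
    rw [hα.2 w hw, Bool.xor_false]

/-- The quantum circuit: entanglement is prepared everywhere, and then every vertex measures its
ancillas as told by its input letter. -/
noncomputable def teleportCircuit (N : ℕ) : QCircuit N 7 :=
  [entanglingLayer N, vertexLayer VertexGate.mat_isUnitary N]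

open scoped Classical in
theorem entanglingLayer_apply_init (x : Grid N → Letter) (t : QWire N 7 → Bool) :
    (entanglingLayer N).apply (QCircuit.init 7 x) t =
      if ConstantOn (entanglingLayer N).gates
        (fun p => Sum.elim (x p.1) (fun _ => false) p.2) t then
        (Real.sqrt 2 : ℂ)⁻¹ ^ (entanglingLayer N).gates.length else 0 := by
  rw [← foldr_preparesGHZ (entanglingLayer N).gates ?_ (entanglingLayer N).disjoint]
  · unfold QLayer.apply QCircuit.init
    congr! 3
  · intro g hg a ha
    obtain ⟨i, -, rfl⟩ := List.mem_map.1 hg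
    obtain ⟨v, k | k⟩ := a
    · exact absurd ha (inl_notMem_support v k i)
    · rfl
  · intro g hg
    obtain ⟨i, -, rfl⟩ := List.mem_map.1 hg
    exact preparesGHZ_entangledGate i

theorem depth_teleportCircuit : (teleportCircuit N).depth ≤ 3 := by
  simp [teleportCircuit, QCircuit.depth]

/-- The gate at a vertex uses all 8 + 7 = 15 qubits there; the preparing gates use two or three. -/
theorem fanIn_teleportCircuit : (teleportCircuit N).FanIn 15 := by
  intro l hl g hg
  simp only [teleportCircuit, List.mem_cons, List.not_mem_nil, or_false] at hl
  rcases hl with rfl | rfl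
  · obtain ⟨i, -, rfl⟩ := List.mem_map.1 hg
    rcases i with (p | p) | p <;>
      exact (Finset.card_map _).trans_le (by decide)
  · obtain ⟨v, -, rfl⟩ := List.mem_map.1 hg
    exact (Finset.card_map _).trans_le (by decide)

/-- The widest gates are those on the triples, whose ends are two steps apart. -/
theorem geometricallyLocal_teleportCircuit : (teleportCircuit N).GeometricallyLocal 2 := by
  intro l hl g hg
  simp only [teleportCircuit, List.mem_cons, List.not_mem_nil, or_false] at hl
  rcases hl with rfl | rfl
  · obtain ⟨i, -, rfl⟩ := List.mem_map.1 hg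
    have hedge : ∀ {d : Dir} (p : EdgeIndex N d), ∀ a ∈ Finset.univ.map (edgeWires p),
        ∀ b ∈ Finset.univ.map (edgeWires p), Grid.Within 2 a.1 b.1 := by
      intro d p a ha b hb
      have hp := p.2
      rcases (mem_map_edgeWires p a).1 ha with rfl | rfl <;>
        rcases (mem_map_edgeWires p b).1 hb with rfl | rfl <;>
        cases d <;> obtain ⟨h1, h2⟩ := hp <;> rw [Fin.ext_iff] at h1 <;>
        refine ⟨?_, ?_, ?_, ?_⟩ <;> dsimp only <;> omega
    rcases i with (p | p) | p
    · exact hedge p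
    · exact hedge p
    · intro a ha b hb
      obtain ⟨⟨h1, h2⟩, h3, h4⟩ := p.2
      rw [Fin.ext_iff] at h1 h3
      have key : ∀ k, (p.1 k).1.val = (p.1 0).1.val ∧ (p.1 0).2.val ≤ (p.1 k).2.val ∧
          (p.1 k).2.val ≤ (p.1 0).2.val + 2 := by
        intro k
        fin_cases k
        · exact ⟨rfl, le_rfl, Nat.le_add_right _ _⟩
        · refine ⟨h1.symm, ?_, ?_⟩ <;> simp only [Fin.mk_one] <;> omega
        · refine ⟨h3.symm.trans h1.symm, ?_, ?_⟩ <;> simp only [Fin.reduceFinMk] <;> omega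
      obtain ⟨k, rfl⟩ := (mem_map_tripleWires p a).1 ha
      obtain ⟨k', rfl⟩ := (mem_map_tripleWires p b).1 hb
      have hk := key k
      have hk' := key k'
      refine ⟨?_, ?_, ?_, ?_⟩ <;> dsimp only <;> omega
  · obtain ⟨v, -, rfl⟩ := List.mem_map.1 hg
    intro a ha b hb
    obtain ⟨k, -, rfl⟩ := Finset.mem_map.1 ha
    obtain ⟨k', -, rfl⟩ := Finset.mem_map.1 hb
    exact ⟨Nat.le_add_right _ _, Nat.le_add_right _ _, Nat.le_add_right _ _,
      Nat.le_add_right _ _⟩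

end EntanglingLayer

/-! ### The quantum circuit wins along every star -/

section Star

variable {N : ℕ}

/-- Three disjoint paths that start at vertically consecutive vertices, so that every one of them
can recognize its share of the GHZ state from its first direction. -/
structure Grid.IsStar (l : Fin 3 → List (Grid N)) : Prop where
  isPath : ∀ j, Grid.IsPath (l j)
  one_lt : ∀ j, 1 < (l j).length
  disjoint : ∀ j j', j ≠ j' → (l j).Disjoint (l j')
  hubs : ∃ (u : TripleIndex N) (σ : Equiv.Perm (Fin 3)), ∀ j,
    (l j)[0]'(zero_lt_one.trans (one_lt j)) = u.1 (σ j) ∧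
      (((l j)[0]'(zero_lt_one.trans (one_lt j))).dir ((l j)[1]'(one_lt j))).ghzPort =
        ghzIndex (σ j)

open scoped Classical in
/-- The symbol at a vertex, with respect to one star. -/
noncomputable def starSymbol (l : Fin 3 → List (Grid N)) (q : Fin 3 → ZMod 2) (v : Grid N) :
    VertexSymbol :=
  if h : ∃ j, v ∈ l j then pathSymbol (l h.choose) h.choose (q h.choose) v
  else VertexSymbol.blank

open scoped Classical in
/-- The question belonging to a vertex, with respect to one star. -/
noncomputable def starQuery (l : Fin 3 → List (Grid N)) (q : Fin 3 → ZMod 2) (v : Grid N) :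
    ZMod 2 :=
  if h : ∃ j, v ∈ l j then q h.choose else 0

variable {l : Fin 3 → List (Grid N)}

theorem Grid.IsStar.index_unique (hl : Grid.IsStar l) {j j' : Fin 3} {v : Grid N}
    (h : v ∈ l j) (h' : v ∈ l j') : j = j' := by
  by_contra hne
  exact hl.disjoint j j' hne h h'

theorem Grid.IsStar.symbol_eq (hl : Grid.IsStar l) (q : Fin 3 → ZMod 2) {j : Fin 3}
    {v : Grid N} (hv : v ∈ l j) :
    starSymbol l q v = pathSymbol (l j) j (q j) v ∧ starQuery l q v = q j := by
  have h : ∃ j, v ∈ l j := ⟨j, hv⟩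
  have hj : h.choose = j := hl.index_unique h.choose_spec hv
  unfold starSymbol starQuery
  rw [dif_pos h, dif_pos h, hj]
  exact ⟨rfl, rfl⟩

theorem starSymbol_eq_blank (q : Fin 3 → ZMod 2) {v : Grid N} (hv : ¬ ∃ j, v ∈ l j) :
    starSymbol l q v = VertexSymbol.blank := by
  unfold starSymbol
  rw [dif_neg hv]

/-- Vertices off the star contribute 1, and the three paths are simple and disjoint. -/
theorem Grid.IsStar.prod_eq (hl : Grid.IsStar l) (q : Fin 3 → ZMod 2)
    (Φ : VertexSymbol → ZMod 2 → Grid N → ℂ) (hΦ : ∀ q v, Φ VertexSymbol.blank q v = 1) :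
    ∏ v, Φ (starSymbol l q v) (starQuery l q v) v =
      ∏ j, ((l j).map fun v => Φ (pathSymbol (l j) j (q j) v) (q j) v).prod := by
  have h1 : ∏ v, Φ (starSymbol l q v) (starQuery l q v) v =
      ∏ v ∈ Finset.univ.biUnion fun j => (l j).toFinset,
        Φ (starSymbol l q v) (starQuery l q v) v := by
    refine (Finset.prod_subset (Finset.subset_univ _) fun v _ hv => ?_).symm
    rw [starSymbol_eq_blank q fun ⟨j, hj⟩ => hv
      (Finset.mem_biUnion.2 ⟨j, Finset.mem_univ j, List.mem_toFinset.2 hj⟩), hΦ]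
  rw [h1, Finset.prod_biUnion]
  · refine Finset.prod_congr rfl fun j _ => ?_
    rw [List.prod_toFinset _ (hl.isPath j).1]
    congr 1
    refine List.map_congr_left fun v hv => ?_
    rw [(hl.symbol_eq q hv).1, (hl.symbol_eq q hv).2]
  · intro j _ j' _ hne
    exact Finset.disjoint_left.2 fun v hv hv' =>
      hl.disjoint j j' hne (List.mem_toFinset.1 hv) (List.mem_toFinset.1 hv')

theorem Grid.IsStar.mem_ports_iff (hl : Grid.IsStar l) (q : Fin 3 → ZMod 2) (v : Grid N)
    (k : Fin 7) : k ∈ (starSymbol l q v).ports ↔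
      ∃ j, v ∈ l j ∧ k ∈ (pathSymbol (l j) j (q j) v).ports := by
  constructor
  · intro h
    by_cases hv : ∃ j, v ∈ l j
    · obtain ⟨j, hj⟩ := hv
      exact ⟨j, hj, (hl.symbol_eq q hj).1 ▸ h⟩
    · rw [starSymbol_eq_blank q hv] at h
      exact absurd h (Finset.notMem_empty k)
  · rintro ⟨j, hj, h⟩
    rwa [(hl.symbol_eq q hj).1]

/-- A measured port points along an edge of a path, and the other end of that edge measures the
opposite port. -/
theorem Grid.IsStar.exists_next_of_mem_ports (hl : Grid.IsStar l) {q : Fin 3 → ZMod 2}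
    {v : Grid N} {d : Dir} (h : d.port ∈ (starSymbol l q v).ports) :
    ∃ w, Grid.Next d v w ∧ d.opp.port ∈ (starSymbol l q w).ports := by
  obtain ⟨j, hv, hk⟩ := (hl.mem_ports_iff q v _).1 h
  obtain ⟨n, hn, ⟨rfl, rfl⟩ | ⟨rfl, rfl⟩⟩ :=
    (port_mem_ports_iff (hl.isPath j) (hl.one_lt j) j (q j) hv d).1 hk
  · refine ⟨(l j)[n + 1], (hl.isPath j).next hn, (hl.mem_ports_iff q _ _).2
      ⟨j, List.getElem_mem _, ?_⟩⟩
    rw [port_mem_ports_iff (hl.isPath j) (hl.one_lt j) j (q j) (List.getElem_mem _)]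
    exact ⟨n, hn, Or.inr ⟨rfl, ((hl.isPath j).dir_opp hn).symm⟩⟩
  · refine ⟨(l j)[n], ?_, (hl.mem_ports_iff q _ _).2 ⟨j, List.getElem_mem _, ?_⟩⟩
    · rw [(hl.isPath j).dir_opp hn]
      exact ((hl.isPath j).next hn).symm
    · rw [port_mem_ports_iff (hl.isPath j) (hl.one_lt j) j (q j) (List.getElem_mem _)]
      exact ⟨n, hn, Or.inl ⟨rfl, by rw [(hl.isPath j).dir_opp hn, Dir.opp_opp]⟩⟩

theorem Grid.IsStar.port_mem_ports_iff_opp (hl : Grid.IsStar l) (q : Fin 3 → ZMod 2)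
    {d : Dir} {v w : Grid N} (hvw : Grid.Next d v w) :
    d.port ∈ (starSymbol l q v).ports ↔ d.opp.port ∈ (starSymbol l q w).ports := by
  constructor
  · intro h
    obtain ⟨w', hw', h'⟩ := hl.exists_next_of_mem_ports h
    rwa [hvw.unique hw']
  · intro h
    obtain ⟨v', hv', h'⟩ := hl.exists_next_of_mem_ports h
    rwa [Dir.opp_opp, ← hvw.symm.unique hv'] at h'

theorem four_le_ghzIndex (i : Fin 3) : 4 ≤ (ghzIndex i).val := by
  revert i
  decide

theorem port_or_ghzIndex (k : Fin 7) :
    (∃ d : Dir, k = d.port) ∨ ∃ i, k = ghzIndex i := by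
  fin_cases k
  · exact Or.inl ⟨Dir.left, rfl⟩
  · exact Or.inl ⟨Dir.right, rfl⟩
  · exact Or.inl ⟨Dir.down, rfl⟩
  · exact Or.inl ⟨Dir.up, rfl⟩
  · exact Or.inr ⟨0, rfl⟩
  · exact Or.inr ⟨1, rfl⟩
  · exact Or.inr ⟨2, rfl⟩

/-- Of each Bell pair both halves are measured or none. A triple has all its shares measured if it
is the hub triple `u` and none otherwise, because one vertex together with its role determines the
triple. No ancilla outside the prepared states is measured. -/
theorem Grid.IsStar.constantOn_flips (hl : Grid.IsStar l) (q : Fin 3 → ZMod 2) :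
    ConstantOn (entanglingLayer N).gates (fun _ => false)
      fun w => (starSymbol l q w.1).flips w.2 := by
  obtain ⟨u, σ, hu⟩ := hl.hubs
  have hghz : ∀ v i, ghzIndex i ∈ (starSymbol l q v).ports ↔ v = u.1 i := by
    intro v i
    rw [hl.mem_ports_iff]
    constructor
    · rintro ⟨j, hv, hk⟩
      rw [mem_ports_iff_of_four_le (hl.isPath j) (hl.one_lt j) j (q j) hv
        (four_le_ghzIndex i)] at hk
      rw [hk.1, (hu j).1, ghzIndex_injective (hk.2.trans (hu j).2)]
    · rintro rfl
      obtain ⟨j, rfl⟩ := σ.surjective i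
      have hj : u.1 (σ j) ∈ l j := by
        rw [← (hu j).1]
        exact List.getElem_mem _
      exact ⟨j, hj, (mem_ports_iff_of_four_le (hl.isPath j) (hl.one_lt j) j (q j) hj
        (four_le_ghzIndex _)).2 ⟨(hu j).1.symm, (hu j).2.symm⟩⟩
  rw [constantOn_entanglingLayer_iff]
  refine ⟨⟨fun d v w hvw => ?_, fun p i i' => ?_⟩, fun w hw => ?_⟩
  · simp only [VertexSymbol.flips, Sum.elim_inr, decide_eq_decide]
    exact hl.port_mem_ports_iff_opp q hvw
  · simp only [VertexSymbol.flips, Sum.elim_inr, decide_eq_decide, hghz]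
    have : ∀ i, p.1 i = u.1 i ↔ p.1 = u.1 := fun i =>
      ⟨fun h => triple_eq p.2 u.2 h, fun h => by rw [h]⟩
    rw [this, this]
  · obtain ⟨v, k | k⟩ := w
    · rfl
    · simp only [VertexSymbol.flips, Sum.elim_inr, decide_eq_false_iff_not]
      intro hk
      rcases port_or_ghzIndex k with ⟨d, rfl⟩ | ⟨i, rfl⟩
      · obtain ⟨w, hvw, -⟩ := hl.exists_next_of_mem_ports hk
        cases d
        · exact hw (Sum.inl (Sum.inl ⟨(w, v), hvw.symm⟩))
            ((mem_map_edgeWires ⟨(w, v), hvw.symm⟩ _).2 (Or.inr rfl))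
        · exact hw (Sum.inl (Sum.inl ⟨(v, w), hvw⟩))
            ((mem_map_edgeWires ⟨(v, w), hvw⟩ _).2 (Or.inl rfl))
        · exact hw (Sum.inl (Sum.inr ⟨(w, v), hvw.symm⟩))
            ((mem_map_edgeWires ⟨(w, v), hvw.symm⟩ _).2 (Or.inr rfl))
        · exact hw (Sum.inl (Sum.inr ⟨(v, w), hvw⟩))
            ((mem_map_edgeWires ⟨(v, w), hvw⟩ _).2 (Or.inl rfl))
      · rw [hghz] at hk
        exact hw (Sum.inr u) ((mem_map_tripleWires u _).2 ⟨i, by rw [hk]⟩)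

/-- Every query has an even number of ones. -/
theorem prod_ghz_signs {q : Fin 3 → ZMod 2} (hq : q ∈ ghzQueries) (b : Bool) :
    ∏ j, bsgn (decide (q j = 1) && b) = 1 := by
  simp only [ghzQueries, Finset.mem_insert, Finset.mem_singleton] at hq
  rcases hq with rfl | rfl | rfl | rfl <;> cases b <;> simp [Fin.prod_univ_three]

/-- The queries other than 000 have exactly two ones, and I · I = -1. -/
theorem prod_ghz_phases {q : Fin 3 → ZMod 2} (hq : q ∈ ghzQueries) :
    ∏ j, (if q j = 1 then Complex.I else 1) = zsgn (ghzTarget q) := by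
  simp only [ghzQueries, Finset.mem_insert, Finset.mem_singleton] at hq
  rcases hq with rfl | rfl | rfl | rfl
  · rw [show ghzTarget ![0, 0, 0] = 0 by decide]; simp [Fin.prod_univ_three]
  · rw [show ghzTarget ![0, 1, 1] = 1 by decide]; simp [Fin.prod_univ_three]
  · rw [show ghzTarget ![1, 0, 1] = 1 by decide]; simp [Fin.prod_univ_three]
  · rw [show ghzTarget ![1, 1, 0] = 1 by decide]; simp [Fin.prod_univ_three]

/-- On an input that describes a star, every output of nonzero amplitude satisfies the win
condition of the rotated GHZ game. -/
theorem Grid.IsStar.ghzRotatedWin (hl : Grid.IsStar l) {q : Fin 3 → ZMod 2}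
    (hq : q ∈ ghzQueries) {x : Grid N → Letter}
    (hx : ∀ j, ∀ v ∈ l j, x v = (pathSymbol (l j) j (q j) v).code) {z : QWire N 7 → Bool}
    (hz : (teleportCircuit N).finalState x z ≠ 0) :
    ghzRotatedWin q (fun j => Planting.answer (fun v k => z (v, Sum.inl k)) (l j))
      (fun j => Planting.rotation (fun v k => z (v, Sum.inl k)) (l j)) := by
  classical
  set z₀ : QWire N 7 → Bool := fun p => Sum.elim (x p.1) (fun _ => false) p.2 with hz₀
  have hα := hl.constantOn_flips q
  -- The symmetry applies X or XZ to every measured ancilla of this star, by the question of its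
  -- path; all other stars are treated like blank vertices.
  have hprod := prod_eq_one_of_vertexLayer_apply_ne_zero VertexGate.mat_isUnitary x
    (fun v => (starSymbol l q v).flips)
    (fun v => (starSymbol l q v).signs (starQuery l q v))
    (fun v => (starSymbol l q v).outcome (starQuery l q v))
    (fun v z t ht => by
      by_cases hv : ∃ j, v ∈ l j
      · obtain ⟨j, hj⟩ := hv
        rw [(hl.symbol_eq q hj).1, (hl.symbol_eq q hj).2]
        refine VertexSymbol.mat_flips
          (pathSymbol_admissible (hl.isPath j) (hl.one_lt j) j (q j) hj)
          (pathSymbol_ne_blank hj) z t ?_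
        rw [← hx j v hj]
        exact funext ht
      · rw [starSymbol_eq_blank q hv]
        have : (fun k => xor (t k) (VertexSymbol.blank.flips k)) = t := by
          funext k
          rcases k with k | k <;> simp [VertexSymbol.flips, VertexSymbol.ports]
        rw [this]
        simp [VertexSymbol.signs, VertexSymbol.outcome, VertexSymbol.ports])
    ((entanglingLayer N).apply (QCircuit.init 7 x))
    (fun t ht v k => by
      rw [entanglingLayer_apply_init] at ht
      have hc : ConstantOn (entanglingLayer N).gates z₀ t := by
        by_contra h
        exact ht (if_neg h)
      exact ((constantOn_entanglingLayer_iff _ _).1 hc).2 (v, Sum.inl k)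
        (inl_notMem_support v k))
    (fun t => by
      rw [entanglingLayer_apply_init, entanglingLayer_apply_init]
      have hiff := constantOn_xor (z₀ := z₀) hα t
      by_cases hc : ConstantOn (entanglingLayer N).gates z₀ t
      · rw [if_pos (hiff.2 hc), if_pos hc]
        obtain ⟨⟨hE, hG⟩, -⟩ := (constantOn_entanglingLayer_iff _ _).1 hc
        obtain ⟨u, σ, hu⟩ := hl.hubs
        rw [hl.prod_eq q (fun s q v => s.signs q fun k => t (v, k))
          (fun q v => by simp [VertexSymbol.signs, VertexSymbol.ports])]
        -- What is left of each path is the sign of its GHZ share, and all three shares hold the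
        -- same bit.
        have : ∀ j, ((l j).map fun v => (pathSymbol (l j) j (q j) v).signs (q j)
            fun k => t (v, k)).prod =
            bsgn (decide (q j = 1) && t (u.1 0, Sum.inr (ghzIndex 0))) := by
          intro j
          rw [prod_signs (hl.isPath j) (hl.one_lt j) j (q j) t hE, (hu j).2, (hu j).1,
            hG u (σ j) 0]
        simp only [this, prod_ghz_signs hq, one_mul]
      · rw [if_neg (fun h => hc (hiff.1 h)), if_neg hc, mul_zero])
    z hz
  rw [hl.prod_eq q (fun s q v => s.outcome q fun k => z (v, k)) (fun _ _ => rfl)] at hprod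
  simp only [prod_outcomes (hl.isPath _) (hl.one_lt _), Finset.prod_mul_distrib,
    prod_ghz_phases hq] at hprod
  have hsum : ∀ f : Fin 3 → ZMod 2, ∏ j, zsgn (f j) = zsgn (∑ j, f j) := by
    intro f
    rw [Fin.prod_univ_three, Fin.sum_univ_three, zsgn_add, zsgn_add]
  rw [hsum, ← zsgn_add, zsgn_eq_one_iff, ← ZMod.neg_eq_self_mod_two (ghzTarget q),
    ← sub_eq_add_neg, sub_eq_zero] at hprod
  exact hprod

end Star

/-! ### From stars to planted instances -/

namespace Planting

variable {κ N r L : ℕ}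

theorem block_subset_square (P : Planting κ N r L) (i : Fin r) (t : Fin P.T) :
    Grid.block N (P.anchor i t) (2 * L + 1) ⊆ Grid.block N (P.corner i) (squareSide N r) := by
  intro v hv
  obtain ⟨⟨h1, h2⟩, h3, h4⟩ := P.box_in_square i t
  obtain ⟨⟨h5, h6⟩, h7, h8⟩ := hv
  refine ⟨⟨?_, ?_⟩, ?_, ?_⟩ <;> omega

theorem path_subset_square (P : Planting κ N r L) (c : P.Instance) (i : Fin r) (j : Fin 3)
    {v : Grid N} (hv : v ∈ P.path c i j) :
    v ∈ Grid.block N (P.corner i) (squareSide N r) := by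
  unfold path at hv
  rw [List.mem_append, List.mem_append] at hv
  rcases hv with (hv | hv) | hv
  · exact P.block_subset_square i _ (P.hub_in_box _ _ _ _ v hv)
  · obtain ⟨a, mid, w, h, ha, hw, hmid⟩ := P.arm_spec i (c i).1 (c i).2.2.1 j
    rw [h, List.mem_cons, List.mem_append, List.mem_singleton] at hv
    rcases hv with rfl | hv | rfl
    · exact P.block_subset_square i _ ha
    · exact (hmid v hv).1
    · exact P.block_subset_square i _ hw
  · exact P.block_subset_square i _ (P.tail_in_box _ _ _ _ _ v hv)

/-- The symbol of an instance at a vertex of one of its paths. -/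
theorem encode_eq (P : Planting κ N r L) (c : P.Instance) {i : Fin r} {j : Fin 3} {v : Grid N}
    (hv : v ∈ P.path c i j) :
    P.encode c v = (pathSymbol (P.path c i j) j (P.query c i j) v).code := by
  have h : ∃ p : Fin r × Fin 3, v ∈ P.path c p.1 p.2 := ⟨(i, j), hv⟩
  have hp : h.choose = (i, j) := by
    have hspec := h.choose_spec
    have hi : h.choose.1 = i := by
      by_contra hne
      exact Set.disjoint_left.1 (P.squares_disjoint hne) (P.path_subset_square c _ _ hspec)
        (P.path_subset_square c _ _ hv)
    rw [hi] at hspec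
    refine Prod.ext hi ?_
    by_contra hne
    exact P.paths_disjoint i _ _ _ _ _ _ hne hspec hv
  unfold encode
  rw [dif_pos h, hp]

/-- If the paths of all stars start at three consecutive vertices, then the quantum circuit wins
with certainty. -/
theorem winProb_teleportCircuit (P : Planting κ N r L)
    (h : ∀ c i, Grid.IsStar fun j => P.path c i j) :
    P.game.winProb (teleportCircuit N).behavior = 1 :=
  P.winProb_eq_one _ fun c _ hz i => (h c i).ghzRotatedWin (c i).2.2.2.2
    (fun _ _ hv => P.encode_eq c hv) hz

end Planting

/-! ### Rectilinear routes in the plane -/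

/-- The numbers from `a` (exclusive) to `b` (inclusive), in the order of a walk. -/
def steps (a b : ℕ) : List ℕ :=
  if a ≤ b then List.range' (a + 1) (b - a) else (List.range' b (a - b)).reverse

theorem mem_steps {a b k : ℕ} : k ∈ steps a b ↔ a < k ∧ k ≤ b ∨ b ≤ k ∧ k < a := by
  unfold steps
  split_ifs with h
  · rw [List.mem_range'_1]; omega
  · rw [List.mem_reverse, List.mem_range'_1]; omega

theorem nodup_steps (a b : ℕ) : (steps a b).Nodup := by
  unfold steps
  split_ifs
  · exact List.nodup_range'
  · exact List.nodup_reverse.2 List.nodup_range'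

theorem length_steps (a b : ℕ) : (steps a b).length = (b - a) + (a - b) := by
  unfold steps
  split_ifs with h
  · rw [List.length_range']; omega
  · rw [List.length_reverse, List.length_range']; omega

theorem steps_self (a : ℕ) : steps a a = [] := by simp [steps]

theorem steps_of_lt {a b : ℕ} (h : a < b) : steps a b = (a + 1) :: steps (a + 1) b := by
  obtain ⟨m, rfl⟩ : ∃ m, b = a + 1 + m := ⟨b - (a + 1), by omega⟩
  unfold steps
  rw [if_pos (by omega), if_pos (by omega), show a + 1 + m - a = m + 1 by omega,
    show a + 1 + m - (a + 1) = m by omega, List.range'_succ]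

theorem steps_of_gt {a b : ℕ} (h : b < a) : steps a b = (a - 1) :: steps (a - 1) b := by
  obtain ⟨m, rfl⟩ : ∃ m, a = b + m + 1 := ⟨a - (b + 1), by omega⟩
  have h1 : steps (b + m + 1) b = (b + m) :: (List.range' b m).reverse := by
    unfold steps
    rw [if_neg (by omega), show b + m + 1 - b = m + 1 by omega, List.range'_1_concat,
      List.reverse_append]
    rfl
  rw [h1, Nat.add_sub_cancel]
  congr 1
  rcases Nat.eq_zero_or_pos m with rfl | hm
  · simp [steps_self]
  · unfold steps
    rw [if_neg (by omega), show b + m - b = m by omega]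

/-- Neighbors in the plane. -/
def PlaneAdj (v w : ℕ × ℕ) : Prop :=
  (v.2 = w.2 ∧ (v.1 + 1 = w.1 ∨ w.1 + 1 = v.1)) ∨ (v.1 = w.1 ∧ (v.2 + 1 = w.2 ∨ w.2 + 1 = v.2))

/-- The list `l` describes a walk from `p` to `p'`, not counting `p`. -/
inductive Walks : ℕ × ℕ → List (ℕ × ℕ) → ℕ × ℕ → Prop
  | nil (p : ℕ × ℕ) : Walks p [] p
  | cons {p p₁ p' : ℕ × ℕ} {l : List (ℕ × ℕ)} :
      PlaneAdj p p₁ → Walks p₁ l p' → Walks p (p₁ :: l) p'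

theorem Walks.append {p p' p'' : ℕ × ℕ} {l l' : List (ℕ × ℕ)} (h : Walks p l p')
    (h' : Walks p' l' p'') : Walks p (l ++ l') p'' := by
  induction h with
  | nil => exact h'
  | cons ha _ ih => exact Walks.cons ha (ih h')

theorem Walks.isChain {p p' : ℕ × ℕ} {l : List (ℕ × ℕ)} (h : Walks p l p') :
    (p :: l).IsChain PlaneAdj := by
  induction h with
  | nil => exact List.isChain_singleton _
  | cons ha _ ih => exact List.isChain_cons_cons.2 ⟨ha, ih⟩

theorem Walks.getLast? {p p' : ℕ × ℕ} {l : List (ℕ × ℕ)} (h : Walks p l p') :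
    (p :: l).getLast? = some p' := by
  induction h with
  | nil => rfl
  | cons _ _ ih => rwa [List.getLast?_cons_cons]

/-- A horizontal walk. -/
def hwalk (y a b : ℕ) : List (ℕ × ℕ) := (steps a b).map fun x => (x, y)

/-- A vertical walk. -/
def vwalk (x a b : ℕ) : List (ℕ × ℕ) := (steps a b).map fun y => (x, y)

theorem walks_hwalk (y a b : ℕ) : Walks (a, y) (hwalk y a b) (b, y) := by
  unfold hwalk
  induction hd : (b - a) + (a - b) generalizing a with
  | zero =>
    obtain rfl : a = b := by omega
    rw [steps_self]
    exact Walks.nil _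
  | succ d ih =>
    rcases Nat.lt_or_ge a b with h | h
    · rw [steps_of_lt h]
      exact Walks.cons (Or.inl ⟨rfl, Or.inl rfl⟩) (ih _ (by omega))
    · rw [steps_of_gt (by omega)]
      exact Walks.cons (Or.inl ⟨rfl, Or.inr (by dsimp only; omega)⟩) (ih _ (by omega))

theorem walks_vwalk (x a b : ℕ) : Walks (x, a) (vwalk x a b) (x, b) := by
  unfold vwalk
  induction hd : (b - a) + (a - b) generalizing a with
  | zero =>
    obtain rfl : a = b := by omega
    rw [steps_self]
    exact Walks.nil _
  | succ d ih =>
    rcases Nat.lt_or_ge a b with h | h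
    · rw [steps_of_lt h]
      exact Walks.cons (Or.inr ⟨rfl, Or.inl rfl⟩) (ih _ (by omega))
    · rw [steps_of_gt (by omega)]
      exact Walks.cons (Or.inr ⟨rfl, Or.inr (by dsimp only; omega)⟩) (ih _ (by omega))

theorem mem_hwalk {y a b : ℕ} {p : ℕ × ℕ} :
    p ∈ hwalk y a b ↔ p.2 = y ∧ (a < p.1 ∧ p.1 ≤ b ∨ b ≤ p.1 ∧ p.1 < a) := by
  obtain ⟨x, y'⟩ := p
  simp only [hwalk, List.mem_map, mem_steps, Prod.mk.injEq]
  constructor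
  · rintro ⟨k, hk, rfl, rfl⟩
    exact ⟨rfl, hk⟩
  · rintro ⟨rfl, hk⟩
    exact ⟨x, hk, rfl, rfl⟩

theorem mem_vwalk {x a b : ℕ} {p : ℕ × ℕ} :
    p ∈ vwalk x a b ↔ p.1 = x ∧ (a < p.2 ∧ p.2 ≤ b ∨ b ≤ p.2 ∧ p.2 < a) := by
  obtain ⟨x', y⟩ := p
  simp only [vwalk, List.mem_map, mem_steps, Prod.mk.injEq]
  constructor
  · rintro ⟨k, hk, rfl, rfl⟩
    exact ⟨rfl, hk⟩
  · rintro ⟨rfl, hk⟩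
    exact ⟨y, hk, rfl, rfl⟩

theorem nodup_hwalk (y a b : ℕ) : (hwalk y a b).Nodup :=
  (nodup_steps a b).map fun _ _ h => (Prod.ext_iff.1 h).1

theorem nodup_vwalk (x a b : ℕ) : (vwalk x a b).Nodup :=
  (nodup_steps a b).map fun _ _ h => (Prod.ext_iff.1 h).2

theorem length_hwalk (y a b : ℕ) : (hwalk y a b).length = (b - a) + (a - b) := by
  rw [hwalk, List.length_map, length_steps]

theorem length_vwalk (x a b : ℕ) : (vwalk x a b).length = (b - a) + (a - b) := by
  rw [vwalk, List.length_map, length_steps]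

/-! ### Stars between four boxes on an antidiagonal -/

namespace Layout

/-- The leftmost column of the `t`-th box of the square whose leftmost column is `x`. -/
def boxX (q x t : ℕ) : ℕ := x + t * (6 * q + 1)

/-- The lowest row of the `t`-th box of the square whose lowest row is `y`. -/
def boxY (q y t : ℕ) : ℕ := y + (3 - t) * (6 * q + 1)

/-- The row in which the path of the `s`-th star from the box `b` to the box `t` leaves `b`. -/
def exitRow (q y b s t : ℕ) : ℕ := boxY q y b + t * q + s

/-- The median of the boxes other than `b`. -/
def median (b : ℕ) : ℕ := if b ≤ 1 then 2 else 1

/-- The position of the box `t` among the boxes other than `b`. -/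
def rank (b t : ℕ) : ℕ := if t < median b then 0 else if t = median b then 1 else 2

/-- The lowest row of the three hub vertices. -/
def hubRow (q y b s : ℕ) : ℕ := exitRow q y b s (median b) - 1

/-- The column of the hub vertices. -/
def hubCol (q x b : ℕ) : ℕ := boxX q x b + 3 * q

/-- The last column before the boundary of the box `b`, on the way to the box `t`. -/
def innerCol (q x b t : ℕ) : ℕ := if b < t then boxX q x b + 6 * q - 1 else boxX q x b + 1

/-- The column in which the box `b` is left on the way to the box `t`. -/
def exitCol (q x b t : ℕ) : ℕ := if b < t then boxX q x b + 6 * q else boxX q x b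

/-- The last row before the box `t`, coming from the box `b`. -/
def outerRow (q y b t : ℕ) : ℕ := if b < t then boxY q y t + 6 * q + 1 else boxY q y t - 1

/-- The row in which the box `t` is entered, coming from the box `b`. -/
def entryRow (q y b t : ℕ) : ℕ := if b < t then boxY q y t + 6 * q else boxY q y t

/-- The column in which the `s`-th star enters the box `t`. -/
def entryCol (q x s t : ℕ) : ℕ := boxX q x t + s

/-- The part of a path in the central box, except for its last vertex. -/
def hub (q x y b s t : ℕ) : List (ℕ × ℕ) :=
  (hubCol q x b, hubRow q y b s + rank b t) ::
    (vwalk (hubCol q x b) (hubRow q y b s + rank b t) (exitRow q y b s t) ++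
      hwalk (exitRow q y b s t) (hubCol q x b) (innerCol q x b t))

/-- The part of a path between the boxes. -/
def bridge (q x y b s t : ℕ) : List (ℕ × ℕ) :=
  hwalk (exitRow q y b s t) (exitCol q x b t) (entryCol q x s t) ++
    vwalk (entryCol q x s t) (exitRow q y b s t) (outerRow q y b t)

/-- A path from box to box. -/
def arm (q x y b s t : ℕ) : List (ℕ × ℕ) :=
  (exitCol q x b t, exitRow q y b s t) ::
    (bridge q x y b s t ++ [(entryCol q x s t, entryRow q y b t)])

/-- The part of a path in the last box, except for its first vertex. -/
def tail (q x y b s t o₁ o₂ : ℕ) : List (ℕ × ℕ) :=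
  vwalk (entryCol q x s t) (entryRow q y b t) (boxY q y t + o₂) ++
    hwalk (boxY q y t + o₂) (entryCol q x s t) (boxX q x t + o₁)

/-- Columns increase and rows decrease with the index, so distinct boxes share neither a row nor a
column. -/
theorem box_order (q x y : ℕ) {b t : ℕ} (hb : b < 4) (ht : t < 4) (hbt : b ≠ t) :
    (b < t ∧ boxX q x b + (6 * q + 1) ≤ boxX q x t ∧ boxY q y t + (6 * q + 1) ≤ boxY q y b) ∨
    (t < b ∧ boxX q x t + (6 * q + 1) ≤ boxX q x b ∧ boxY q y b + (6 * q + 1) ≤ boxY q y t) := by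
  unfold boxX boxY
  interval_cases b <;> interval_cases t <;> omega

theorem box_bounds (q x y : ℕ) {t : ℕ} (ht : t < 4) :
    x ≤ boxX q x t ∧ boxX q x t + (6 * q + 1) ≤ x + 4 * (6 * q + 1) ∧
      y ≤ boxY q y t ∧ boxY q y t + (6 * q + 1) ≤ y + 4 * (6 * q + 1) := by
  unfold boxX boxY
  interval_cases t <;> omega

theorem exitRow_bounds (q y b : ℕ) {s t : ℕ} (hs : s < q) (ht : t < 4) :
    boxY q y b ≤ exitRow q y b s t ∧ exitRow q y b s t + 2 * q + 1 ≤ boxY q y b + 6 * q := by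
  unfold exitRow
  interval_cases t <;> omega

/-- Each target owns a block of q consecutive exit rows, one for each star, and the blocks are
ordered like the targets. -/
theorem exitRow_lt (q y b : ℕ) {s s' t t' : ℕ} (hs : s < q) (ht : t < 4) (ht' : t' < 4)
    (h : t < t') : exitRow q y b s t < exitRow q y b s' t' := by
  unfold exitRow
  interval_cases t <;> interval_cases t' <;> omega

theorem exitRow_add_le (q y b s : ℕ) {t t' : ℕ} (ht : t < 4) (ht' : t' < 4)
    (h : t < t') : exitRow q y b s t + q ≤ exitRow q y b s t' := by
  unfold exitRow
  interval_cases t <;> interval_cases t' <;> omega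

/-- The median is at least 1, so the subtraction in `hubRow` is not truncated and the row stays in
the box. -/
theorem one_le_exitRow_median (q y b s : ℕ) (hq : 1 ≤ q) :
    boxY q y b + 1 ≤ exitRow q y b s (median b) := by
  unfold exitRow median
  split_ifs <;> omega

end Layout

/-! ### Containment and disjointness of the routes -/

namespace Layout

variable {q x y b s t : ℕ}

/-- The two orientations of a route, with all conditional definitions resolved into linear facts for
`omega`. -/
theorem route_cases (x y : ℕ) (hb : b < 4) (ht : t < 4) (hbt : b ≠ t) :
    (b < t ∧ boxX q x b + (6 * q + 1) ≤ boxX q x t ∧ boxY q y t + (6 * q + 1) ≤ boxY q y b ∧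
      innerCol q x b t = boxX q x b + 6 * q - 1 ∧ exitCol q x b t = boxX q x b + 6 * q ∧
      outerRow q y b t = boxY q y t + 6 * q + 1 ∧ entryRow q y b t = boxY q y t + 6 * q) ∨
    (t < b ∧ boxX q x t + (6 * q + 1) ≤ boxX q x b ∧ boxY q y b + (6 * q + 1) ≤ boxY q y t ∧
      innerCol q x b t = boxX q x b + 1 ∧ exitCol q x b t = boxX q x b ∧
      outerRow q y b t = boxY q y t - 1 ∧ entryRow q y b t = boxY q y t) := by
  rcases box_order q x y hb ht hbt with ⟨h, h1, h2⟩ | ⟨h, h1, h2⟩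
  · refine Or.inl ⟨h, h1, h2, ?_, ?_, ?_, ?_⟩
    · rw [innerCol, if_pos h]
    · rw [exitCol, if_pos h]
    · rw [outerRow, if_pos h]
    · rw [entryRow, if_pos h]
  · have h' : ¬ b < t := by omega
    refine Or.inr ⟨h, h1, h2, ?_, ?_, ?_, ?_⟩
    · rw [innerCol, if_neg h']
    · rw [exitCol, if_neg h']
    · rw [outerRow, if_neg h']
    · rw [entryRow, if_neg h']

theorem median_lt (b : ℕ) : median b < 4 := by
  unfold median
  split_ifs <;> omega

/-- The median path starts in its own exit row; the exit rows of the other two are at least q below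
or above it. -/
theorem hub_cases (y b s : ℕ) (ht : t < 4) (hq : 1 ≤ q) :
    (t < median b ∧ rank b t = 0 ∧ exitRow q y b s t + q ≤ hubRow q y b s + 1) ∨
    (t = median b ∧ rank b t = 1 ∧ exitRow q y b s t = hubRow q y b s + 1) ∨
    (median b < t ∧ rank b t = 2 ∧ hubRow q y b s + 1 + q ≤ exitRow q y b s t) := by
  have h1 : hubRow q y b s + 1 = exitRow q y b s (median b) := by
    have := one_le_exitRow_median q y b s hq
    unfold hubRow
    omega
  rw [h1]
  rcases lt_trichotomy t (median b) with h | h | h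
  · exact Or.inl ⟨h, by rw [rank, if_pos h], exitRow_add_le q y b s ht (median_lt b) h⟩
  · exact Or.inr (Or.inl ⟨h, by rw [rank, if_neg (by omega), if_pos h], by rw [h]⟩)
  · exact Or.inr (Or.inr ⟨h, by rw [rank, if_neg (by omega), if_neg (by omega)],
      exitRow_add_le q y b s (median_lt b) ht h⟩)

theorem hubRow_bounds (y b : ℕ) (hs : s < q) :
    boxY q y b ≤ hubRow q y b s ∧ hubRow q y b s + 2 * q + 2 ≤ boxY q y b + 6 * q := by
  have h1 := one_le_exitRow_median q y b s (by omega)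
  have h2 := exitRow_bounds q y b hs (median_lt b)
  unfold hubRow
  omega

theorem walks_path (x y : ℕ) (hb : b < 4) (ht : t < 4) (hbt : b ≠ t) (hs : s < q) (o₁ o₂ : ℕ) :
    Walks (hubCol q x b, hubRow q y b s + rank b t)
      ((vwalk (hubCol q x b) (hubRow q y b s + rank b t) (exitRow q y b s t) ++
        hwalk (exitRow q y b s t) (hubCol q x b) (innerCol q x b t)) ++
        (arm q x y b s t ++ tail q x y b s t o₁ o₂))
      (boxX q x t + o₁, boxY q y t + o₂) := by
  have hr := route_cases (q := q) x y hb ht hbt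
  refine ((walks_vwalk _ _ _).append (walks_hwalk _ _ _)).append ?_
  unfold arm tail bridge
  rw [List.cons_append, List.append_assoc, List.append_assoc]
  refine Walks.cons (Or.inl ⟨rfl, ?_⟩) ((walks_hwalk _ _ _).append
    ((walks_vwalk _ _ _).append (Walks.cons (Or.inr ⟨rfl, ?_⟩)
      ((walks_vwalk _ _ _).append (walks_hwalk _ _ _)))))
  · dsimp only; omega
  · dsimp only; omega

theorem mem_hub {p : ℕ × ℕ} : p ∈ hub q x y b s t ↔
    (p.1 = hubCol q x b ∧ (hubRow q y b s + rank b t ≤ p.2 ∧ p.2 ≤ exitRow q y b s t ∨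
      exitRow q y b s t ≤ p.2 ∧ p.2 ≤ hubRow q y b s + rank b t)) ∨
    (p.2 = exitRow q y b s t ∧ (hubCol q x b < p.1 ∧ p.1 ≤ innerCol q x b t ∨
      innerCol q x b t ≤ p.1 ∧ p.1 < hubCol q x b)) := by
  unfold hub
  rw [List.mem_cons, List.mem_append, mem_vwalk, mem_hwalk, Prod.ext_iff]
  omega

theorem mem_bridge {p : ℕ × ℕ} : p ∈ bridge q x y b s t ↔
    (p.2 = exitRow q y b s t ∧ (exitCol q x b t < p.1 ∧ p.1 ≤ entryCol q x s t ∨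
      entryCol q x s t ≤ p.1 ∧ p.1 < exitCol q x b t)) ∨
    (p.1 = entryCol q x s t ∧ (exitRow q y b s t < p.2 ∧ p.2 ≤ outerRow q y b t ∨
      outerRow q y b t ≤ p.2 ∧ p.2 < exitRow q y b s t)) := by
  unfold bridge
  rw [List.mem_append, mem_vwalk, mem_hwalk]

theorem mem_arm {p : ℕ × ℕ} : p ∈ arm q x y b s t ↔
    (p.1 = exitCol q x b t ∧ p.2 = exitRow q y b s t) ∨ p ∈ bridge q x y b s t ∨
      (p.1 = entryCol q x s t ∧ p.2 = entryRow q y b t) := by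
  unfold arm
  rw [List.mem_cons, List.mem_append, List.mem_singleton, Prod.ext_iff, Prod.ext_iff]

theorem mem_tail {p : ℕ × ℕ} {o₁ o₂ : ℕ} : p ∈ tail q x y b s t o₁ o₂ ↔
    (p.1 = entryCol q x s t ∧ (entryRow q y b t < p.2 ∧ p.2 ≤ boxY q y t + o₂ ∨
      boxY q y t + o₂ ≤ p.2 ∧ p.2 < entryRow q y b t)) ∨
    (p.2 = boxY q y t + o₂ ∧ (entryCol q x s t < p.1 ∧ p.1 ≤ boxX q x t + o₁ ∨
      boxX q x t + o₁ ≤ p.1 ∧ p.1 < entryCol q x s t)) := by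
  unfold tail
  rw [List.mem_append, mem_vwalk, mem_hwalk]

/-- The `t`-th box. -/
def InBox (q x y t : ℕ) (p : ℕ × ℕ) : Prop :=
  (boxX q x t ≤ p.1 ∧ p.1 < boxX q x t + (6 * q + 1)) ∧
    (boxY q y t ≤ p.2 ∧ p.2 < boxY q y t + (6 * q + 1))

theorem inBox_of_mem_hub (hb : b < 4) (ht : t < 4) (hbt : b ≠ t) (hs : s < q) {p : ℕ × ℕ}
    (hp : p ∈ hub q x y b s t) : InBox q x y b p := by
  have h1 := route_cases (q := q) x y hb ht hbt
  have h2 := exitRow_bounds q y b hs ht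
  have h3 := hubRow_bounds y b hs
  have h4 := hub_cases y b s ht (show 1 ≤ q by omega)
  rw [mem_hub] at hp
  unfold hubCol at hp
  unfold InBox
  omega

theorem inBox_of_mem_tail (hb : b < 4) (ht : t < 4) (hbt : b ≠ t) (hs : s < q) {p : ℕ × ℕ}
    {o₁ o₂ : ℕ} (ho₁ : o₁ ≤ 6 * q) (ho₂ : o₂ ≤ 6 * q) (hp : p ∈ tail q x y b s t o₁ o₂) :
    InBox q x y t p := by
  have h1 := route_cases (q := q) x y hb ht hbt
  rw [mem_tail] at hp
  unfold entryCol at hp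
  unfold InBox
  omega

theorem inBox_exit (hb : b < 4) (ht : t < 4) (hbt : b ≠ t) (hs : s < q) :
    InBox q x y b (exitCol q x b t, exitRow q y b s t) := by
  have h1 := route_cases (q := q) x y hb ht hbt
  have h2 := exitRow_bounds q y b hs ht
  unfold InBox
  dsimp only
  omega

theorem inBox_entry (hb : b < 4) (ht : t < 4) (hbt : b ≠ t) (hs : s < q) :
    InBox q x y t (entryCol q x s t, entryRow q y b t) := by
  have h1 := route_cases (q := q) x y hb ht hbt
  unfold InBox entryCol
  dsimp only
  omega

/-- The horizontal part keeps to the rows of box b and has already left its columns; the vertical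
part keeps to the columns of box t and stops one step short of it. No other box meets these rows or
columns. -/
theorem not_inBox_of_mem_bridge (hb : b < 4) (ht : t < 4) (hbt : b ≠ t) (hs : s < q)
    {p : ℕ × ℕ} (hp : p ∈ bridge q x y b s t) {t' : ℕ} (ht' : t' < 4) :
    ¬ InBox q x y t' p := by
  have h1 := route_cases (q := q) x y hb ht hbt
  have h2 := exitRow_bounds q y b hs ht
  have h3 : t' = b ∨ _ := or_iff_not_imp_left.2 fun h => box_order q x y ht' hb h
  have h4 : t' = t ∨ _ := or_iff_not_imp_left.2 fun h => box_order q x y ht' ht h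
  rw [mem_bridge] at hp
  unfold entryCol at hp
  unfold InBox
  rcases h3 with rfl | h3
  · omega
  · rcases h4 with rfl | h4
    · omega
    · omega

theorem inSquare_of_mem_bridge (hb : b < 4) (ht : t < 4) (hbt : b ≠ t) (hs : s < q)
    {p : ℕ × ℕ} (hp : p ∈ bridge q x y b s t) :
    (x ≤ p.1 ∧ p.1 < x + 4 * (6 * q + 1)) ∧ (y ≤ p.2 ∧ p.2 < y + 4 * (6 * q + 1)) := by
  have h1 := route_cases (q := q) x y hb ht hbt
  have h2 := exitRow_bounds q y b hs ht
  have h3 := box_bounds q x y hb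
  have h4 := box_bounds q x y ht
  rw [mem_bridge] at hp
  unfold entryCol at hp
  omega

theorem inSquare_of_inBox (ht : t < 4) {p : ℕ × ℕ} (hp : InBox q x y t p) :
    (x ≤ p.1 ∧ p.1 < x + 4 * (6 * q + 1)) ∧ (y ≤ p.2 ∧ p.2 < y + 4 * (6 * q + 1)) := by
  have h3 := box_bounds q x y ht
  unfold InBox at hp
  omega

theorem inBox_unique {t t' : ℕ} (ht : t < 4) (ht' : t' < 4) {p : ℕ × ℕ}
    (hp : InBox q x y t p) (hp' : InBox q x y t' p) : t = t' := by
  by_contra hne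
  have h := box_order q x y ht ht' hne
  unfold InBox at hp hp'
  omega

/-- Distinct routes use distinct exit rows and distinct entry columns, so only a horizontal and a
vertical part could cross. A horizontal part passes the columns of t' only if t' lies between b and
its target t. If b < t' < t, the vertical part descends from a row below that horizontal part; if t
< t' < b, it ascends from a row above it. For equal targets the orders of the rows and columns of
the stars agree, which excludes a crossing in the same way. -/
theorem disjoint_arm {s' t' : ℕ} (hb : b < 4) (ht : t < 4) (hbt : b ≠ t) (ht' : t' < 4)
    (hbt' : b ≠ t') (hs : s < q) (hs' : s' < q) (h : s < s' ∨ t ≠ t') :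
    (arm q x y b s t).Disjoint (arm q x y b s' t') := by
  intro p hp hp'
  have h1 := route_cases (q := q) x y hb ht hbt
  have h1' := route_cases (q := q) x y hb ht' hbt'
  have h2 := exitRow_bounds q y b hs ht
  have h2' := exitRow_bounds q y b hs' ht'
  rw [mem_arm, mem_bridge] at hp hp'
  unfold entryCol at hp hp'
  rcases lt_trichotomy t t' with htt | rfl | htt
  · have h3 := exitRow_lt q y b (s' := s') hs ht ht' htt
    have h4 := box_order q x y ht ht' htt.ne
    rcases h1 with h1 | h1 <;> rcases h1' with h1' | h1' <;> omega
  · have h3 : exitRow q y b s t + s' = exitRow q y b s' t + s := by unfold exitRow; omega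
    rcases h1 with h1 | h1 <;> omega
  · have h3 := exitRow_lt q y b (s' := s) hs' ht' ht htt
    have h4 := box_order q x y ht ht' htt.ne'
    rcases h1 with h1 | h1 <;> rcases h1' with h1' | h1' <;> omega

/-- The median lies weakly between the two targets, so the vertical parts occupy disjoint intervals
of the hub column; the horizontal parts lie in different exit rows. -/
theorem disjoint_hub {t' : ℕ} (hb : b < 4) (ht : t < 4) (hbt : b ≠ t) (ht' : t' < 4)
    (hbt' : b ≠ t') (hs : s < q) (h : t < t') :
    (hub q x y b s t).Disjoint (hub q x y b s t') := by
  intro p hp hp'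
  have h2 := exitRow_bounds q y b hs ht
  have h3 := hub_cases y b s ht (show 1 ≤ q by omega)
  have h3' := hub_cases y b s ht' (show 1 ≤ q by omega)
  have h4 := exitRow_lt q y b (s' := s) hs ht ht' h
  have h5 : t ≤ median b ∧ median b ≤ t' := by
    unfold median
    split_ifs <;> omega
  rw [mem_hub] at hp hp'
  omega

/-- The bridge avoids both boxes, so hub and tail can meet the arm only in its first or last vertex,
where coordinates are compared. -/
theorem nodup_path (hb : b < 4) (ht : t < 4) (hbt : b ≠ t) (hs : s < q) {o₁ o₂ : ℕ}
    (ho₁ : o₁ ≤ 6 * q) (ho₂ : o₂ ≤ 6 * q) :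
    (hub q x y b s t ++ arm q x y b s t ++ tail q x y b s t o₁ o₂).Nodup := by
  have h1 := route_cases (q := q) x y hb ht hbt
  have h2 := exitRow_bounds q y b hs ht
  have hbridge : ∀ {p}, p ∈ bridge q x y b s t → ¬ InBox q x y b p ∧ ¬ InBox q x y t p :=
    fun hp => ⟨not_inBox_of_mem_bridge hb ht hbt hs hp hb,
      not_inBox_of_mem_bridge hb ht hbt hs hp ht⟩
  have hunique : ∀ {p}, InBox q x y b p → InBox q x y t p → False :=
    fun hp hp' => hbt (inBox_unique hb ht hp hp')
  have hhub : (hub q x y b s t).Nodup := by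
    refine List.nodup_cons.2 ⟨fun hp => ?_, (nodup_vwalk _ _ _).append (nodup_hwalk _ _ _)
      fun p hp hp' => ?_⟩
    · rw [List.mem_append, mem_vwalk, mem_hwalk] at hp
      omega
    · rw [mem_vwalk] at hp
      rw [mem_hwalk] at hp'
      omega
  have harm : (arm q x y b s t).Nodup := by
    refine List.nodup_cons.2 ⟨fun hp => ?_, ((nodup_hwalk _ _ _).append (nodup_vwalk _ _ _)
      fun p hp hp' => ?_).append (List.nodup_singleton _) fun p hp hp' => ?_⟩
    · rw [List.mem_append, List.mem_singleton] at hp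
      rcases hp with hp | hp
      · exact (hbridge hp).1 (inBox_exit hb ht hbt hs)
      · exact hunique (inBox_exit hb ht hbt hs) (hp ▸ inBox_entry hb ht hbt hs)
    · rw [mem_vwalk] at hp'
      rw [mem_hwalk] at hp
      omega
    · rw [List.mem_singleton] at hp'
      subst hp'
      exact (hbridge hp).2 (inBox_entry hb ht hbt hs)
  have htail : (tail q x y b s t o₁ o₂).Nodup := by
    refine (nodup_vwalk _ _ _).append (nodup_hwalk _ _ _) fun p hp hp' => ?_
    rw [mem_vwalk] at hp
    rw [mem_hwalk] at hp'
    omega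
  refine (hhub.append harm fun p hp hp' => ?_).append htail fun p hp hp' => ?_
  · have hbox := inBox_of_mem_hub hb ht hbt hs hp
    unfold arm at hp'
    rw [List.mem_cons, List.mem_append, List.mem_singleton] at hp'
    rcases hp' with rfl | hp' | rfl
    · rw [mem_hub] at hp
      unfold hubCol at hp
      dsimp only at hp
      omega
    · exact (hbridge hp').1 hbox
    · exact hunique hbox (inBox_entry hb ht hbt hs)
  · have hbox := inBox_of_mem_tail hb ht hbt hs ho₁ ho₂ hp'
    rw [List.mem_append] at hp
    rcases hp with hp | hp
    · exact hunique (inBox_of_mem_hub hb ht hbt hs hp) hbox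
    · unfold arm at hp
      rw [List.mem_cons, List.mem_append, List.mem_singleton] at hp
      rcases hp with rfl | hp | rfl
      · exact hunique (inBox_exit hb ht hbt hs) hbox
      · exact (hbridge hp).2 hbox
      · rw [mem_tail] at hp'
        dsimp only at hp'
        omega

theorem disjoint_path {t' o₁ o₂ o₁' o₂' : ℕ} (hb : b < 4) (ht : t < 4) (hbt : b ≠ t)
    (ht' : t' < 4) (hbt' : b ≠ t') (hs : s < q) (htt : t ≠ t')
    (ho₁ : o₁ ≤ 6 * q) (ho₂ : o₂ ≤ 6 * q) (ho₁' : o₁' ≤ 6 * q) (ho₂' : o₂' ≤ 6 * q) :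
    (hub q x y b s t ++ arm q x y b s t ++ tail q x y b s t o₁ o₂).Disjoint
      (hub q x y b s t' ++ arm q x y b s t' ++ tail q x y b s t' o₁' o₂') := by
  have hHA : ∀ {t t'}, t < 4 → b ≠ t → t' < 4 → b ≠ t' → t ≠ t' → ∀ p,
      p ∈ hub q x y b s t → p ∉ arm q x y b s t' := by
    intro t t' ht hbt ht' hbt' htt p hp hp'
    have hbox := inBox_of_mem_hub hb ht hbt hs hp
    unfold arm at hp'
    rw [List.mem_cons, List.mem_append, List.mem_singleton] at hp'
    rcases hp' with rfl | hp' | rfl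
    · have h1 := route_cases (q := q) x y hb ht hbt
      have h1' := route_cases (q := q) x y hb ht' hbt'
      have h2 := exitRow_bounds q y b hs ht
      have h3 : exitRow q y b s t ≠ exitRow q y b s t' := by
        rcases Nat.lt_or_gt_of_ne htt with h | h
        · exact (exitRow_lt q y b hs ht ht' h).ne
        · exact (exitRow_lt q y b hs ht' ht h).ne'
      rw [mem_hub] at hp
      unfold hubCol at hp
      dsimp only at hp
      omega
    · exact not_inBox_of_mem_bridge hb ht' hbt' hs hp' hb hbox
    · exact hbt' (inBox_unique hb ht' hbox (inBox_entry hb ht' hbt' hs))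
  have hTA : ∀ {t t' o₁ o₂}, o₁ ≤ 6 * q → o₂ ≤ 6 * q → t < 4 → b ≠ t → t' < 4 → b ≠ t' →
      t ≠ t' → ∀ p, p ∈ tail q x y b s t o₁ o₂ → p ∉ arm q x y b s t' := by
    intro t t' o₁ o₂ ho₁ ho₂ ht hbt ht' hbt' htt p hp hp'
    have hbox := inBox_of_mem_tail hb ht hbt hs ho₁ ho₂ hp
    unfold arm at hp'
    rw [List.mem_cons, List.mem_append, List.mem_singleton] at hp'
    rcases hp' with rfl | hp' | rfl
    · exact hbt (inBox_unique hb ht (inBox_exit hb ht' hbt' hs) hbox)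
    · exact not_inBox_of_mem_bridge hb ht' hbt' hs hp' ht hbox
    · exact htt (inBox_unique ht ht' hbox (inBox_entry hb ht' hbt' hs))
  intro p hp hp'
  rw [List.mem_append, List.mem_append] at hp hp'
  rcases hp with (hp | hp) | hp <;> rcases hp' with (hp' | hp') | hp'
  · rcases Nat.lt_or_gt_of_ne htt with h | h
    · exact disjoint_hub hb ht hbt ht' hbt' hs h hp hp'
    · exact disjoint_hub hb ht' hbt' ht hbt hs h hp' hp
  · exact hHA ht hbt ht' hbt' htt p hp hp'
  · exact hbt' (inBox_unique hb ht' (inBox_of_mem_hub hb ht hbt hs hp)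
      (inBox_of_mem_tail hb ht' hbt' hs ho₁' ho₂' hp'))
  · exact hHA ht' hbt' ht hbt htt.symm p hp' hp
  · exact disjoint_arm hb ht hbt ht' hbt' hs hs (Or.inr htt) hp hp'
  · exact hTA ho₁' ho₂' ht' hbt' ht hbt htt.symm p hp' hp
  · exact hbt (inBox_unique hb ht (inBox_of_mem_hub hb ht' hbt' hs hp')
      (inBox_of_mem_tail hb ht hbt hs ho₁ ho₂ hp))
  · exact hTA ho₁ ho₂ ht hbt ht' hbt' htt p hp hp'
  · exact htt (inBox_unique ht ht' (inBox_of_mem_tail hb ht hbt hs ho₁ ho₂ hp)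
      (inBox_of_mem_tail hb ht' hbt' hs ho₁' ho₂' hp'))

theorem inSquare_of_mem_path (hb : b < 4) (ht : t < 4) (hbt : b ≠ t) (hs : s < q) {o₁ o₂ : ℕ}
    (ho₁ : o₁ ≤ 6 * q) (ho₂ : o₂ ≤ 6 * q) {p : ℕ × ℕ}
    (hp : p ∈ hub q x y b s t ++ arm q x y b s t ++ tail q x y b s t o₁ o₂) :
    (x ≤ p.1 ∧ p.1 < x + 4 * (6 * q + 1)) ∧ (y ≤ p.2 ∧ p.2 < y + 4 * (6 * q + 1)) := by
  rw [List.mem_append, List.mem_append] at hp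
  rcases hp with (hp | hp) | hp
  · exact inSquare_of_inBox hb (inBox_of_mem_hub hb ht hbt hs hp)
  · unfold arm at hp
    rw [List.mem_cons, List.mem_append, List.mem_singleton] at hp
    rcases hp with rfl | hp | rfl
    · exact inSquare_of_inBox hb (inBox_exit hb ht hbt hs)
    · exact inSquare_of_mem_bridge hb ht hbt hs hp
    · exact inSquare_of_inBox ht (inBox_entry hb ht hbt hs)
  · exact inSquare_of_inBox ht (inBox_of_mem_tail hb ht hbt hs ho₁ ho₂ hp)

theorem length_arm_le (x y : ℕ) (hb : b < 4) (ht : t < 4) (hbt : b ≠ t) (hs : s < q) :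
    (arm q x y b s t).length ≤ 2 * (4 * (6 * q + 1)) := by
  have h1 := route_cases (q := q) x y hb ht hbt
  have h2 := exitRow_bounds q y b hs ht
  have h3 := box_bounds q x y hb
  have h4 := box_bounds q x y ht
  unfold arm bridge
  rw [List.length_cons, List.length_append, List.length_append, length_hwalk, length_vwalk,
    List.length_singleton]
  unfold entryCol
  omega

theorem length_path_le (x y : ℕ) (hb : b < 4) (ht : t < 4) (hbt : b ≠ t) (hs : s < q)
    {o₁ o₂ : ℕ} (ho₁ : o₁ ≤ 6 * q) (ho₂ : o₂ ≤ 6 * q) :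
    (hub q x y b s t ++ arm q x y b s t ++ tail q x y b s t o₁ o₂).length ≤
      7 * (4 * (6 * q + 1)) := by
  have h0 := length_arm_le x y hb ht hbt hs
  have h1 := route_cases (q := q) x y hb ht hbt
  have h2 := exitRow_bounds q y b hs ht
  have h3 := hubRow_bounds y b hs
  have h4 := hub_cases y b s ht (show 1 ≤ q by omega)
  rw [List.length_append, List.length_append]
  unfold hub tail
  rw [List.length_cons, List.length_append, List.length_append, length_hwalk, length_hwalk,
    length_vwalk, length_vwalk]
  unfold hubCol entryCol
  omega

/-- The first two vertices of a path, and the direction between them. -/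
theorem exists_hub_eq (x y : ℕ) (hb : b < 4) (ht : t < 4) (hbt : b ≠ t) (hs : s < q)
    (hq : 2 ≤ q) : ∃ p l, hub q x y b s t = (hubCol q x b, hubRow q y b s + rank b t) :: p :: l ∧
      ((rank b t = 0 ∧ p.1 = hubCol q x b ∧ p.2 + 1 = hubRow q y b s) ∨
        (rank b t = 1 ∧ p.2 = hubRow q y b s + 1 ∧
          (p.1 = hubCol q x b + 1 ∨ p.1 + 1 = hubCol q x b)) ∨
        (rank b t = 2 ∧ p.1 = hubCol q x b ∧ p.2 = hubRow q y b s + 3)) := by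
  have h1 := route_cases (q := q) x y hb ht hbt
  unfold hub
  rcases hub_cases y b s ht (show 1 ≤ q by omega) with ⟨-, hr, h⟩ | ⟨-, hr, h⟩ | ⟨-, hr, h⟩
  -- For 2 ≤ q the exit row lies strictly below the hub vertex, so the first step really goes down.
  -- The upward case likewise needs 2 ≤ q.
  · rw [hr, vwalk, steps_of_gt (by omega)]
    exact ⟨_, _, rfl, Or.inl ⟨rfl, rfl, by dsimp only; omega⟩⟩
  · rw [hr, h, vwalk, steps_self, hwalk]
    rcases h1 with h1 | h1
    · rw [steps_of_lt (by unfold hubCol; omega)]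
      exact ⟨_, _, rfl, Or.inr (Or.inl ⟨rfl, rfl, Or.inl rfl⟩)⟩
    · rw [steps_of_gt (by unfold hubCol; omega)]
      exact ⟨_, _, rfl, Or.inr (Or.inl ⟨rfl, rfl, Or.inr (by unfold hubCol; dsimp only; omega)⟩)⟩
  · rw [hr, vwalk, steps_of_lt (by omega)]
    exact ⟨_, _, rfl, Or.inr (Or.inr ⟨rfl, rfl, rfl⟩)⟩

end Layout

/-! ### A planting with four boxes in each square -/

namespace Layout

/-- A point of the plane as a vertex of the grid (modulo its side length). -/
def toGrid {S : ℕ} (hS : 0 < S) (p : ℕ × ℕ) : Grid S :=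
  (⟨p.1 % S, Nat.mod_lt _ hS⟩, ⟨p.2 % S, Nat.mod_lt _ hS⟩)

theorem toGrid_val {S : ℕ} (hS : 0 < S) {p : ℕ × ℕ} (h1 : p.1 < S) (h2 : p.2 < S) :
    (toGrid hS p).1.val = p.1 ∧ (toGrid hS p).2.val = p.2 :=
  ⟨Nat.mod_eq_of_lt h1, Nat.mod_eq_of_lt h2⟩

theorem toGrid_inj {S : ℕ} (hS : 0 < S) {p p' : ℕ × ℕ} (hp : p.1 < S ∧ p.2 < S)
    (hp' : p'.1 < S ∧ p'.2 < S) (h : toGrid hS p = toGrid hS p') : p = p' := by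
  have h1 := toGrid_val hS hp.1 hp.2
  have h2 := toGrid_val hS hp'.1 hp'.2
  rw [h] at h1
  exact Prod.ext (h1.1.symm.trans h2.1) (h1.2.symm.trans h2.2)

theorem toGrid_mem_block_iff {S : ℕ} (hS : 0 < S) {p : ℕ × ℕ} (hp : p.1 < S ∧ p.2 < S)
    (c : ℕ × ℕ) (s : ℕ) : toGrid hS p ∈ Grid.block S c s ↔
      (c.1 ≤ p.1 ∧ p.1 < c.1 + s) ∧ (c.2 ≤ p.2 ∧ p.2 < c.2 + s) := by
  have h := toGrid_val hS hp.1 hp.2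
  rw [Grid.block, Set.mem_ofPred_eq, h.1, h.2]

theorem isPath_map_toGrid {S : ℕ} (hS : 0 < S) {l : List (ℕ × ℕ)} (hnd : l.Nodup)
    (hc : l.IsChain PlaneAdj) (hl : ∀ p ∈ l, p.1 < S ∧ p.2 < S) :
    Grid.IsPath (l.map (toGrid hS)) := by
  refine ⟨hnd.map_on fun p hp p' hp' h => toGrid_inj hS (hl p hp) (hl p' hp') h, ?_⟩
  rw [List.isChain_map]
  refine List.IsChain.imp_of_mem_imp (fun p p' hp hp' h => ?_) hc
  have h1 := toGrid_val hS (hl p hp).1 (hl p hp).2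
  have h2 := toGrid_val hS (hl p' hp').1 (hl p' hp').2
  unfold Grid.Adj
  rw [Fin.ext_iff, Fin.ext_iff, h1.1, h1.2, h2.1, h2.2]
  exact h

theorem disjoint_map_toGrid {S : ℕ} (hS : 0 < S) {l l' : List (ℕ × ℕ)} (h : l.Disjoint l')
    (hl : ∀ p ∈ l, p.1 < S ∧ p.2 < S) (hl' : ∀ p ∈ l', p.1 < S ∧ p.2 < S) :
    (l.map (toGrid hS)).Disjoint (l'.map (toGrid hS)) := by
  intro v hv hv'
  obtain ⟨p, hp, rfl⟩ := List.mem_map.1 hv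
  obtain ⟨p', hp', hpp⟩ := List.mem_map.1 hv'
  rw [toGrid_inj hS (hl' p' hp') (hl p hp) hpp] at hp'
  exact h hp hp'

/-- The leftmost column of the `i`-th of `n ^ 2` squares. -/
def squareX (n q i : ℕ) : ℕ := 4 * (6 * q + 1) * (i / n)

/-- The lowest row of the `i`-th of `n ^ 2` squares. -/
def squareY (n q i : ℕ) : ℕ := 4 * (6 * q + 1) * (i % n)

theorem square_le {n : ℕ} (q : ℕ) {i : ℕ} (hi : i < n ^ 2) :
    squareX n q i + 4 * (6 * q + 1) ≤ n * (4 * (6 * q + 1)) ∧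
      squareY n q i + 4 * (6 * q + 1) ≤ n * (4 * (6 * q + 1)) := by
  have hn : 0 < n := by
    rcases Nat.eq_zero_or_pos n with rfl | h
    · simp at hi
    · exact h
  have h1 : i / n + 1 ≤ n := Nat.div_lt_of_lt_mul (by rwa [← sq])
  have h2 : i % n + 1 ≤ n := Nat.mod_lt i hn
  unfold squareX squareY
  constructor
  · calc _ = 4 * (6 * q + 1) * (i / n + 1) := by ring
      _ ≤ 4 * (6 * q + 1) * n := Nat.mul_le_mul_left _ h1
      _ = _ := by ring
  · calc _ = 4 * (6 * q + 1) * (i % n + 1) := by ring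
      _ ≤ 4 * (6 * q + 1) * n := Nat.mul_le_mul_left _ h2
      _ = _ := by ring

theorem square_disjoint {n : ℕ} (q S : ℕ) {i i' : ℕ} (h : i ≠ i') :
    Disjoint (Grid.block S (squareX n q i, squareY n q i) (4 * (6 * q + 1)))
      (Grid.block S (squareX n q i', squareY n q i') (4 * (6 * q + 1))) := by
  rw [Set.disjoint_left]
  rintro v ⟨⟨h1, h2⟩, h3, h4⟩ ⟨⟨h1', h2'⟩, h3', h4'⟩
  have hkey : ∀ {a c k : ℕ}, 4 * (6 * q + 1) * a ≤ k → k < 4 * (6 * q + 1) * a +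
      4 * (6 * q + 1) → 4 * (6 * q + 1) * c ≤ k → k < 4 * (6 * q + 1) * c +
      4 * (6 * q + 1) → a ≤ c := by
    intro a c k h1 _ _ h4
    by_contra hlt
    have : 4 * (6 * q + 1) * (c + 1) ≤ 4 * (6 * q + 1) * a :=
      Nat.mul_le_mul_left _ (by omega)
    rw [Nat.mul_add, Nat.mul_one] at this
    omega
  have e1 : i / n = i' / n := le_antisymm (hkey h1 h2 h1' h2') (hkey h1' h2' h1 h2)
  have e2 : i % n = i' % n := le_antisymm (hkey h3 h4 h3' h4') (hkey h3' h4' h3 h4)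
  exact h (by rw [← Nat.div_add_mod i n, ← Nat.div_add_mod i' n, e1, e2])

/-- The grid side is a multiple of n, so neither the division nor the square root rounds. -/
theorem squareSide_eq {n : ℕ} (hn : 0 < n) (m : ℕ) : squareSide (n * m) (n ^ 2) = m := by
  rw [squareSide, mul_pow, Nat.mul_div_cancel_left _ (by positivity), Nat.sqrt_eq']

theorem embedding_val_ne (b : Fin 4 ↪ Fin 4) (j : Fin 3) : (b 0).val ≠ (b j.succ).val :=
  fun h => absurd (b.injective (Fin.ext h)) (Fin.succ_ne_zero j).symm

theorem embedding_succ_val_ne (b : Fin 4 ↪ Fin 4) {j j' : Fin 3} (h : j ≠ j') :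
    (b j.succ).val ≠ (b j'.succ).val :=
  fun h' => h (Fin.succ_injective _ (b.injective (Fin.ext h')))

/-- The bounds for the points of the paths in the `i`-th square. -/
theorem lt_of_mem_path {n q i : ℕ} (hi : i < n ^ 2) (b : Fin 4 ↪ Fin 4) {s : ℕ} (hs : s < q)
    (j : Fin 3) {o₁ o₂ : ℕ} (ho₁ : o₁ ≤ 6 * q) (ho₂ : o₂ ≤ 6 * q) {p : ℕ × ℕ}
    (hp : p ∈ hub q (squareX n q i) (squareY n q i) (b 0) s (b j.succ) ++
      arm q (squareX n q i) (squareY n q i) (b 0) s (b j.succ) ++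
      tail q (squareX n q i) (squareY n q i) (b 0) s (b j.succ) o₁ o₂) :
    p.1 < n * (4 * (6 * q + 1)) ∧ p.2 < n * (4 * (6 * q + 1)) := by
  have h1 := inSquare_of_mem_path (b 0).2 (b j.succ).2 (embedding_val_ne b j) hs ho₁ ho₂ hp
  have h2 := square_le q hi
  omega

theorem mem_path_of_mem_arm {q x y b s t o₁ o₂ : ℕ} {p : ℕ × ℕ} (hp : p ∈ arm q x y b s t) :
    p ∈ hub q x y b s t ++ arm q x y b s t ++ tail q x y b s t o₁ o₂ :=
  List.mem_append_left _ (List.mem_append_right _ hp)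

theorem mem_path_of_mem_hub {q x y b s t o₁ o₂ : ℕ} {p : ℕ × ℕ} (hp : p ∈ hub q x y b s t) :
    p ∈ hub q x y b s t ++ arm q x y b s t ++ tail q x y b s t o₁ o₂ :=
  List.mem_append_left _ (List.mem_append_left _ hp)

theorem mem_path_of_mem_tail {q x y b s t o₁ o₂ : ℕ} {p : ℕ × ℕ}
    (hp : p ∈ tail q x y b s t o₁ o₂) :
    p ∈ hub q x y b s t ++ arm q x y b s t ++ tail q x y b s t o₁ o₂ :=
  List.mem_append_right _ hp

/-- The planting with `n ^ 2` squares and boxes of side `6 q + 1`. -/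
def planting (n q : ℕ) (hn : 1 ≤ n) (hq : 2 ≤ q) (hnq : n ≤ q) :
    Planting 6 (n * (4 * (6 * q + 1))) (n ^ 2) (3 * q) :=
  have hS : 0 < n * (4 * (6 * q + 1)) := by positivity
  have hside : squareSide (n * (4 * (6 * q + 1))) (n ^ 2) = 4 * (6 * q + 1) :=
    squareSide_eq hn _
  have hsq : ∀ s : Fin (3 * q / 3), s.val < q := fun s => by have := s.2; omega
  have ho : ∀ o : Fin (2 * (3 * q) + 1), o.val ≤ 6 * q := fun o => by have := o.2; omega
  { T := 4
    one_le_r := Nat.one_le_pow _ _ hn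
    r_le := by
      rw [sq]
      exact Nat.mul_le_mul_left _ (by omega)
    three_le_L := by omega
    six_L_le := by rw [hside]; omega
    four_le_T := le_rfl
    corner := fun i => (squareX n q i, squareY n q i)
    corner_le := fun i => by rw [hside]; exact square_le q i.2
    squares_disjoint := fun i i' h => by
      rw [hside]
      exact square_disjoint q _ fun h' => h (Fin.ext h')
    anchor := fun i t => (boxX q (squareX n q i) t, boxY q (squareY n q i) t)
    box_in_square := fun i t => by
      have := box_bounds q (squareX n q i) (squareY n q i) t.2
      rw [hside]
      dsimp only
      omega
    boxes_disjoint := fun i t t' h => by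
      have := box_order q (squareX n q i) (squareY n q i) t.2 t'.2 fun h' => h (Fin.ext h')
      refine Set.disjoint_left.2 ?_
      rintro v ⟨⟨h1, h2⟩, h3, h4⟩ ⟨⟨h1', h2'⟩, h3', h4'⟩
      dsimp only at *
      omega
    -- Four boxes of side 6q + 1 in a square of side 4(6q + 1): the inequality compares the factors
    -- 16 and 24.
    dense := by
      rw [hside]
      ring_nf
      nlinarith
    arm := fun i b s j => (arm q (squareX n q i) (squareY n q i) (b 0) s (b j.succ)).map
      (toGrid hS)
    hub := fun i b s j => (hub q (squareX n q i) (squareY n q i) (b 0) s (b j.succ)).map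
      (toGrid hS)
    tail := fun i b s j o =>
      (tail q (squareX n q i) (squareY n q i) (b 0) s (b j.succ) o.1 o.2).map (toGrid hS)
    arm_spec := fun i b s j => by
      have hb := (b 0).2
      have ht := (b j.succ).2
      have hne := embedding_val_ne b j
      have hlt : ∀ p ∈ arm q (squareX n q i) (squareY n q i) (b 0) s (b j.succ),
          p.1 < n * (4 * (6 * q + 1)) ∧ p.2 < n * (4 * (6 * q + 1)) := fun p hp =>
        lt_of_mem_path i.2 b (hsq s) j (Nat.zero_le _) (Nat.zero_le _) (mem_path_of_mem_arm hp)
      have hbox : ∀ t p, p ∈ arm q (squareX n q i) (squareY n q i) (b 0) s (b j.succ) →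
          (toGrid hS p ∈ Grid.block (n * (4 * (6 * q + 1)))
            (boxX q (squareX n q i) t, boxY q (squareY n q i) t) (2 * (3 * q) + 1) ↔
          InBox q (squareX n q i) (squareY n q i) t p) := fun t p hp => by
        rw [toGrid_mem_block_iff hS (hlt p hp), show 2 * (3 * q) + 1 = 6 * q + 1 by ring]
        exact Iff.rfl
      refine ⟨toGrid hS (exitCol q (squareX n q i) (b 0) (b j.succ),
          exitRow q (squareY n q i) (b 0) s (b j.succ)),
        (bridge q (squareX n q i) (squareY n q i) (b 0) s (b j.succ)).map (toGrid hS),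
        toGrid hS (entryCol q (squareX n q i) s (b j.succ),
          entryRow q (squareY n q i) (b 0) (b j.succ)), ?_, ?_, ?_, fun v hv => ?_⟩
      · rw [arm, List.map_cons, List.map_append, List.map_singleton]
      · exact (hbox _ _ List.mem_cons_self).2 (inBox_exit hb ht hne (hsq s))
      · exact (hbox _ _ (List.mem_cons_of_mem _ (List.mem_append_right _
          (List.mem_singleton_self _)))).2 (inBox_entry hb ht hne (hsq s))
      · obtain ⟨p, hp, rfl⟩ := List.mem_map.1 hv
        have hpa : p ∈ arm q (squareX n q i) (squareY n q i) (b 0) s (b j.succ) :=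
          List.mem_cons_of_mem _ (List.mem_append_left _ hp)
        refine ⟨?_, fun t h => not_inBox_of_mem_bridge hb ht hne (hsq s) hp (b t).2
          ((hbox _ _ hpa).1 h)⟩
        rw [hside, toGrid_mem_block_iff hS (hlt p hpa)]
        exact inSquare_of_mem_bridge hb ht hne (hsq s) hp
    stars_disjoint := fun i b s s' j j' h => by
      have hlt : ∀ (s : Fin (3 * q / 3)) (j : Fin 3),
          ∀ p ∈ arm q (squareX n q i) (squareY n q i) (b 0) s (b j.succ),
          p.1 < n * (4 * (6 * q + 1)) ∧ p.2 < n * (4 * (6 * q + 1)) := fun s j p hp =>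
        lt_of_mem_path i.2 b (hsq s) j (Nat.zero_le _) (Nat.zero_le _) (mem_path_of_mem_arm hp)
      have hss : s.val ≠ s'.val := fun h' => h (Fin.ext h')
      refine disjoint_map_toGrid hS ?_ (hlt s j) (hlt s' j')
      rcases Nat.lt_or_gt_of_ne hss with h' | h'
      · exact disjoint_arm (b 0).2 (b j.succ).2 (embedding_val_ne b j) (b j'.succ).2
          (embedding_val_ne b j') (hsq s) (hsq s') (Or.inl h')
      · exact (disjoint_arm (b 0).2 (b j'.succ).2 (embedding_val_ne b j') (b j.succ).2
          (embedding_val_ne b j) (hsq s') (hsq s) (Or.inl h')).symm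
    -- Three arms of length at most twice the side of the square; this is where κ = 6 comes from.
    length_le := fun i b s => by
      rw [hside]
      calc _ ≤ ∑ _j : Fin 3, 2 * (4 * (6 * q + 1)) := Finset.sum_le_sum fun j _ => by
            rw [List.length_map]
            exact length_arm_le _ _ (b 0).2 (b j.succ).2 (embedding_val_ne b j) (hsq s)
        _ = _ := by
            rw [Finset.sum_const, Finset.card_univ, Fintype.card_fin, smul_eq_mul]
            ring
    hub_in_box := fun i b s j v hv => by
      obtain ⟨p, hp, rfl⟩ := List.mem_map.1 hv
      rw [toGrid_mem_block_iff hS (lt_of_mem_path i.2 b (hsq s) j (Nat.zero_le _)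
        (Nat.zero_le _) (mem_path_of_mem_hub hp)), show 2 * (3 * q) + 1 = 6 * q + 1 by ring]
      exact inBox_of_mem_hub (b 0).2 (b j.succ).2 (embedding_val_ne b j) (hsq s) hp
    tail_in_box := fun i b s j o v hv => by
      obtain ⟨p, hp, rfl⟩ := List.mem_map.1 hv
      rw [toGrid_mem_block_iff hS (lt_of_mem_path i.2 b (hsq s) j (ho _) (ho _)
        (mem_path_of_mem_tail hp)), show 2 * (3 * q) + 1 = 6 * q + 1 by ring]
      exact inBox_of_mem_tail (b 0).2 (b j.succ).2 (embedding_val_ne b j) (hsq s) (ho _) (ho _) hp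
    isPath := fun i b s j o => by
      rw [← List.map_append, ← List.map_append]
      refine isPath_map_toGrid hS (nodup_path (b 0).2 (b j.succ).2 (embedding_val_ne b j)
        (hsq s) (ho _) (ho _)) ?_ fun p hp => lt_of_mem_path i.2 b (hsq s) j (ho _) (ho _) hp
      rw [List.append_assoc]
      exact (walks_path _ _ (b 0).2 (b j.succ).2 (embedding_val_ne b j) (hsq s) _ _).isChain
    path_last := fun i b s j o => by
      have hw := (walks_path (squareX n q i) (squareY n q i) (b 0).2 (b j.succ).2
        (embedding_val_ne b j) (hsq s) o.1 o.2).getLast?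
      rw [← List.cons_append, ← List.append_assoc] at hw
      have hlt := lt_of_mem_path i.2 b (hsq s) j (ho o.1) (ho o.2) (List.mem_of_getLast? hw)
      refine ⟨toGrid hS (boxX q (squareX n q i) (b j.succ) + o.1,
        boxY q (squareY n q i) (b j.succ) + o.2), ?_, toGrid_val hS hlt.1 hlt.2⟩
      rw [← List.map_append, ← List.map_append, List.getLast?_map]
      exact Option.mem_map_of_mem _ hw
    paths_disjoint := fun i b s j j' o o' h => by
      rw [← List.map_append, ← List.map_append, ← List.map_append, ← List.map_append]
      exact disjoint_map_toGrid hS (disjoint_path (b 0).2 (b j.succ).2 (embedding_val_ne b j)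
        (b j'.succ).2 (embedding_val_ne b j') (hsq s) (embedding_succ_val_ne b h) (ho _) (ho _)
        (ho _) (ho _)) (fun p hp => lt_of_mem_path i.2 b (hsq s) j (ho _) (ho _) hp)
        (fun p hp => lt_of_mem_path i.2 b (hsq s) j' (ho _) (ho _) hp) }

end Layout

/-! ### The planted paths form stars -/

namespace Layout

theorem rank_lt (b t : ℕ) : rank b t < 3 := by
  unfold rank
  split_ifs <;> omega

theorem rank_injOn {b t t' : ℕ} (ht : t < 4) (ht' : t' < 4) (hbt : b ≠ t) (hbt' : b ≠ t')
    (hb : b < 4) (h : rank b t = rank b t') : t = t' := by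
  unfold rank median at h
  split_ifs at h <;> omega

/-- The order of the three paths of a star at the hub. -/
noncomputable def rankPerm (b : Fin 4 ↪ Fin 4) : Equiv.Perm (Fin 3) :=
  Equiv.ofBijective (fun j => ⟨rank (b 0) (b j.succ), rank_lt _ _⟩)
    (Finite.injective_iff_bijective.1 fun j j' h => by
      by_contra hne
      exact embedding_succ_val_ne b hne (rank_injOn (b j.succ).2 (b j'.succ).2
        (embedding_val_ne b j) (embedding_val_ne b j') (b 0).2 (Fin.ext_iff.1 h)))

variable {n q : ℕ} (hn : 1 ≤ n) (hq : 2 ≤ q) (hnq : n ≤ q)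

theorem length_pathAt_planting_le (i : Fin (n ^ 2)) (y : (planting n q hn hq hnq).Pos)
    (j : Fin 3) : ((planting n q hn hq hnq).pathAt i y j).length ≤ 7 * (4 * (6 * q + 1)) := by
  obtain ⟨b, o, s⟩ := y
  change Fin 4 ↪ Fin 4 at b
  change Fin (3 * q / 3) at s
  have hs : s.val < q := by have := s.2; omega
  have h1 : (o j).1.val ≤ 6 * q := by have := (o j).1.2; omega
  have h2 : (o j).2.val ≤ 6 * q := by have := (o j).2.2; omega
  have h := length_path_le (squareX n q i) (squareY n q i) (b 0).2 (b j.succ).2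
    (embedding_val_ne b j) hs h1 h2
  rw [Planting.pathAt]
  simp only [planting, List.length_append, List.length_map] at h ⊢
  exact h

theorem next_toGrid {S : ℕ} (hS : 0 < S) {p p' : ℕ × ℕ} (hp : p.1 < S ∧ p.2 < S)
    (hp' : p'.1 < S ∧ p'.2 < S) :
    (p.2 = p'.2 → p'.1 + 1 = p.1 → Grid.Next Dir.left (toGrid hS p) (toGrid hS p')) ∧
    (p.2 = p'.2 → p.1 + 1 = p'.1 → Grid.Next Dir.right (toGrid hS p) (toGrid hS p')) ∧
    (p.1 = p'.1 → p'.2 + 1 = p.2 → Grid.Next Dir.down (toGrid hS p) (toGrid hS p')) ∧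
    (p.1 = p'.1 → p.2 + 1 = p'.2 → Grid.Next Dir.up (toGrid hS p) (toGrid hS p')) := by
  have h1 := toGrid_val hS hp.1 hp.2
  have h2 := toGrid_val hS hp'.1 hp'.2
  simp only [Grid.Next, Fin.ext_iff, h1.1, h1.2, h2.1, h2.2]
  omega

/-- The paths of rank 0, 1, 2 start at the lower, middle and upper hub vertex and leave downwards,
sideways and upwards. `Dir.ghzPort` assigns exactly these directions to the three shares of the
triple. -/
theorem isStar_planting (c : (planting n q hn hq hnq).Instance) (i : Fin (n ^ 2)) :
    Grid.IsStar fun j => (planting n q hn hq hnq).path c i j := by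
  have hS : 0 < n * (4 * (6 * q + 1)) := by positivity
  obtain ⟨b, hb⟩ : ∃ b : Fin 4 ↪ Fin 4, b = (c i).1 := ⟨_, rfl⟩
  obtain ⟨s, hs⟩ : ∃ s : Fin (3 * q / 3), s = (c i).2.2.1 := ⟨_, rfl⟩
  have hsq : s.val < q := by have := s.2; omega
  have hpath : ∀ j, ∃ p : ℕ × ℕ, (∃ l, (planting n q hn hq hnq).path c i j =
      toGrid hS (hubCol q (squareX n q i) (b 0),
        hubRow q (squareY n q i) (b 0) s + rank (b 0) (b j.succ)) :: toGrid hS p :: l) ∧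
      (p.1 < n * (4 * (6 * q + 1)) ∧ p.2 < n * (4 * (6 * q + 1))) ∧
      ((rank (b 0) (b j.succ) = 0 ∧ p.1 = hubCol q (squareX n q i) (b 0) ∧
          p.2 + 1 = hubRow q (squareY n q i) (b 0) s) ∨
        (rank (b 0) (b j.succ) = 1 ∧ p.2 = hubRow q (squareY n q i) (b 0) s + 1 ∧
          (p.1 = hubCol q (squareX n q i) (b 0) + 1 ∨
            p.1 + 1 = hubCol q (squareX n q i) (b 0))) ∨
        (rank (b 0) (b j.succ) = 2 ∧ p.1 = hubCol q (squareX n q i) (b 0) ∧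
          p.2 = hubRow q (squareY n q i) (b 0) s + 3)) := by
    intro j
    obtain ⟨p, l, hpl, hp⟩ := exists_hub_eq (squareX n q i) (squareY n q i) (b 0).2 (b j.succ).2
      (embedding_val_ne b j) hsq hq
    refine ⟨p, ?_, lt_of_mem_path i.2 b hsq j (Nat.zero_le _) (Nat.zero_le _)
      (mem_path_of_mem_hub ?_), hp⟩
    · rw [Planting.path, ← hb, ← hs]
      simp only [planting]
      rw [hpl]
      exact ⟨_, rfl⟩
    · rw [hpl]
      exact List.mem_cons_of_mem _ List.mem_cons_self
  have hlen : ∀ j, 1 < ((planting n q hn hq hnq).path c i j).length := fun j => by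
    obtain ⟨p, ⟨l, h⟩, -⟩ := hpath j
    rw [h]
    simp
  have hlt : ∀ k : ℕ, k ≤ 2 → hubCol q (squareX n q i) (b 0) < n * (4 * (6 * q + 1)) ∧
      hubRow q (squareY n q i) (b 0) s + k < n * (4 * (6 * q + 1)) := fun k hk => by
    have h1 := square_le q i.2
    have h2 := box_bounds q (squareX n q i) (squareY n q i) (b 0).2
    have h3 := hubRow_bounds (squareY n q i) (b 0) hsq
    unfold hubCol
    omega
  refine ⟨fun j => (planting n q hn hq hnq).isPath i _ _ j _, hlen, fun j j' h =>
    (planting n q hn hq hnq).paths_disjoint i _ _ j j' _ _ h,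
    ⟨fun k => toGrid hS (hubCol q (squareX n q i) (b 0),
      hubRow q (squareY n q i) (b 0) s + k.val),
      (next_toGrid hS (hlt 0 (by omega)) (hlt 1 (by omega))).2.2.2 rfl rfl,
      (next_toGrid hS (hlt 1 (by omega)) (hlt 2 (by omega))).2.2.2 rfl rfl⟩,
    rankPerm b, fun j => ?_⟩
  obtain ⟨p, ⟨l, hpl⟩, hpS, hp⟩ := hpath j
  have hr := rank_lt (b 0) (b j.succ)
  have h01 : ∀ (m : List (Grid (n * (4 * (6 * q + 1))))) (v w) (hm : 1 < m.length),
      m = v :: w :: l → m[0] = v ∧ m[1] = w := by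
    rintro m v w hm rfl
    exact ⟨rfl, rfl⟩
  obtain ⟨h0, h1⟩ := h01 _ _ _ (hlen j) hpl
  rw [h0, h1]
  refine ⟨rfl, ?_⟩
  have hn := next_toGrid hS (p := (hubCol q (squareX n q i) (b 0),
    hubRow q (squareY n q i) (b 0) s + rank (b 0) (b j.succ)))
    (hlt (rank (b 0) (b j.succ)) (by omega)) hpS
  rcases hp with ⟨h, h2, h3⟩ | ⟨h, h2, h3⟩ | ⟨h, h2, h3⟩
  · rw [(hn.2.2.1 h2.symm (by dsimp only; omega)).dir_eq,
      show rankPerm b j = 0 from Fin.ext h]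
    rfl
  · rw [show rankPerm b j = 1 from Fin.ext h]
    rcases h3 with h3 | h3
    · rw [(hn.2.1 (by dsimp only; omega) h3.symm).dir_eq]
      rfl
    · rw [(hn.1 (by dsimp only; omega) h3).dir_eq]
      rfl
  · rw [(hn.2.2.2 h2.symm (by dsimp only; omega)).dir_eq,
      show rankPerm b j = 2 from Fin.ext h]
    rfl

end Layout

/-! ### The parameters -/

namespace Layout

/-- The number of squares in each direction. -/
def squares (N : ℕ) : ℕ := Nat.sqrt (Nat.sqrt N) + 1

theorem lt_squares_pow (N : ℕ) : N < squares N ^ 4 := by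
  have h1 := Nat.lt_succ_sqrt N
  have h2 := Nat.lt_succ_sqrt (Nat.sqrt N)
  have h3 : Nat.sqrt N + 1 ≤ squares N * squares N := h2
  calc N < (Nat.sqrt N + 1) * (Nat.sqrt N + 1) := h1
    _ ≤ (squares N * squares N) * (squares N * squares N) := Nat.mul_le_mul h3 h3
    _ = _ := by ring

theorem squares_pow_le {N : ℕ} (hN : 1 ≤ N) : squares N ^ 4 ≤ 16 * N := by
  obtain ⟨k, hk⟩ : ∃ k, k = Nat.sqrt (Nat.sqrt N) := ⟨_, rfl⟩
  have h1 : 1 ≤ k := by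
    rw [hk]
    exact Nat.sqrt_pos.2 (Nat.sqrt_pos.2 hN)
  have h2 : k * k ≤ Nat.sqrt N := by
    rw [hk]
    exact Nat.sqrt_le _
  have h3 : k + 1 ≤ 2 * k := by omega
  rw [squares, ← hk]
  calc (k + 1) ^ 4 ≤ (2 * k) ^ 4 := Nat.pow_le_pow_left h3 4
    _ = 16 * ((k * k) * (k * k)) := by ring
    _ ≤ 16 * (Nat.sqrt N * Nat.sqrt N) := Nat.mul_le_mul_left _ (Nat.mul_le_mul h2 h2)
    _ ≤ 16 * N := Nat.mul_le_mul_left _ (Nat.sqrt_le N)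

theorem one_le_squares (N : ℕ) : 1 ≤ squares N := Nat.le_add_left _ _

/-- A third of the box parameter. -/
def boxes (N : ℕ) : ℕ := 2 * squares N ^ 3

theorem two_le_boxes (N : ℕ) : 2 ≤ boxes N := by
  have := Nat.one_le_pow 3 _ (one_le_squares N)
  unfold boxes
  omega

theorem squares_le_boxes (N : ℕ) : squares N ≤ boxes N := by
  have := Nat.le_self_pow (n := 3) (by omega) (squares N)
  unfold boxes
  omega

/-- The planting that belongs to `N`. -/
def family (N : ℕ) : Planting 6 (squares N * (4 * (6 * boxes N + 1))) (squares N ^ 2)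
    (3 * boxes N) :=
  planting (squares N) (boxes N) (one_le_squares N) (two_le_boxes N) (squares_le_boxes N)

/-- With n = `squares N`, the side is 48 n^4 + 4 n and n ≤ n^4 ≤ 16 N; the constant is 48·16 + 4·16.
-/
theorem side_le {N : ℕ} (hN : 1 ≤ N) : squares N * (4 * (6 * boxes N + 1)) ≤ 832 * N := by
  have h1 := squares_pow_le hN
  have h2 := Nat.le_self_pow (n := 4) (by omega) (squares N)
  calc squares N * (4 * (6 * boxes N + 1)) = 48 * squares N ^ 4 + 4 * squares N := by
        unfold boxes
        ring
    _ ≤ 832 * N := by omega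

/-- The light cones of a circuit of logarithmic depth are small. -/
theorem fanIn_pow_le {K d N : ℕ} (hN : 42 ^ 8 ≤ N)
    (hd : (d : ℝ) ≤ 1 / (8 * (Real.log (K + 1) + 1)) * Real.log N) :
    42 * (K + 1) ^ d ≤ squares N := by
  have hK : 0 ≤ Real.log (K + 1) := Real.log_nonneg (by
    have : (0 : ℝ) ≤ K := Nat.cast_nonneg K
    linarith)
  have hN1 : (1 : ℝ) ≤ N := by exact_mod_cast (show 1 ≤ N by omega)
  have hlog : 0 ≤ Real.log N := Real.log_nonneg hN1
  have h1 : 8 * (d * Real.log (K + 1)) ≤ Real.log N := by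
    rw [one_div_mul_eq_div, le_div_iff₀ (by positivity)] at hd
    have : (0 : ℝ) ≤ d := Nat.cast_nonneg d
    nlinarith
  -- The depth constant is chosen to make the light cones no larger than N^(1/8).
  have h2 : ((K + 1) ^ d) ^ 8 ≤ N := by
    have : (((K : ℝ) + 1) ^ d) ^ 8 ≤ N := by
      rw [← Real.log_le_log_iff (by positivity) (by linarith), Real.log_pow, Real.log_pow]
      exact_mod_cast h1
    exact_mod_cast this
  have h3 := lt_squares_pow N
  -- Otherwise n^8 ≤ 42^8 · ((K+1)^d)^8 ≤ N·N for n = `squares N`, against N < n^4.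
  by_contra h
  have h4 : squares N ^ 8 ≤ N * N := by
    have := Nat.pow_le_pow_left (le_of_lt (not_le.1 h)) 8
    rw [mul_pow] at this
    exact this.trans (Nat.mul_le_mul hN h2)
  have h5 : N * N < squares N ^ 8 := by
    calc N * N < squares N ^ 4 * squares N ^ 4 := Nat.mul_lt_mul'' h3 h3
      _ = _ := by ring
  omega

/-- With n = `squares N`, there are n^2 copies, the paths have length at most 28(6q + 1), and the
light cones have size at most n/42, so the required bound becomes 12 n^3 (6q + 1) ≤ (6q + 1)^2. The
choice q = 2 n^3 makes the left side 6q(6q + 1). -/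
theorem winProb_family_le {K m N : ℕ} (hN : 42 ^ 8 ≤ N) (ρ : PMF (Fin m → Letter))
    (D : ClassicalCircuit Letter (Grid (squares N * (4 * (6 * boxes N + 1))) ⊕ Fin m)
      (Grid (squares N * (4 * (6 * boxes N + 1)))) K)
    (hd : (D.depth : ℝ) ≤ 1 / (8 * (Real.log (K + 1) + 1)) * Real.log N) :
    (family N).game.winProb (classicalBehavior ρ D) ≤ (7 / 8) ^ (squares N ^ 2) := by
  refine (family N).winProb_classicalBehavior_le ρ D (Λ := 7 * (4 * (6 * boxes N + 1)))
    (length_pathAt_planting_le _ _ _) ?_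
  have h := fanIn_pow_le hN hd
  calc 18 * (squares N ^ 2 * (7 * (4 * (6 * boxes N + 1)) * (K + 1) ^ D.depth))
      = 12 * squares N ^ 2 * (42 * (K + 1) ^ D.depth) * (6 * boxes N + 1) := by ring
    _ ≤ 12 * squares N ^ 2 * squares N * (6 * boxes N + 1) := by gcongr
    _ = 6 * boxes N * (6 * boxes N + 1) := by
        unfold boxes
        ring
    _ ≤ (2 * (3 * boxes N) + 1) ^ 2 := by
        rw [sq, ← mul_assoc]
        exact Nat.mul_le_mul_right _ (Nat.le_succ _)

/-- The number of copies is at least √N, so the exponent only has to satisfy η ≤ 1/2. -/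
theorem pow_squares_le_exp {η : ℝ} (hη : η < 1 / 7) {N : ℕ} (hN : 1 ≤ N) :
    (7 / 8 : ℝ) ^ (squares N ^ 2) ≤ Real.exp (-(Real.log (8 / 7) * (N : ℝ) ^ η)) := by
  have hN1 : (1 : ℝ) ≤ N := by exact_mod_cast hN
  have hlog : 0 ≤ Real.log (8 / 7) := Real.log_nonneg (by norm_num)
  have h1 : (N : ℝ) ^ η ≤ (squares N ^ 2 : ℕ) := by
    calc (N : ℝ) ^ η ≤ (N : ℝ) ^ (1 / 2 : ℝ) :=
          Real.rpow_le_rpow_of_exponent_le hN1 (by linarith)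
      _ = Real.sqrt N := (Real.sqrt_eq_rpow _).symm
      _ ≤ (squares N ^ 2 : ℕ) := by
          rw [Real.sqrt_le_left (by positivity)]
          have h : N ≤ (squares N ^ 2) ^ 2 := by
            rw [← pow_mul]
            exact (lt_squares_pow N).le
          exact_mod_cast h
  have h2 : (7 / 8 : ℝ) = Real.exp (-Real.log (8 / 7)) := by
    rw [Real.exp_neg, Real.exp_log (by norm_num)]
    norm_num
  rw [h2, ← Real.exp_nat_mul, Real.exp_le_exp]
  nlinarith

end Layout

theorem mainTheorem2 :
    ∃ (C κ a K₀ R : ℕ) (side r L : ℕ → ℕ) (P : ∀ N : ℕ, Planting κ (side N) (r N) (L N)),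
      (∀ N : ℕ, 1 ≤ N → side N ≤ C * N) ∧
      (∀ N : ℕ, 1 ≤ N → ∃ Q : QCircuit (side N) a,
        Q.depth ≤ 3 ∧ Q.FanIn K₀ ∧ Q.GeometricallyLocal R ∧
        (P N).game.winProb Q.behavior = 1) ∧
      (∀ (K : ℕ) (η : ℝ), η < 1 / 7 → ∃ c : ℝ, 0 < c ∧ ∃ δ : ℝ, 0 < δ ∧ ∃ N₀ : ℕ,
        ∀ N : ℕ, N₀ ≤ N → ∀ (m : ℕ) (ρ : PMF (Fin m → Letter))
          (D : ClassicalCircuit Letter (Grid (side N) ⊕ Fin m) (Grid (side N)) K),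
          (D.depth : ℝ) ≤ c * Real.log N →
          (P N).game.winProb (classicalBehavior ρ D) ≤ Real.exp (-(δ * (N : ℝ) ^ η))) := by
  -- Seven ancillas per vertex: halves of up to four Bell pairs and up to three GHZ shares.
  refine ⟨832, 6, 7, 15, 2, fun N => Layout.squares N * (4 * (6 * Layout.boxes N + 1)),
    fun N => Layout.squares N ^ 2, fun N => 3 * Layout.boxes N, Layout.family,
    fun N hN => Layout.side_le hN, fun N _ => ⟨teleportCircuit _, ?_, fanIn_teleportCircuit,
      geometricallyLocal_teleportCircuit,
      (Layout.family N).winProb_teleportCircuit (Layout.isStar_planting _ _ _)⟩,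
    -- The summand 1 avoids a zero denominator for K = 0; log(8/7) is the decay rate per copy.
    fun K η hη => ⟨1 / (8 * (Real.log (K + 1) + 1)), ?_, Real.log (8 / 7),
      Real.log_pos (by norm_num), 42 ^ 8, fun N hN m ρ D hd =>
      (Layout.winProb_family_le hN ρ D hd).trans
        (Layout.pow_squares_le_exp hη (by omega))⟩⟩
  · exact depth_teleportCircuit
  · have hK : 0 ≤ Real.log ((K : ℝ) + 1) := Real.log_nonneg (by
      have : (0 : ℝ) ≤ K := Nat.cast_nonneg K
      linarith)
    positivity
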